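/- Let $\Delta$ be a triangulation of a region $\Omega\subset\mathbb R^2$, i.e. a finite set of nondegenerate closed triangles with union $\Omega$, any two distinct ones of which intersect in a common edge, in a common vertex, or not at all. The Powell–Sabin 12-split of a triangle is obtained by joining its barycenter to its three corners and to its three edge midpoints, and joining the three edge midpoints to each other; $\Delta_{12}$ denotes the refinement of $\Delta$ in which every triangle is replaced by its 12-split. Let $\mathcal S_{12}$ be the space of functions $s:\Omega\to\mathbb R$ that coincide with a polynomial of degree at most $5$ on every triangle of $\Delta_{12}$, are $C^2$ on $\Omega$, are $C^3$ on every triangle of $\Delta$, and are three times differentiable at every vertex of $\Delta$. For every edge $e=\langle v,v'\rangle$ of $\Delta$ choose directions that are not parallel to $e$, one at the midpoint $(v+v')/2$ and one at each of the two quarterpoints $(3v+v')/4$, $(v+3v')/4$. Let $\Lambda_{12}$ be the set of the following linear functionals on $\mathcal S_{12}$: - for every vertex $v$ of $\Delta$, the ten functionals $s\mapsto \partial_x^{i}\partial_y^{j}s(v)$ with $i+j\le 3$; - for every edge $e$ of $\Delta$, the first-order derivative $s\mapsto\nabla_u s(w)$ at the midpoint $w$ of $e$, with $u$ the direction chosen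 there; - for every edge $e$ of $\Delta$ and each quarterpoint $q$ of $e$, the second-order derivative $s\mapsto\nabla_u\nabla_u s(q)$, with $u$ the direction chosen there. A linear functional on $\mathcal S_{12}$ is *nodal* with carrier $x\in\Omega$ if it is a linear combination of values and derivatives at $x$ that exist for every $s\in\mathcal S_{12}$. A set $\Lambda$ of nodal functionals is a *nodal determining set* if $s=0$ is the only $s\in\mathcal S_{12}$ with $\lambda s=0$ for all $\lambda\in\Lambda$; it is *minimal* if no nodal determining set has smaller cardinality. **Theorem.** $\Lambda_{12}$ is a nodal minimal determining set for $\mathcal S_{12}$. For every triangle $T$ of $\Delta$ exactly $39$ of the functionals in $\Lambda_{12}$ listed above have their point of evaluation in $T$, and the restriction $s|_T$ of any $s\in\mathcal S_{12}$ is uniquely determined by the values of these $39$ functionals. Hence $\mathcal S_{12}$ is a macro-element space: $\Lambda_{12}$ is a basis of the dual space of $\mathcal S_{12}$, and $\mathcal S_{12}$ has a nodal basis, i.e. a basis dual to $\Lambda_{12}$. -/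

import Mathlib

open Set Topology

noncomputable section

namespace PowellSabin

/-- The Euclidean plane. -/
abbrev Plane : Type := EuclideanSpace ℝ (Fin 2)

/-! ### Derivatives of functions defined on a planar region

A function on a region `Ω` is represented by a function on the plane; all smoothness notions
and derivatives below are taken within `Ω`. The regions that occur are finite unions of closed
triangles, so that derivatives within `Ω` are unique. -/

/-- `f : Ω → ℝ` is `k` times differentiable at `x`: for `k = j + 1` this means that `f` is `C^j`
near `x` and that its `j`-th derivative is differentiable at `x`. -/
def TimesDiffWithinAt : ℕ → (Plane → ℝ) → Set Plane → Plane → Prop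
  | 0, _, _, _ => True
  | j + 1, f, Ω, x =>
      ContDiffWithinAt ℝ j f Ω x ∧ DifferentiableWithinAt ℝ (iteratedFDerivWithin ℝ j f Ω) Ω x

theorem TimesDiffWithinAt.of_contDiffOn {k : ℕ} {f : Plane → ℝ} {Ω : Set Plane} {x : Plane}
    (hΩ : UniqueDiffOn ℝ Ω) (hx : x ∈ Ω) (h : ContDiffOn ℝ k f Ω) :
    TimesDiffWithinAt k f Ω x := by
  cases k with
  | zero => trivial
  | succ j =>
    refine ⟨(h x hx).of_le (by exact_mod_cast Nat.le_succ j), ?_⟩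
    exact h.differentiableOn_iteratedFDerivWithin (by exact_mod_cast Nat.lt_succ_self j) hΩ x hx

theorem iteratedFDerivWithin_eventually_add {j : ℕ} {f g : Plane → ℝ} {Ω : Set Plane} {x : Plane}
    (hΩ : UniqueDiffOn ℝ Ω) (hx : x ∈ Ω)
    (hf : ContDiffWithinAt ℝ j f Ω x) (hg : ContDiffWithinAt ℝ j g Ω x) :
    iteratedFDerivWithin ℝ j (f + g) Ω =ᶠ[𝓝[Ω] x]
      (iteratedFDerivWithin ℝ j f Ω + iteratedFDerivWithin ℝ j g Ω) := by
  have h := (hf.eventually (by simp)).and (hg.eventually (by simp))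
  rw [insert_eq_of_mem hx] at h
  filter_upwards [h, self_mem_nhdsWithin] with y hy hyΩ
  exact iteratedFDerivWithin_add_apply hy.1 hy.2 hΩ hyΩ

theorem iteratedFDerivWithin_eventually_smul {j : ℕ} {f : Plane → ℝ} {Ω : Set Plane} {x : Plane}
    (hΩ : UniqueDiffOn ℝ Ω) (hx : x ∈ Ω) (c : ℝ) (hf : ContDiffWithinAt ℝ j f Ω x) :
    iteratedFDerivWithin ℝ j (c • f) Ω =ᶠ[𝓝[Ω] x] (c • iteratedFDerivWithin ℝ j f Ω) := by
  have h := hf.eventually (by simp)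
  rw [insert_eq_of_mem hx] at h
  filter_upwards [h, self_mem_nhdsWithin] with y hy hyΩ
  exact iteratedFDerivWithin_const_smul_apply hy hΩ hyΩ

theorem TimesDiffWithinAt.add {k : ℕ} {f g : Plane → ℝ} {Ω : Set Plane} {x : Plane}
    (hΩ : UniqueDiffOn ℝ Ω) (hx : x ∈ Ω)
    (hf : TimesDiffWithinAt k f Ω x) (hg : TimesDiffWithinAt k g Ω x) :
    TimesDiffWithinAt k (f + g) Ω x := by
  cases k with
  | zero => trivial
  | succ j =>
    refine ⟨hf.1.add hg.1, ?_⟩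
    have e := iteratedFDerivWithin_eventually_add hΩ hx hf.1 hg.1
    exact (hf.2.add hg.2).congr_of_eventuallyEq e (e.self_of_nhdsWithin hx)

theorem TimesDiffWithinAt.smul {k : ℕ} {f : Plane → ℝ} {Ω : Set Plane} {x : Plane}
    (hΩ : UniqueDiffOn ℝ Ω) (hx : x ∈ Ω) (c : ℝ) (hf : TimesDiffWithinAt k f Ω x) :
    TimesDiffWithinAt k (c • f) Ω x := by
  cases k with
  | zero => trivial
  | succ j =>
    refine ⟨hf.1.const_smul c, ?_⟩
    have e := iteratedFDerivWithin_eventually_smul hΩ hx c hf.1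
    exact (hf.2.const_smul c).congr_of_eventuallyEq e (e.self_of_nhdsWithin hx)

/-- The derivative `∇_{u 0} ∇_{u 1} ⋯ ∇_{u (k-1)} f (x)` of a function `f` on `Ω`
(for `k = 0` it is the value `f x`). -/
def dirDeriv (Ω : Set Plane) (x : Plane) {k : ℕ} (u : Fin k → Plane) (f : Plane → ℝ) : ℝ :=
  iteratedFDerivWithin ℝ k f Ω x u

theorem dirDeriv_add {Ω : Set Plane} {x : Plane} {k : ℕ} (u : Fin k → Plane) {f g : Plane → ℝ}
    (hΩ : UniqueDiffOn ℝ Ω) (hx : x ∈ Ω)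
    (hf : TimesDiffWithinAt k f Ω x) (hg : TimesDiffWithinAt k g Ω x) :
    dirDeriv Ω x u (f + g) = dirDeriv Ω x u f + dirDeriv Ω x u g := by
  cases k with
  | zero => simp [dirDeriv]
  | succ j =>
    have e := iteratedFDerivWithin_eventually_add hΩ hx hf.1 hg.1
    simp only [dirDeriv, iteratedFDerivWithin_succ_apply_left]
    rw [e.fderivWithin_eq (e.self_of_nhdsWithin hx), fderivWithin_add (hΩ x hx) hf.2 hg.2]
    rfl

theorem dirDeriv_smul {Ω : Set Plane} {x : Plane} {k : ℕ} (u : Fin k → Plane) {f : Plane → ℝ}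
    (hΩ : UniqueDiffOn ℝ Ω) (hx : x ∈ Ω) (c : ℝ) (hf : TimesDiffWithinAt k f Ω x) :
    dirDeriv Ω x u (c • f) = c * dirDeriv Ω x u f := by
  cases k with
  | zero => simp [dirDeriv]
  | succ j =>
    have e := iteratedFDerivWithin_eventually_smul hΩ hx c hf.1
    simp only [dirDeriv, iteratedFDerivWithin_succ_apply_left]
    rw [e.fderivWithin_eq (e.self_of_nhdsWithin hx), fderivWithin_const_smul (hΩ x hx) hf.2]
    rfl

/-! ### Nodal functionals and macro-element spaces -/

/-- A linear functional `ℓ` on a space `S` of functions on `Ω` is nodal with carrier `x` if it is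
a linear combination of values and derivatives at `x`, all of which exist for every
member of `S`. -/
def IsNodalAt (Ω : Set Plane) (S : Submodule ℝ (Plane → ℝ)) (x : Plane)
    (ℓ : Module.Dual ℝ S) : Prop :=
  ℓ ∈ Submodule.span ℝ {μ : Module.Dual ℝ S | ∃ (k : ℕ) (u : Fin k → Plane),
    (∀ s ∈ S, TimesDiffWithinAt k s Ω x) ∧ ∀ s : S, μ s = dirDeriv Ω x u s}

/-- A nodal functional on `S`, together with its carrier. -/
structure NodalFunctional (Ω : Set Plane) (S : Submodule ℝ (Plane → ℝ)) where
  /-- the carrier -/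
  carrier : Plane
  /-- the linear functional -/
  functional : Module.Dual ℝ S
  carrier_mem : carrier ∈ Ω
  isNodal : IsNodalAt Ω S carrier functional

/-- `Λ` is a nodal determining set: the functionals in `Λ` vanish simultaneously only at `0`. -/
def IsNodalDeterminingSet {Ω : Set Plane} {S : Submodule ℝ (Plane → ℝ)}
    (Λ : Set (NodalFunctional Ω S)) : Prop :=
  ∀ s : S, (∀ ℓ ∈ Λ, ℓ.functional s = 0) → s = 0

/-- `Λ` is a nodal minimal determining set: no nodal determining set is smaller. -/
def IsNodalMinimalDeterminingSet {Ω : Set Plane} {S : Submodule ℝ (Plane → ℝ)}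
    (Λ : Set (NodalFunctional Ω S)) : Prop :=
  IsNodalDeterminingSet Λ ∧
    ∀ Λ' : Set (NodalFunctional Ω S), IsNodalDeterminingSet Λ' → Λ.encard ≤ Λ'.encard

/-- The single functional `s ↦ ∇_{u 0} ⋯ ∇_{u (k-1)} s (x)`, for a space `S` all of whose members
are `k` times differentiable at `x`. -/
def NodalFunctional.ofDirDeriv {Ω : Set Plane} (hΩ : UniqueDiffOn ℝ Ω)
    {S : Submodule ℝ (Plane → ℝ)} (x : Plane) (hx : x ∈ Ω) {k : ℕ} (u : Fin k → Plane)
    (h : ∀ s ∈ S, TimesDiffWithinAt k s Ω x) : NodalFunctional Ω S where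
  carrier := x
  functional :=
    { toFun := fun s => dirDeriv Ω x u s
      map_add' := fun s t => dirDeriv_add u hΩ hx (h s s.2) (h t t.2)
      map_smul' := fun c s => dirDeriv_smul u hΩ hx c (h s s.2) }
  carrier_mem := hx
  isNodal := Submodule.subset_span ⟨k, u, h, fun _ => rfl⟩

/-! ### Triangulations -/

/-- A (finite) triangulation of a planar region: nondegenerate triangles, given by their sets of
corners, any two of which meet only in the convex hull of their common corners, that is, in a
common edge, in a common vertex, or not at all. -/
structure Triangulation where
  /-- the triangles, as sets of three corners -/
  triangles : Finset (Finset Plane)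
  card_eq : ∀ t ∈ triangles, t.card = 3
  indep : ∀ t ∈ triangles, AffineIndependent ℝ ((↑) : t → Plane)
  inter : ∀ t ∈ triangles, ∀ t' ∈ triangles,
    convexHull ℝ (t : Set Plane) ∩ convexHull ℝ (t' : Set Plane)
      ⊆ convexHull ℝ ((t : Set Plane) ∩ (t' : Set Plane))

namespace Triangulation

/-- The region `Ω` covered by the triangulation. -/
def region (Δ : Triangulation) : Set Plane :=
  {x | ∃ t ∈ Δ.triangles, x ∈ convexHull ℝ (t : Set Plane)}

/-- The vertices of the triangulation. -/
def vertices (Δ : Triangulation) : Set Plane :=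
  {v | ∃ t ∈ Δ.triangles, v ∈ t}

/-- The edges of the triangulation, as sets of two endpoints. -/
def edges (Δ : Triangulation) : Set (Finset Plane) :=
  {e | e.card = 2 ∧ ∃ t ∈ Δ.triangles, e ⊆ t}

theorem convexHull_subset_region (Δ : Triangulation) {t : Finset Plane} (ht : t ∈ Δ.triangles) :
    convexHull ℝ (t : Set Plane) ⊆ Δ.region :=
  fun _ hx => ⟨t, ht, hx⟩

theorem uniqueDiffOn_convexHull (Δ : Triangulation) {t : Finset Plane} (ht : t ∈ Δ.triangles) :
    UniqueDiffOn ℝ (convexHull ℝ (t : Set Plane)) := by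
  refine uniqueDiffOn_convex (convex_convexHull ℝ _) ?_
  rw [interior_convexHull_nonempty_iff_affineSpan_eq_top]
  have h := ((Δ.indep t ht).affineSpan_eq_top_iff_card_eq_finrank_add_one).2
    (by simp [Δ.card_eq t ht])
  simpa using h

theorem uniqueDiffOn_region (Δ : Triangulation) : UniqueDiffOn ℝ Δ.region := by
  rintro x ⟨t, ht, hx⟩
  exact (Δ.uniqueDiffOn_convexHull ht x hx).mono (Δ.convexHull_subset_region ht)

theorem vertex_mem_region (Δ : Triangulation) {v : Plane} (hv : v ∈ Δ.vertices) :
    v ∈ Δ.region := by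
  obtain ⟨t, ht, h⟩ := hv
  exact ⟨t, ht, subset_convexHull ℝ _ h⟩

end Triangulation

/-- The midpoint `w_e` of an edge `e` (the average of its two endpoints). -/
def edgeMidpoint (e : Finset Plane) : Plane := (1 / 2 : ℝ) • ∑ x ∈ e, x

/-- The quarterpoint `(3 a + b) / 4` of an edge `e` with endpoints `a` and `b`, as the average of
`a` and the midpoint of `e`. -/
def edgeQuarterpoint (e : Finset Plane) (a : Plane) : Plane :=
  (1 / 2 : ℝ) • (a + edgeMidpoint e)

theorem edgeMidpoint_mem {Δ : Triangulation} {e : Finset Plane} (he : e ∈ Δ.edges) :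
    edgeMidpoint e ∈ Δ.region := by
  obtain ⟨h2, t, ht, het⟩ := he
  refine ⟨t, ht, ?_⟩
  have h := (convex_convexHull ℝ (t : Set Plane)).sum_mem (t := e) (w := fun _ => (1 / 2 : ℝ))
    (z := fun x => x) (fun _ _ => by norm_num) (by simp [h2])
    (fun x hx => subset_convexHull ℝ _ (het hx))
  simpa [edgeMidpoint, Finset.smul_sum] using h

theorem edgeQuarterpoint_mem {Δ : Triangulation} {e : Finset Plane} (he : e ∈ Δ.edges)
    {a : Plane} (ha : a ∈ e) : edgeQuarterpoint e a ∈ Δ.region := by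
  obtain ⟨h2, t, ht, het⟩ := he
  refine ⟨t, ht, ?_⟩
  have hm := (convex_convexHull ℝ (t : Set Plane)).sum_mem (t := e) (w := fun _ => (1 / 2 : ℝ))
    (z := fun x => x) (fun _ _ => by norm_num) (by simp [h2])
    (fun x hx => subset_convexHull ℝ _ (het hx))
  have hm' : edgeMidpoint e ∈ convexHull ℝ (t : Set Plane) := by
    simpa [edgeMidpoint, Finset.smul_sum] using hm
  have h := (convex_convexHull ℝ (t : Set Plane)) (subset_convexHull ℝ _ (het ha)) hm'
    (by norm_num : (0 : ℝ) ≤ 1 / 2) (by norm_num : (0 : ℝ) ≤ 1 / 2) (by norm_num)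
  simpa [edgeQuarterpoint, smul_add] using h

/-! ### The 12-split and the spline space -/

/-- The barycenter of a triangle. -/
def barycenter (t : Finset Plane) : Plane := (1 / 3 : ℝ) • ∑ x ∈ t, x

/-- For a triangle `t = {a, b, c}`, the point `(2 a + b + c) / 4` in which the segment from the
corner `a` to the barycenter meets the segment joining the midpoints of the two edges at `a`. -/
def innerPoint (t : Finset Plane) (a : Plane) : Plane := (1 / 4 : ℝ) • (a + ∑ x ∈ t, x)

/-- The twelve closed subtriangles of the Powell-Sabin 12-split of the triangle `t`. The barycenter
is joined to the corners and to the edge midpoints, and the edge midpoints are joined to each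
other. The triangle spanned by a corner `a`, the midpoint of the edge `{a, b}` and the barycenter
is thereby cut into two, and there are six ordered pairs `(a, b)`. -/
def splitCells (t : Finset Plane) : Set (Set Plane) :=
  {K | ∃ a ∈ t, ∃ b ∈ t, a ≠ b ∧
    (K = convexHull ℝ {a, midpoint ℝ a b, innerPoint t a} ∨
     K = convexHull ℝ {barycenter t, midpoint ℝ a b, innerPoint t a})}

/-- The space of quintic splines on the 12-split of `Δ`. Its members are functions on the region of
`Δ` (extended by zero) that are polynomials of degree at most five on every subtriangle, `C²` on
the whole region, `C³` on every triangle of `Δ`, and three times differentiable at every vertex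
of `Δ`. -/
def splineSpace (Δ : Triangulation) : Submodule ℝ (Plane → ℝ) where
  carrier := {s | (∀ x ∉ Δ.region, s x = 0) ∧
    (∀ t ∈ Δ.triangles, ∀ K ∈ splitCells t, ∃ p : MvPolynomial (Fin 2) ℝ,
      p.totalDegree ≤ 5 ∧ ∀ x ∈ K, s x = MvPolynomial.eval (fun i => x i) p) ∧
    ContDiffOn ℝ 2 s Δ.region ∧
    (∀ t ∈ Δ.triangles, ContDiffOn ℝ 3 s (convexHull ℝ (t : Set Plane))) ∧
    (∀ v ∈ Δ.vertices, TimesDiffWithinAt 3 s Δ.region v)}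
  zero_mem' := by
    refine ⟨fun _ _ => rfl, fun t _ K _ => ⟨0, by simp, by simp⟩, contDiffOn_const,
      fun _ _ => contDiffOn_const, fun v hv => ?_⟩
    exact TimesDiffWithinAt.of_contDiffOn Δ.uniqueDiffOn_region (Δ.vertex_mem_region hv)
      contDiffOn_const
  add_mem' := by
    rintro f g ⟨f0, f1, f2, f3, f4⟩ ⟨g0, g1, g2, g3, g4⟩
    refine ⟨fun x hx => by simp [f0 x hx, g0 x hx], fun t ht K hK => ?_, f2.add g2,
      fun t ht => (f3 t ht).add (g3 t ht), fun v hv =>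
        (f4 v hv).add Δ.uniqueDiffOn_region (Δ.vertex_mem_region hv) (g4 v hv)⟩
    obtain ⟨p, hp, hp'⟩ := f1 t ht K hK
    obtain ⟨q, hq, hq'⟩ := g1 t ht K hK
    exact ⟨p + q, (MvPolynomial.totalDegree_add p q).trans (max_le hp hq),
      fun x hx => by simp [hp' x hx, hq' x hx]⟩
  smul_mem' := by
    rintro c f ⟨f0, f1, f2, f3, f4⟩
    refine ⟨fun x hx => by simp [f0 x hx], fun t ht K hK => ?_, contDiffOn_const.smul f2,
      fun t ht => contDiffOn_const.smul (f3 t ht), fun v hv =>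
        (f4 v hv).smul Δ.uniqueDiffOn_region (Δ.vertex_mem_region hv) c⟩
    obtain ⟨p, hp, hp'⟩ := f1 t ht K hK
    exact ⟨c • p, (MvPolynomial.totalDegree_smul_le c p).trans hp,
      fun x hx => by simp [hp' x hx]⟩

theorem timesDiff_of_mem_splineSpace (Δ : Triangulation) {x : Plane} (hx : x ∈ Δ.region)
    {k : ℕ} (hk : k ≤ 2) : ∀ s ∈ splineSpace Δ, TimesDiffWithinAt k s Δ.region x := by
  intro s hs
  refine TimesDiffWithinAt.of_contDiffOn Δ.uniqueDiffOn_region hx (hs.2.2.1.of_le ?_)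
  exact_mod_cast hk

theorem timesDiff_vertex (Δ : Triangulation) {v : Plane} (hv : v ∈ Δ.vertices)
    {k : ℕ} (hk : k ≤ 3) : ∀ s ∈ splineSpace Δ, TimesDiffWithinAt k s Δ.region v := by
  intro s hs
  rcases Nat.lt_or_ge k 3 with h | h
  · exact timesDiff_of_mem_splineSpace Δ (Δ.vertex_mem_region hv) (by omega) s hs
  · obtain rfl : k = 3 := le_antisymm hk h
    exact hs.2.2.2.2 v hv

/-! ### The degrees of freedom -/

/-- A choice of cross-boundary directions: for every edge one direction at its midpoint and one at
each of its two quarterpoints, none of them parallel to the edge. -/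
structure CrossDirections (Δ : Triangulation) where
  /-- the direction at the midpoint of `e` -/
  mid : Δ.edges → Plane
  /-- the direction at the quarterpoint of `e` next to the endpoint `a` -/
  quarter : (e : Δ.edges) → e.1 → Plane
  mid_transverse : ∀ e, mid e ∉ vectorSpan ℝ (e.1 : Set Plane)
  quarter_transverse : ∀ e a, quarter e a ∉ vectorSpan ℝ (e.1 : Set Plane)

/-- Labels of the degrees of freedom: for every vertex the partial derivatives `∂x^(k-j) ∂y^j` with
`0 ≤ j ≤ k ≤ 3`, for every edge one at the midpoint and one at each quarterpoint. -/
inductive Dof (Δ : Triangulation) : Type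
  | vertex (v : Δ.vertices) (k : Fin 4) (j : Fin (k.1 + 1)) : Dof Δ
  | mid (e : Δ.edges) : Dof Δ
  | quarter (e : Δ.edges) (a : e.1) : Dof Δ

/-- The list of `k` coordinate directions with `j` times the `y`-direction followed by `k - j` times
the `x`-direction. -/
def coordDirections (k j : ℕ) : Fin k → Plane :=
  fun l => if l.1 < j then EuclideanSpace.single 1 1 else EuclideanSpace.single 0 1

/-- The nodal functionals: partial derivatives up to order three at the vertices, a first-order
cross-boundary derivative `∇_u` at every edge midpoint, and a second-order cross-boundary
derivative `∇_u ∇_u` at every quarterpoint. -/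
def dofFunctional (Δ : Triangulation) (d : CrossDirections Δ) :
    Dof Δ → NodalFunctional Δ.region (splineSpace Δ)
  | .vertex v k j =>
      .ofDirDeriv Δ.uniqueDiffOn_region v (Δ.vertex_mem_region v.2) (coordDirections k j)
        (timesDiff_vertex Δ v.2 (Nat.le_of_lt_succ k.2))
  | .mid e =>
      .ofDirDeriv Δ.uniqueDiffOn_region (edgeMidpoint e) (edgeMidpoint_mem e.2)
        (fun _ : Fin 1 => d.mid e)
        (timesDiff_of_mem_splineSpace Δ (edgeMidpoint_mem e.2) (by norm_num))
  | .quarter e a =>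
      .ofDirDeriv Δ.uniqueDiffOn_region (edgeQuarterpoint e a) (edgeQuarterpoint_mem e.2 a.2)
        (fun _ : Fin 2 => d.quarter e a)
        (timesDiff_of_mem_splineSpace Δ (edgeQuarterpoint_mem e.2 a.2) le_rfl)

/-- The set of all degrees of freedom. -/
def dofSet (Δ : Triangulation) (d : CrossDirections Δ) :
    Set (NodalFunctional Δ.region (splineSpace Δ)) :=
  Set.range (dofFunctional Δ d)

/-- The functionals in `Λ` whose carrier lies in the closed triangle `t`. -/
def carriedBy {Ω : Set Plane} {S : Submodule ℝ (Plane → ℝ)} (Λ : Set (NodalFunctional Ω S))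
    (t : Finset Plane) : Set (NodalFunctional Ω S) :=
  {ℓ ∈ Λ | ℓ.carrier ∈ convexHull ℝ (t : Set Plane)}

/-- `Λ` makes `S` a macro-element space over `Δ`: it is a nodal minimal determining set, and the
restriction of a spline to a triangle is determined by the functionals carried by it. -/
def IsMacroElement (Δ : Triangulation) (S : Submodule ℝ (Plane → ℝ))
    (Λ : Set (NodalFunctional Δ.region S)) : Prop :=
  IsNodalMinimalDeterminingSet Λ ∧
    ∀ t ∈ Δ.triangles, ∀ s s' : S,
      (∀ ℓ ∈ carriedBy Λ t, ℓ.functional s = ℓ.functional s') →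
        EqOn (s : Plane → ℝ) s' (convexHull ℝ (t : Set Plane))

end PowellSabin

end

open PowellSabin

/-!
# The quintic macro-element on the Powell-Sabin 12-split

The functionals form a basis of the dual space because the map that sends a spline to the values of
all degrees of freedom is bijective (`dofEquiv`).

*Injectivity* is a statement about a single triangle (`IsTri.eq_zero_of_edgeDataZero`). Along an
edge, the value and the first and second derivatives across the edge are univariate splines with one
knot, of degrees five, four and three; the ten derivatives at each endpoint, the derivative at the midpoint
and the two second derivatives at the quarterpoints force them to vanish
(`exists_cubic_mul_of_edge_data`), so the polynomial piece next to an edge is divisible by the third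
power of the equation of the edge. Two quintics that meet with `C³` smoothness along a segment
differ by the fourth power of the equation of its line times an affine function
(`IsPoly.exists_pow_four_mul`). Going around the points where a median crosses a midline, around the
edge midpoints and across the medians at the corners, these jumps and the cubic factors
leave no freedom.

*Surjectivity* rests on a dimension count. On one triangle the functions `p + ∑ q_l (ℓ_l)₊ ^ 4`,
with a quintic `p`, affine functions `q_l` and equations `ℓ_l` of the six lines of the split, are `C³`
splines. They form a space of dimension `21 + 6 * 3 = 39` (`ridgeSpline_injective`,
`finrank_coefficients`), and `39` degrees of freedom are carried by the triangle (`ncard_dof`), so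
that local unisolvence yields local interpolants (`exists_local_interpolant`). The interpolants
of two triangles with a common edge have the same data on the edge, so by the edge lemma they agree
there to second order, and at common vertices they agree to third order; hence they glue to a member
of the spline space (`exists_interpolant`).

Minimality holds since a determining set with `n` elements embeds the spline space into `ℝⁿ`.
-/

open scoped ContDiff Polynomial

noncomputable section

namespace PowellSabin

/-! ### Polynomial functions on the plane and their derivatives along a line -/

/-- `F` is a polynomial function of total degree at most `n` on the plane. -/
def IsPoly (n : ℕ) (F : Plane → ℝ) : Prop :=
  ∃ p : MvPolynomial (Fin 2) ℝ, p.totalDegree ≤ n ∧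
    ∀ x : Plane, F x = MvPolynomial.eval (fun i => x i) p

theorem IsPoly.mono {m n : ℕ} {F : Plane → ℝ} (h : IsPoly m F) (hmn : m ≤ n) : IsPoly n F := by
  obtain ⟨p, hp, hF⟩ := h
  exact ⟨p, hp.trans hmn, hF⟩

theorem IsPoly.add {n : ℕ} {F G : Plane → ℝ} (hF : IsPoly n F) (hG : IsPoly n G) :
    IsPoly n (fun x => F x + G x) := by
  obtain ⟨p, hp, hF⟩ := hF
  obtain ⟨q, hq, hG⟩ := hG
  exact ⟨p + q, (MvPolynomial.totalDegree_add p q).trans (max_le hp hq), fun x => by simp [hF, hG]⟩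

theorem IsPoly.mul {m n : ℕ} {F G : Plane → ℝ} (hF : IsPoly m F) (hG : IsPoly n G) :
    IsPoly (m + n) (fun x => F x * G x) := by
  obtain ⟨p, hp, hF⟩ := hF
  obtain ⟨q, hq, hG⟩ := hG
  exact ⟨p * q, (MvPolynomial.totalDegree_mul p q).trans (add_le_add hp hq),
    fun x => by simp [hF, hG]⟩

theorem isPoly_const (n : ℕ) (c : ℝ) : IsPoly n (fun _ => c) :=
  ⟨MvPolynomial.C c, by simp, fun x => by simp⟩

theorem isPoly_coord (i : Fin 2) : IsPoly 1 (fun x => x i) :=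
  ⟨MvPolynomial.X i, by simp, fun x => by simp⟩

theorem IsPoly.pow {n : ℕ} {F : Plane → ℝ} (hF : IsPoly n F) (k : ℕ) :
    IsPoly (k * n) (fun x => F x ^ k) := by
  obtain ⟨p, hp, hF⟩ := hF
  exact ⟨p ^ k, (MvPolynomial.totalDegree_pow p k).trans (Nat.mul_le_mul_left k hp),
    fun x => by simp [hF]⟩

theorem IsPoly.const_mul {n : ℕ} {F : Plane → ℝ} (hF : IsPoly n F) (c : ℝ) :
    IsPoly n (fun x => c * F x) := by
  simpa using (isPoly_const 0 c).mul hF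

theorem IsPoly.sub {n : ℕ} {F G : Plane → ℝ} (hF : IsPoly n F) (hG : IsPoly n G) :
    IsPoly n (fun x => F x - G x) := by
  simpa [sub_eq_add_neg] using hF.add (hG.const_mul (-1))

theorem IsPoly.sum {ι : Type*} {n : ℕ} (s : Finset ι) {F : ι → Plane → ℝ}
    (hF : ∀ i ∈ s, IsPoly n (F i)) : IsPoly n (fun x => ∑ i ∈ s, F i x) := by
  classical
  induction s using Finset.induction_on with
  | empty => simpa using isPoly_const n 0
  | insert a s ha ih =>
    simp only [Finset.sum_insert ha]
    exact (hF a (by simp)).add (ih fun i hi => hF i (by simp [hi]))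

theorem IsPoly.contDiff {n : ℕ} {F : Plane → ℝ} (hF : IsPoly n F) {k : ℕ∞ω} :
    ContDiff ℝ k F := by
  obtain ⟨p, -, hF⟩ := hF
  have hF' : F = fun x : Plane => MvPolynomial.eval (fun i => x i) p := funext hF
  rw [hF']
  clear hF hF'
  induction p using MvPolynomial.induction_on with
  | C a => simpa using contDiff_const
  | add p q hp hq => simpa using hp.add hq
  | mul_X p i hp =>
    simp only [map_mul, MvPolynomial.eval_X]
    exact hp.mul (by fun_prop)

/-- In the frame with origin `o` and axes `u`, `v`, the function `F` is
`∑ j < 6, A j (τ) t ^ j`. The coefficients are indexed by all of `ℕ` and vanish from index six on,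
so that differentiation in the direction `v` is a shift of the index. -/
structure HasExpansion (F : Plane → ℝ) (o u v : Plane) (A : ℕ → ℝ[X]) : Prop where
  eq : ∀ τ t : ℝ, F (o + τ • u + t • v) = ∑ j ∈ Finset.range 6, (A j).eval τ * t ^ j
  zero : ∀ j, 6 ≤ j → A j = 0

theorem eval_aeval_eq (y : Fin 2 → ℝ) (f : Fin 2 → MvPolynomial (Fin 2) ℝ)
    (p : MvPolynomial (Fin 2) ℝ) :
    MvPolynomial.eval y (MvPolynomial.aeval f p)
      = MvPolynomial.eval (fun i => MvPolynomial.eval y (f i)) p := by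
  induction p using MvPolynomial.induction_on with
  | C a => simp
  | add p q hp hq => rw [map_add, map_add, map_add, hp, hq]
  | mul_X p i hp => rw [map_mul, map_mul, map_mul, hp]; simp

/-- In every frame a quintic has an expansion in which the coefficient of `t ^ j` has degree at most
`5 - j`. -/
theorem IsPoly.exists_expansion {F : Plane → ℝ} (hF : IsPoly 5 F) (o u v : Plane) :
    ∃ A : ℕ → ℝ[X], HasExpansion F o u v A ∧ ∀ j, (A j).natDegree ≤ 5 - j := by
  obtain ⟨p, hp, hF⟩ := hF
  let f : Fin 2 → MvPolynomial (Fin 2) ℝ := fun i =>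
    MvPolynomial.C (o i) + MvPolynomial.X 0 * MvPolynomial.C (u i)
      + MvPolynomial.X 1 * MvPolynomial.C (v i)
  have hf : ∀ i, (f i).totalDegree ≤ 1 := by
    intro i
    refine (MvPolynomial.totalDegree_add _ _).trans (max_le ?_ ?_)
    · refine (MvPolynomial.totalDegree_add _ _).trans (max_le (by simp) ?_)
      exact (MvPolynomial.totalDegree_mul _ _).trans (by simp)
    · exact (MvPolynomial.totalDegree_mul _ _).trans (by simp)
  let q := MvPolynomial.aeval f p
  have hq : q.totalDegree ≤ 5 := by
    simp only [q, MvPolynomial.aeval_def, MvPolynomial.eval₂_eq]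
    refine MvPolynomial.totalDegree_finsetSum_le fun m hm => ?_
    refine (MvPolynomial.totalDegree_mul _ _).trans ?_
    have h1 : (∏ i ∈ m.support, f i ^ m i).totalDegree ≤ ∑ i ∈ m.support, m i := by
      refine (MvPolynomial.totalDegree_finsetProd _ _).trans (Finset.sum_le_sum fun i _ => ?_)
      refine (MvPolynomial.totalDegree_pow _ _).trans ?_
      simpa using Nat.mul_le_mul_left (m i) (hf i)
    have h2 : ∑ i ∈ m.support, m i ≤ 5 := by
      refine le_trans ?_ hp
      exact MvPolynomial.le_totalDegree hm
    have h3 : (algebraMap ℝ (MvPolynomial (Fin 2) ℝ) (p.coeff m)).totalDegree = 0 := by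
      simp [MvPolynomial.algebraMap_eq]
    omega
  have hFq : ∀ τ t : ℝ, F (o + τ • u + t • v) = MvPolynomial.eval ![τ, t] q := by
    intro τ t
    rw [hF]
    have : MvPolynomial.eval ![τ, t] q
        = MvPolynomial.eval (fun i => MvPolynomial.eval ![τ, t] (f i)) p := by
      exact eval_aeval_eq _ f p
    rw [this]
    congr 2
    funext i
    simp [f]
  have hdeg : ∀ m ∈ q.support, m 0 + m 1 ≤ 5 := by
    intro m hm
    have := (MvPolynomial.le_totalDegree hm).trans hq
    rwa [Finsupp.sum_fintype _ _ (by simp), Fin.sum_univ_two] at this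
  let A : ℕ → ℝ[X] := fun j => ∑ m ∈ q.support with m 1 = j,
    Polynomial.C (q.coeff m) * Polynomial.X ^ m 0
  refine ⟨A, ⟨fun τ t => ?_, fun j hj => ?_⟩, fun j => ?_⟩
  · rw [hFq, MvPolynomial.eval_eq,
      ← Finset.sum_fiberwise_of_maps_to (s := q.support) (t := Finset.range 6) (g := fun m => m 1)
        (fun m hm => by have := hdeg m hm; simp; omega)]
    refine Finset.sum_congr rfl fun j _ => ?_
    simp only [A, Polynomial.eval_finsetSum, Finset.sum_mul]
    refine Finset.sum_congr rfl fun m hm => ?_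
    rw [← (Finset.mem_filter.1 hm).2]
    rw [← Finsupp.prod, Finsupp.prod_fintype _ _ (by simp)]
    simp [Fin.prod_univ_two, mul_assoc]
  · refine Finset.sum_eq_zero fun m hm => ?_
    have h1 := hdeg m (Finset.mem_filter.1 hm).1
    have h2 := (Finset.mem_filter.1 hm).2
    omega
  · refine Polynomial.natDegree_sum_le_of_forall_le _ _ fun m hm => ?_
    have h1 := hdeg m (Finset.mem_filter.1 hm).1
    have h2 := (Finset.mem_filter.1 hm).2
    refine (Polynomial.natDegree_C_mul_X_pow_le _ _).trans ?_
    omega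

/-- The algebraic form of the directional derivative along `α u + β v`. -/
theorem HasExpansion.fderiv {F : Plane → ℝ} {o u v : Plane} {A : ℕ → ℝ[X]}
    (h : HasExpansion F o u v A) (hF : ContDiff ℝ ω F) (α β : ℝ) :
    HasExpansion (fun y => fderiv ℝ F y (α • u + β • v)) o u v
      (fun j => α • Polynomial.derivative (A j) + (β * (j + 1)) • A (j + 1)) := by
  refine ⟨fun τ t => ?_, fun j hj => by simp [h.zero j hj, h.zero (j + 1) (by omega)]⟩
  have hd : DifferentiableAt ℝ F (o + τ • u + t • v) :=
    (hF.differentiable (by simp)).differentiableAt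
  have hl : HasDerivAt (fun s : ℝ => o + τ • u + t • v + s • (α • u + β • v))
      (α • u + β • v) 0 := by
    simpa using ((hasDerivAt_id (0 : ℝ)).smul_const (α • u + β • v)).const_add
      (o + τ • u + t • v)
  have h1 : HasDerivAt (fun s : ℝ => F (o + τ • u + t • v + s • (α • u + β • v)))
      (_root_.fderiv ℝ F (o + τ • u + t • v) (α • u + β • v)) 0 := by
    have hd' : HasFDerivAt F (_root_.fderiv ℝ F (o + τ • u + t • v))
        (o + τ • u + t • v + (0 : ℝ) • (α • u + β • v)) := by
      simpa using hd.hasFDerivAt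
    exact hd'.comp_hasDerivAt 0 hl
  have h2 : HasDerivAt (fun s : ℝ => ∑ j ∈ Finset.range 6,
        (A j).eval (τ + s * α) * (t + s * β) ^ j)
      (∑ j ∈ Finset.range 6, ((Polynomial.derivative (A j)).eval τ * α * t ^ j
        + (A j).eval τ * (j * t ^ (j - 1) * β))) 0 := by
    refine HasDerivAt.fun_sum fun j _ => ?_
    have e1 : HasDerivAt (fun s : ℝ => τ + s * α) α 0 := by
      simpa using ((hasDerivAt_id (0 : ℝ)).mul_const α).const_add τ
    have e2 : HasDerivAt (fun s : ℝ => t + s * β) β 0 := by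
      simpa using ((hasDerivAt_id (0 : ℝ)).mul_const β).const_add t
    have e3 : HasDerivAt (fun s : ℝ => (A j).eval (τ + s * α))
        ((Polynomial.derivative (A j)).eval τ * α) 0 := by
      have := HasDerivAt.comp (0 : ℝ) ((A j).hasDerivAt (τ + 0 * α)) e1
      rw [zero_mul, add_zero] at this
      exact this
    have := e3.mul (e2.pow j)
    rw [zero_mul, zero_mul, add_zero, add_zero, Pi.pow_apply, zero_mul, add_zero] at this
    exact this
  have h3 : (fun s : ℝ => F (o + τ • u + t • v + s • (α • u + β • v)))
      = fun s : ℝ => ∑ j ∈ Finset.range 6, (A j).eval (τ + s * α) * (t + s * β) ^ j := by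
    funext s
    rw [← h.eq]
    congr 1
    module
  rw [h3] at h1
  rw [h1.unique h2]
  simp only [Finset.sum_range_succ, Finset.sum_range_zero, Polynomial.eval_add,
    Polynomial.eval_smul, smul_eq_mul, h.zero 6 le_rfl]
  norm_num
  ring

theorem iteratedFDeriv_fderiv_apply_eq_zero {F : Plane → ℝ} (hF : ContDiff ℝ ω F) {k : ℕ}
    {x : Plane} (h : ∀ j ≤ k + 1, iteratedFDeriv ℝ j F x = 0) (w : Plane) :
    ∀ j ≤ k, iteratedFDeriv ℝ j (fun y => fderiv ℝ F y w) x = 0 := by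
  intro j hj
  have h1 : iteratedFDeriv ℝ j (fderiv ℝ F) x = 0 := by
    rw [← norm_eq_zero, norm_iteratedFDeriv_fderiv, h (j + 1) (by omega), norm_zero]
  have h2 := (ContinuousLinearMap.apply ℝ ℝ w).iteratedFDeriv_comp_left (i := j) (n := ω) (x := x)
    (f := fderiv ℝ F) ((hF.fderiv_right (m := ω) (by simp)).contDiffAt) (by simp)
  have h3 : (⇑(ContinuousLinearMap.apply ℝ ℝ w) ∘ _root_.fderiv ℝ F)
      = fun y => fderiv ℝ F y w := rfl
  rw [h3, h1] at h2
  rw [h2]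
  ext m
  simp

theorem contDiff_fderiv_apply {F : Plane → ℝ} (hF : ContDiff ℝ ω F) (w : Plane) :
    ContDiff ℝ ω (fun y => fderiv ℝ F y w) :=
  (hF.fderiv_right (m := ω) (by simp)).clm_apply contDiff_const

/-- If all derivatives of `F` up to order `k` vanish at a point of the axis `t = 0`, so do all
mixed derivatives of its expansion. -/
theorem HasExpansion.eval_iterate_derivative_eq_zero {o u v : Plane} {τ : ℝ} (k : ℕ) :
    ∀ {F : Plane → ℝ} {A : ℕ → ℝ[X]}, HasExpansion F o u v A → ContDiff ℝ ω F →
      (∀ j ≤ k, iteratedFDeriv ℝ j F (o + τ • u) = 0) →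
      ∀ i j, i + j ≤ k → (Polynomial.derivative^[i] (A j)).eval τ = 0 := by
  induction k with
  | zero =>
    intro F A h hF h0 i j hij
    obtain ⟨rfl, rfl⟩ : i = 0 ∧ j = 0 := by omega
    have h1 := h.eq τ 0
    have h2 := congrArg (fun f => f 0) (h0 0 le_rfl)
    simp only [iteratedFDeriv_zero_apply] at h2
    simp [Finset.sum_range_succ] at h1 h2
    simpa [h2] using h1.symm
  | succ k ih =>
    intro F A h hF h0 i j hij
    rcases i with _ | i
    · rcases j with _ | j
      · have h1 := h.eq τ 0
        have h2 := congrArg (fun f => f 0) (h0 0 (by omega))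
        simp only [iteratedFDeriv_zero_apply] at h2
        simp [Finset.sum_range_succ] at h1 h2
        simpa [h2] using h1.symm
      · have := ih (h.fderiv hF 0 1) (contDiff_fderiv_apply hF _)
          (iteratedFDeriv_fderiv_apply_eq_zero hF h0 _) 0 j (by omega)
        simp only [Function.iterate_zero, id, zero_smul, zero_add, one_mul, Polynomial.eval_smul,
          smul_eq_mul, mul_eq_zero] at this
        rcases this with h3 | h3
        · exact absurd h3 (by positivity)
        · exact h3
    · have := ih (h.fderiv hF 1 0) (contDiff_fderiv_apply hF _)
          (iteratedFDeriv_fderiv_apply_eq_zero hF h0 _) i j (by omega)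
      simpa using this

/-- A univariate polynomial of degree at most `k + 1` with a zero of order `k` at `τ₀`. -/
theorem exists_eval_eq_pow_mul {A : ℝ[X]} {k : ℕ} {τ₀ : ℝ} (hd : A.natDegree ≤ k + 1)
    (h : ∀ i < k, (Polynomial.derivative^[i] A).eval τ₀ = 0) :
    ∃ x y : ℝ, ∀ τ, A.eval τ = (τ - τ₀) ^ k * (x + y * τ) := by
  rcases eq_or_ne A 0 with rfl | hA
  · exact ⟨0, 0, by simp⟩
  have hdvd : (Polynomial.X - Polynomial.C τ₀) ^ k ∣ A := by
    rcases k with _ | k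
    · simp
    · rw [← Polynomial.le_rootMultiplicity_iff hA]
      refine (Polynomial.lt_rootMultiplicity_iff_isRoot_iterate_derivative hA).2 fun m hm => ?_
      exact h m (by omega)
  obtain ⟨B, rfl⟩ := hdvd
  have hB : B ≠ 0 := right_ne_zero_of_mul hA
  have hm : ((Polynomial.X - Polynomial.C τ₀) ^ k : ℝ[X]).Monic :=
    (Polynomial.monic_X_sub_C τ₀).pow k
  rw [hm.natDegree_mul' hB, Polynomial.natDegree_pow, Polynomial.natDegree_X_sub_C] at hd
  have hB1 : B.natDegree ≤ 1 := by omega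
  obtain ⟨a, b, rfl⟩ := Polynomial.exists_eq_X_add_C_of_natDegree_le_one hB1
  refine ⟨b, a, fun τ => ?_⟩
  simp
  left; ring

/-! ### Quintics with vanishing jets along a line -/

theorem exists_linear_eval {A : ℝ[X]} (h : A.natDegree ≤ 1) :
    ∃ x y : ℝ, ∀ τ, A.eval τ = x + y * τ := by
  obtain ⟨a, b, rfl⟩ := Polynomial.exists_eq_X_add_C_of_natDegree_le_one h
  exact ⟨b, a, fun τ => by simp; ring⟩

theorem exists_quadratic_eval {A : ℝ[X]} (h : A.natDegree ≤ 2) :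
    ∃ x y z : ℝ, ∀ τ, A.eval τ = x + y * τ + z * τ ^ 2 := by
  refine ⟨A.coeff 0, A.coeff 1, A.coeff 2, fun τ => ?_⟩
  rw [Polynomial.eval_eq_sum_range' (n := 3) (by omega)]
  simp [Finset.sum_range_succ]

/-- A quintic whose derivatives up to order three vanish along a segment of a line is the fourth
power of an equation of that line, times an affine function. -/
theorem IsPoly.exists_pow_four_mul {F : Plane → ℝ} (hF : IsPoly 5 F) (o u v : Plane)
    (h : ∀ τ ∈ Icc (0 : ℝ) 1, ∀ j ≤ 3, iteratedFDeriv ℝ j F (o + τ • u) = 0) :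
    ∃ x y z : ℝ, ∀ τ t : ℝ, F (o + τ • u + t • v) = t ^ 4 * (x + y * τ + z * t) := by
  obtain ⟨A, hA, hdeg⟩ := hF.exists_expansion o u v
  have hzero : ∀ j ≤ 3, A j = 0 := by
    intro j hj
    refine Polynomial.eq_zero_of_infinite_isRoot _
      ((Icc_infinite (zero_lt_one' ℝ)).mono fun τ hτ => ?_)
    exact hA.eval_iterate_derivative_eq_zero 3 hF.contDiff (h τ hτ) 0 j (by omega)
  obtain ⟨x, y, h4⟩ := exists_linear_eval (hdeg 4)
  obtain ⟨z, w, h5⟩ := exists_linear_eval ((hdeg 5).trans (by norm_num))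
  have h5' : w = 0 := by
    have hc : A 5 = Polynomial.C ((A 5).coeff 0) :=
      Polynomial.eq_C_of_natDegree_le_zero (by simpa using hdeg 5)
    have e0 := h5 0
    have e1 := h5 1
    rw [hc] at e0 e1
    simp only [Polynomial.eval_C] at e0 e1
    linarith
  refine ⟨x, y, z, fun τ t => ?_⟩
  rw [hA.eq]
  simp [Finset.sum_range_succ, hzero 0, hzero 1, hzero 2, hzero 3, h4, h5, h5']
  ring

theorem iteratedFDeriv_two_const_apply {F : Plane → ℝ} (hF : ContDiff ℝ ω F) (x u : Plane) :
    iteratedFDeriv ℝ 2 F x (fun _ => u) = fderiv ℝ (fun y => fderiv ℝ F y u) x u := by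
  rw [iteratedFDeriv_two_apply]
  have h : DifferentiableAt ℝ (fderiv ℝ F) x :=
    ((hF.fderiv_right (m := ω) (by simp)).differentiable (by simp)).differentiableAt
  rw [fderiv_clm_apply h (differentiableAt_const u)]
  simp

theorem iteratedFDeriv_sub_eq_zero {F G : Plane → ℝ} {k : ℕ} (hF : ContDiff ℝ ω F)
    (hG : ContDiff ℝ ω G) {x : Plane}
    (h : ∀ j ≤ k, iteratedFDeriv ℝ j F x = iteratedFDeriv ℝ j G x) :
    ∀ j ≤ k, iteratedFDeriv ℝ j (fun y => F y - G y) x = 0 := by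
  intro j hj
  have := iteratedFDeriv_sub_apply (𝕜 := ℝ) (i := j) (f := F) (g := G) (x := x)
    ((hF.of_le le_top).contDiffAt) ((hG.of_le le_top).contDiffAt)
  rw [h j hj, sub_self] at this
  exact this

/-- A `C³` quintic spline on `[0, 1]` with knot `1 / 2` vanishes if it has zeros of order four at
both ends. -/
theorem spline_value_eq_zero {x y z w p q : ℝ}
    (h : ∀ τ : ℝ, τ ^ 4 * (x + y * τ) - (τ - 1) ^ 4 * (z + w * τ)
      = (τ - 1 / 2) ^ 4 * (p + q * τ)) : x = 0 ∧ y = 0 ∧ z = 0 ∧ w = 0 := by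
  have h0 := h 0
  have h1 := h 1
  have h2 := h 2
  have h3 := h (-1)
  have h4 := h (1 / 2)
  have h5 := h 3
  norm_num at h0 h1 h2 h3 h4 h5
  refine ⟨?_, ?_, ?_, ?_⟩ <;> linarith

/-- A `C²` quartic spline on `[0, 1]` with knot `1 / 2` vanishes if it has zeros of order three at
both ends and a zero at `1 / 2`. -/
theorem spline_first_eq_zero {x y z w p q : ℝ}
    (h : ∀ τ : ℝ, τ ^ 3 * (x + y * τ) - (τ - 1) ^ 3 * (z + w * τ)
      = (τ - 1 / 2) ^ 3 * (p + q * τ)) (hm : x + y / 2 = 0) :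
    x = 0 ∧ y = 0 ∧ z = 0 ∧ w = 0 := by
  have h0 := h 0
  have h1 := h 1
  have h2 := h 2
  have h3 := h (-1)
  have h4 := h (1 / 2)
  have h5 := h 3
  norm_num at h0 h1 h2 h3 h4 h5
  refine ⟨?_, ?_, ?_, ?_⟩ <;> linarith

/-- A `C¹` cubic spline on `[0, 1]` with knot `1 / 2` vanishes if it has zeros of order two at both
ends and zeros at `1 / 4` and `3 / 4`. -/
theorem spline_second_eq_zero {x y z w p q : ℝ}
    (h : ∀ τ : ℝ, τ ^ 2 * (x + y * τ) - (τ - 1) ^ 2 * (z + w * τ)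
      = (τ - 1 / 2) ^ 2 * (p + q * τ)) (ha : x + y / 4 = 0) (hb : z + w * (3 / 4) = 0) :
    x = 0 ∧ y = 0 ∧ z = 0 ∧ w = 0 := by
  have h0 := h 0
  have h1 := h 1
  have h2 := h 2
  have h3 := h (-1)
  have h4 := h (1 / 2)
  have h5 := h 3
  norm_num at h0 h1 h2 h3 h4 h5
  refine ⟨?_, ?_, ?_, ?_⟩ <;> linarith

theorem exists_cubic_mul {F : Plane → ℝ} {o u v : Plane} {A : ℕ → ℝ[X]}
    (hA : HasExpansion F o u v A) (hdeg : ∀ j, (A j).natDegree ≤ 5 - j)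
    (h0 : ∀ τ, (A 0).eval τ = 0) (h1 : ∀ τ, (A 1).eval τ = 0) (h2 : ∀ τ, (A 2).eval τ = 0) :
    ∃ q : Fin 6 → ℝ, q 0 = (A 3).eval 0 ∧ ∀ τ t : ℝ, F (o + τ • u + t • v)
      = t ^ 3 * (q 0 + q 1 * τ + q 2 * t + q 3 * τ ^ 2 + q 4 * τ * t + q 5 * t ^ 2) := by
  obtain ⟨x, y, z, h3⟩ := exists_quadratic_eval (hdeg 3)
  obtain ⟨x', y', h4⟩ := exists_linear_eval (hdeg 4)
  have hc : A 5 = Polynomial.C ((A 5).coeff 0) :=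
    Polynomial.eq_C_of_natDegree_le_zero (by simpa using hdeg 5)
  refine ⟨![x, y, x', z, y', (A 5).coeff 0], by simp [h3], fun τ t => ?_⟩
  rw [hA.eq]
  have h5 : (A 5).eval τ = (A 5).coeff 0 := by rw [hc]; simp
  simp [Finset.sum_range_succ, h0, h1, h2, h3, h4, h5]
  ring

/-- **The edge data determine a spline up to second order along the edge.** The quintics `F` and
`G` live next to the two halves of the segment from `a` to `b` and agree to third order at its
midpoint; if all data attached to the edge vanish, both are divisible by the third power of an
equation of the line through `a` and `b`. The value, the first and the second derivative in the
direction `w` along the edge are univariate splines of degrees five, four and three, and they are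
determined one after the other. That `q 0 = 0` expresses the vanishing of the third derivatives
at `a`. -/
theorem exists_cubic_mul_of_edge_data {F G : Plane → ℝ} (hF : IsPoly 5 F) (hG : IsPoly 5 G)
    {a b w u₀ u₁ u₂ : Plane} {α₀ β₀ α₁ β₁ α₂ β₂ : ℝ}
    (e₀ : u₀ = α₀ • (b - a) + β₀ • w) (e₁ : u₁ = α₁ • (b - a) + β₁ • w)
    (e₂ : u₂ = α₂ • (b - a) + β₂ • w) (hβ₀ : β₀ ≠ 0) (hβ₁ : β₁ ≠ 0) (hβ₂ : β₂ ≠ 0)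
    (ha : ∀ j ≤ 3, iteratedFDeriv ℝ j F a = 0) (hb : ∀ j ≤ 3, iteratedFDeriv ℝ j G b = 0)
    (hm : ∀ j ≤ 3, iteratedFDeriv ℝ j F (a + (1 / 2 : ℝ) • (b - a))
      = iteratedFDeriv ℝ j G (a + (1 / 2 : ℝ) • (b - a)))
    (d₀ : iteratedFDeriv ℝ 1 F (a + (1 / 2 : ℝ) • (b - a)) (fun _ => u₀) = 0)
    (d₁ : iteratedFDeriv ℝ 2 F (a + (1 / 4 : ℝ) • (b - a)) (fun _ => u₁) = 0)
    (d₂ : iteratedFDeriv ℝ 2 G (a + (3 / 4 : ℝ) • (b - a)) (fun _ => u₂) = 0) :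
    (∃ q : Fin 6 → ℝ, q 0 = 0 ∧ ∀ τ t : ℝ, F (a + τ • (b - a) + t • w)
      = t ^ 3 * (q 0 + q 1 * τ + q 2 * t + q 3 * τ ^ 2 + q 4 * τ * t + q 5 * t ^ 2)) ∧
    ∃ q : Fin 6 → ℝ, ∀ τ t : ℝ, G (a + τ • (b - a) + t • w)
      = t ^ 3 * (q 0 + q 1 * τ + q 2 * t + q 3 * τ ^ 2 + q 4 * τ * t + q 5 * t ^ 2) := by
  have cF : ContDiff ℝ ω F := hF.contDiff
  have cG : ContDiff ℝ ω G := hG.contDiff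
  obtain ⟨A, hA, dA⟩ := hF.exists_expansion a (b - a) w
  obtain ⟨B, hB, dB⟩ := hG.exists_expansion a (b - a) w
  have hAB : HasExpansion (fun y => F y - G y) a (b - a) w (fun j => A j - B j) :=
    ⟨fun τ t => by simp [hA.eq, hB.eq, sub_mul],
      fun j hj => by simp [hA.zero j hj, hB.zero j hj]⟩
  have zA := hA.eval_iterate_derivative_eq_zero (τ := 0) 3 cF (by simpa using ha)
  have zB := hB.eval_iterate_derivative_eq_zero (τ := 1) 3 cG (by simpa using hb)
  have zAB := hAB.eval_iterate_derivative_eq_zero (τ := 1 / 2) 3 (cF.sub cG)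
    (iteratedFDeriv_sub_eq_zero cF cG hm)
  have dAB : ∀ j, (A j - B j).natDegree ≤ 5 - j := fun j =>
    (Polynomial.natDegree_sub_le _ _).trans (max_le (dA j) (dB j))
  -- The value along the edge.
  obtain ⟨x, y, fA⟩ := exists_eval_eq_pow_mul (k := 4) (dA 0)
    (fun i hi => zA i 0 (by omega))
  obtain ⟨z, t, fB⟩ := exists_eval_eq_pow_mul (k := 4) (dB 0)
    (fun i hi => zB i 0 (by omega))
  obtain ⟨p, q, fAB⟩ := exists_eval_eq_pow_mul (k := 4) (dAB 0)
    (fun i hi => zAB i 0 (by omega))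
  obtain ⟨rfl, rfl, rfl, rfl⟩ := spline_value_eq_zero (x := x) (y := y) (z := z) (w := t) (p := p)
    (q := q) fun τ => by rw [← fAB, Polynomial.eval_sub, fA, fB, sub_zero]
  have A0 : ∀ τ, (A 0).eval τ = 0 := fun τ => by rw [fA]; ring
  have B0 : ∀ τ, (B 0).eval τ = 0 := fun τ => by rw [fB]; ring
  have A0' : A 0 = 0 := Polynomial.funext (by simpa using A0)
  have B0' : B 0 = 0 := Polynomial.funext (by simpa using B0)
  clear fA fB fAB
  -- As the value vanishes along the edge, the derivative along `u₀` at the midpoint is `β₀ ≠ 0`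
  -- times the derivative along `w`.
  have hm1 : (A 1).eval (1 / 2) = 0 := by
    have h1 := (hA.fderiv cF α₀ β₀).eq (1 / 2) 0
    rw [iteratedFDeriv_one_apply, e₀] at d₀
    rw [zero_smul, add_zero, d₀] at h1
    simp [Finset.sum_range_succ, A0'] at h1
    simpa [hβ₀] using h1
  obtain ⟨x, y, fA⟩ := exists_eval_eq_pow_mul (k := 3) (dA 1)
    (fun i hi => zA i 1 (by omega))
  obtain ⟨z, t, fB⟩ := exists_eval_eq_pow_mul (k := 3) (dB 1)
    (fun i hi => zB i 1 (by omega))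
  obtain ⟨p, q, fAB⟩ := exists_eval_eq_pow_mul (k := 3) (dAB 1)
    (fun i hi => zAB i 1 (by omega))
  obtain ⟨rfl, rfl, rfl, rfl⟩ := spline_first_eq_zero (x := x) (y := y) (z := z) (w := t) (p := p)
    (q := q) (fun τ => by rw [← fAB, Polynomial.eval_sub, fA, fB, sub_zero])
    (by rw [fA] at hm1; linarith)
  have A1 : ∀ τ, (A 1).eval τ = 0 := fun τ => by rw [fA]; ring
  have B1 : ∀ τ, (B 1).eval τ = 0 := fun τ => by rw [fB]; ring
  have A1' : A 1 = 0 := Polynomial.funext (by simpa using A1)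
  have B1' : B 1 = 0 := Polynomial.funext (by simpa using B1)
  clear fA fB fAB
  -- As value and first derivatives vanish along the edge, the second derivatives along `u₁` and
  -- `u₂` at the quarterpoints are `β₁ ^ 2` and `β₂ ^ 2` times those along `w`.
  have hq1 : (A 2).eval (1 / 4) = 0 := by
    have h1 := ((hA.fderiv cF α₁ β₁).fderiv (contDiff_fderiv_apply cF _) α₁ β₁).eq (1 / 4) 0
    rw [iteratedFDeriv_two_const_apply cF, e₁] at d₁
    rw [zero_smul, add_zero, d₁] at h1
    simp [Finset.sum_range_succ, A0', A1'] at h1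
    have h2 : (β₁ * β₁ * 2) * (A 2).eval (1 / 4) = 0 := by norm_num at h1 ⊢; simpa [hβ₁] using h1
    exact (mul_eq_zero.1 h2).resolve_left (by positivity)
  have hq2 : (B 2).eval (3 / 4) = 0 := by
    have h1 := ((hB.fderiv cG α₂ β₂).fderiv (contDiff_fderiv_apply cG _) α₂ β₂).eq (3 / 4) 0
    rw [iteratedFDeriv_two_const_apply cG, e₂] at d₂
    rw [zero_smul, add_zero, d₂] at h1
    simp [Finset.sum_range_succ, B0', B1'] at h1
    have h2 : (β₂ * β₂ * 2) * (B 2).eval (3 / 4) = 0 := by norm_num at h1 ⊢; simpa [hβ₂] using h1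
    exact (mul_eq_zero.1 h2).resolve_left (by positivity)
  obtain ⟨x, y, fA⟩ := exists_eval_eq_pow_mul (k := 2) (dA 2)
    (fun i hi => zA i 2 (by omega))
  obtain ⟨z, t, fB⟩ := exists_eval_eq_pow_mul (k := 2) (dB 2)
    (fun i hi => zB i 2 (by omega))
  obtain ⟨p, q, fAB⟩ := exists_eval_eq_pow_mul (k := 2) (dAB 2)
    (fun i hi => zAB i 2 (by omega))
  obtain ⟨rfl, rfl, rfl, rfl⟩ := spline_second_eq_zero (x := x) (y := y) (z := z) (w := t) (p := p)
    (q := q) (fun τ => by rw [← fAB, Polynomial.eval_sub, fA, fB, sub_zero])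
    (by rw [fA] at hq1; linarith) (by rw [fB] at hq2; linarith)
  obtain ⟨q, hq, hqF⟩ := exists_cubic_mul hA dA A0 A1 fun τ => by rw [fA]; ring
  obtain ⟨q', -, hqG⟩ := exists_cubic_mul hB dB B0 B1 fun τ => by rw [fB]; ring
  exact ⟨⟨q, hq.trans (zA 0 3 (by omega)), hqF⟩, q', hqG⟩

/-- The product of a function that vanishes at `x` and a function whose derivatives up to order
`k - 1` vanish at `x` has vanishing derivatives up to order `k`. -/
theorem iteratedFDeriv_mul_eq_zero {f g : Plane → ℝ} (hf : ContDiff ℝ ω f) (hg : ContDiff ℝ ω g)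
    {x : Plane} {k : ℕ} (hfx : f x = 0) (hgx : ∀ j < k, iteratedFDeriv ℝ j g x = 0) :
    ∀ j ≤ k, iteratedFDeriv ℝ j (fun y => f y * g y) x = 0 := by
  intro j hj
  rw [← norm_eq_zero]
  refine le_antisymm ?_ (norm_nonneg _)
  refine (norm_iteratedFDeriv_mul_le hf hg x (n := j) le_top).trans (le_of_eq ?_)
  refine Finset.sum_eq_zero fun i hi => ?_
  rcases i with _ | i
  · simp [hfx]
  · rw [hgx (j - (i + 1)) (by have := Finset.mem_range.1 hi; omega)]
    simp

/-! ### Identities between the jumps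

All of these compare coefficients of two polynomials; the coefficients are extracted by evaluating
at sufficiently many points. -/

/-- Two quintics, divisible by `ζ ^ 3` and by `η ^ 3` and without terms of degree three, whose
difference is divisible by `(η - ζ) ^ 4`, have no terms of degree four: the monomial
`η ^ 2 * ζ ^ 2` occurs only on the right, so that `l₀ = 0`. -/
theorem corner_eq_zero {q q' : Fin 6 → ℝ} {l₀ l₁ l₂ : ℝ} (hq : q 0 = 0) (hq' : q' 0 = 0)
    (h : ∀ η ζ : ℝ,
      ζ ^ 3 * (q 0 + q 1 * η + q 2 * ζ + q 3 * η ^ 2 + q 4 * η * ζ + q 5 * ζ ^ 2)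
        - η ^ 3 * (q' 0 + q' 1 * ζ + q' 2 * η + q' 3 * ζ ^ 2 + q' 4 * ζ * η + q' 5 * η ^ 2)
      = (η - ζ) ^ 4 * (l₀ + l₁ * η + l₂ * ζ)) :
    q 1 = 0 ∧ q 2 = 0 := by
  have a1 := h 1 0
  have a2 := h (-1) 0
  have b1 := h 0 1
  have b2 := h 0 (-1)
  have c1 := h 1 1
  have c2 := h (-1) (-1)
  have d1 := h 1 (-1)
  have d2 := h (-1) 1
  have e1 := h 2 1
  have e2 := h (-2) (-1)
  have f1 := h 1 2
  have f2 := h (-1) (-2)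
  rw [hq, hq'] at a1 a2 b1 b2 c1 c2 d1 d2 e1 e2 f1 f2
  norm_num at a1 a2 b1 b2 c1 c2 d1 d2 e1 e2 f1 f2
  constructor <;> linarith

/-- The coefficients vanish because `l ^ 4 * k ^ 4` has degree eight, whereas both sides have degree
at most five. -/
theorem midline_eq {d₀ d₁ d₂ e₀ e₁ e₂ : ℝ}
    (h : ∀ l k : ℝ, l ^ 4 * (d₀ + d₁ * l + d₂ * k) = k ^ 4 * (e₀ + e₁ * l + e₂ * k)) :
    d₀ = 0 ∧ d₁ = 0 ∧ d₂ = 0 := by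
  have a1 := h 1 0
  have a2 := h (-1) 0
  have a3 := h 0 1
  have a4 := h 0 (-1)
  have a5 := h 1 1
  have a6 := h 2 1
  norm_num at a1 a2 a3 a4 a5 a6
  refine ⟨?_, ?_, ?_⟩ <;> linarith

/-- The jumps around the midpoint of an edge, in coordinates `u, v` for which `u + v = 0` is the
edge, `u = 0` and `v = 0` are the two midlines and `u = v` is the median: the jumps across the midlines
vanish at the midpoint, by comparison of the terms of degree at most four. -/
theorem edge_value_eq_zero {r m m' n : ℝ} {r₁ r₂ r₃ r₄ r₅ m₁ m₂ m₁' m₂' n₁ n₂ : ℝ}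
    (h : ∀ u v : ℝ, (u + v) ^ 3 * (r + r₁ * u + r₂ * v + r₃ * u ^ 2 + r₄ * u * v + r₅ * v ^ 2)
      + u ^ 4 * (m + m₁ * u + m₂ * v) - v ^ 4 * (m' + m₁' * u + m₂' * v)
      = (u - v) ^ 4 * (n + n₁ * u + n₂ * v)) : m = 0 ∧ m' = 0 := by
  have a1 := h 1 0
  have a2 := h (-1) 0
  have b1 := h 0 1
  have b2 := h 0 (-1)
  have c1 := h 1 1
  have c2 := h (-1) (-1)
  have d1 := h 1 (-1)
  have d2 := h (-1) 1
  have e1 := h 2 1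
  have e2 := h (-2) (-1)
  have f1 := h 1 2
  have f2 := h (-1) (-2)
  norm_num at a1 a2 b1 b2 c1 c2 d1 d2 e1 e2 f1 f2
  constructor <;> linarith

/-- As `edge_value_eq_zero`, one degree higher. -/
theorem edge_slope_add_eq_zero {r m m' n : ℝ} {r₁ r₂ r₃ r₄ r₅ n₁ n₂ : ℝ}
    (h : ∀ u v : ℝ, (u + v) ^ 3 * (r + r₁ * u + r₂ * v + r₃ * u ^ 2 + r₄ * u * v + r₅ * v ^ 2)
      + u ^ 4 * (m * u) - v ^ 4 * (m' * v) = (u - v) ^ 4 * (n + n₁ * u + n₂ * v)) :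
    m + m' = 0 := by
  have a1 := h 1 0
  have a2 := h (-1) 0
  have b1 := h 0 1
  have b2 := h 0 (-1)
  have c1 := h 1 1
  have c2 := h (-1) (-1)
  have d1 := h 1 (-1)
  have d2 := h (-1) 1
  have e1 := h 2 1
  have e2 := h (-2) (-1)
  have f1 := h 1 2
  have f2 := h (-1) (-2)
  have g1 := h 2 2
  have g2 := h (-2) (-2)
  norm_num at a1 a2 b1 b2 c1 c2 d1 d2 e1 e2 f1 f2 g1 g2
  linarith

/-- Without jumps across the midlines there is no jump across the median either. -/
theorem edge_jump_eq_zero {r n : ℝ} {r₁ r₂ r₃ r₄ r₅ n₁ n₂ : ℝ}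
    (h : ∀ u v : ℝ, (u + v) ^ 3 * (r + r₁ * u + r₂ * v + r₃ * u ^ 2 + r₄ * u * v + r₅ * v ^ 2)
      = (u - v) ^ 4 * (n + n₁ * u + n₂ * v)) : n = 0 ∧ n₁ = 0 ∧ n₂ = 0 := by
  have a1 := h 1 0
  have a2 := h (-1) 0
  have b1 := h 0 1
  have b2 := h 0 (-1)
  have c1 := h 1 1
  have c2 := h (-1) (-1)
  have d1 := h 1 (-1)
  have d2 := h (-1) 1
  have e1 := h 2 1
  have e2 := h (-2) (-1)
  have f1 := h 1 2
  have f2 := h (-1) (-2)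
  have g1 := h 2 2
  have g2 := h (-2) (-2)
  norm_num at a1 a2 b1 b2 c1 c2 d1 d2 e1 e2 f1 f2 g1 g2
  refine ⟨?_, ?_, ?_⟩ <;> linarith

/-- A quadratic form in `η, ζ` that is also one in `ξ, ζ`, for barycentric coordinates
`ξ, η, ζ`, is a multiple of `ζ ^ 2`. -/
theorem coeff_eq_zero_of_quadratic_eq {a b c a' b' c' : ℝ}
    (h : ∀ ξ η ζ : ℝ, ξ + η + ζ = 1 → ζ ^ 3 * (a * η ^ 2 + b * η * ζ + c * ζ ^ 2)
      = ζ ^ 3 * (a' * ξ ^ 2 + b' * ξ * ζ + c' * ζ ^ 2)) : a = 0 ∧ b = 0 := by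
  have h1 := h 0 0 1 (by norm_num)
  have h2 := h (-1) 1 1 (by norm_num)
  have h3 := h 1 (-1) 1 (by norm_num)
  have h4 := h (-1) 0 2 (by norm_num)
  have h5 := h 0 (-1) 2 (by norm_num)
  have h6 := h 1 1 (-1) (by norm_num)
  norm_num at h1 h2 h3 h4 h5 h6
  constructor <;> linarith

/-- The monomial `η ^ 3 * ζ ^ 2` and its mirror image force the right-hand side to vanish. -/
theorem corner_pow_five_eq_zero {c c' l₀ l₁ l₂ : ℝ}
    (h : ∀ η ζ : ℝ, c * ζ ^ 5 - c' * η ^ 5 = (η - ζ) ^ 4 * (l₀ + l₁ * η + l₂ * ζ)) : c = 0 := by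
  have a1 := h 1 0
  have a2 := h (-1) 0
  have b1 := h 0 1
  have b2 := h 0 (-1)
  have c1 := h 1 1
  have d1 := h 1 (-1)
  have d2 := h (-1) 1
  have e1 := h 2 1
  norm_num at a1 a2 b1 b2 c1 d1 d2 e1
  linarith

/-! ### Plane vectors and triangles spanned by three points -/

/-- The cross product of two vectors of the plane. -/
def cross (u v : Plane) : ℝ := u 0 * v 1 - u 1 * v 0

theorem plane_ext {u v : Plane} (h0 : u 0 = v 0) (h1 : u 1 = v 1) : u = v := by
  ext i
  fin_cases i
  · exact h0
  · exact h1

theorem linearIndependent_of_cross_ne_zero {u v : Plane} (h : cross u v ≠ 0) :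
    LinearIndependent ℝ ![u, v] := by
  rw [LinearIndependent.pair_iff]
  intro s t hst
  have h0 := congrArg (fun w : Plane => w 0) hst
  have h1 := congrArg (fun w : Plane => w 1) hst
  simp only [PiLp.add_apply, PiLp.smul_apply, smul_eq_mul, PiLp.zero_apply] at h0 h1
  have hs : s * cross u v = 0 := by
    unfold cross; linear_combination v 1 * h0 - v 0 * h1
  have ht : t * cross u v = 0 := by
    unfold cross; linear_combination u 0 * h1 - u 1 * h0
  exact ⟨(mul_eq_zero.1 hs).resolve_right h, (mul_eq_zero.1 ht).resolve_right h⟩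

theorem cross_ne_zero_of_linearIndependent {u v : Plane} (h : LinearIndependent ℝ ![u, v]) :
    cross u v ≠ 0 := by
  rw [LinearIndependent.pair_iff] at h
  intro hc
  unfold cross at hc
  have h1 := h (v 1) (-u 1) (plane_ext
    (by simp only [PiLp.add_apply, PiLp.smul_apply, smul_eq_mul, PiLp.zero_apply]; linarith)
    (by simp only [PiLp.add_apply, PiLp.smul_apply, smul_eq_mul, PiLp.zero_apply]; ring))
  have h2 := h (v 0) (-u 0) (plane_ext
    (by simp only [PiLp.add_apply, PiLp.smul_apply, smul_eq_mul, PiLp.zero_apply]; ring)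
    (by simp only [PiLp.add_apply, PiLp.smul_apply, smul_eq_mul, PiLp.zero_apply]; linarith))
  have h3 := h 0 1 (plane_ext (by simp [h2.1]) (by simp [h1.1]))
  simp at h3

theorem exists_eq_smul_add_smul {v w : Plane} (h : cross v w ≠ 0) (u : Plane) :
    u = (cross u w / cross v w) • v + (cross v u / cross v w) • w := by
  refine plane_ext ?_ ?_ <;>
  · simp only [PiLp.add_apply, PiLp.smul_apply, smul_eq_mul]
    field_simp
    unfold cross
    ring

theorem affineIndependent_triple {p q r : Plane} (h : cross (q - p) (r - p) ≠ 0) :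
    AffineIndependent ℝ ![p, q, r] := by
  rw [affineIndependent_iff_linearIndependent_vsub ℝ _ (0 : Fin 3)]
  have hl := linearIndependent_of_cross_ne_zero h
  rw [← linearIndependent_equiv (finSuccAboveEquiv (0 : Fin 3))]
  convert hl using 1
  · ext i j
    fin_cases i <;> simp [finSuccAboveEquiv]
  · rfl

theorem uniqueDiffOn_convexHull_triple {p q r : Plane} (h : cross (q - p) (r - p) ≠ 0) :
    UniqueDiffOn ℝ (convexHull ℝ {p, q, r}) := by
  refine uniqueDiffOn_convex (convex_convexHull ℝ _) ?_
  rw [interior_convexHull_nonempty_iff_affineSpan_eq_top]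
  have h1 := ((affineIndependent_triple h).affineSpan_eq_top_iff_card_eq_finrank_add_one).2
    (by simp)
  rw [← h1]
  congr 1
  ext y
  simp [eq_comm]
  tauto

theorem mem_convexHull_triple {p q r : Plane} {a b c : ℝ} (ha : 0 ≤ a) (hb : 0 ≤ b) (hc : 0 ≤ c)
    (h : a + b + c = 1) : a • p + b • q + c • r ∈ convexHull ℝ {p, q, r} := by
  have := (convex_convexHull ℝ {p, q, r}).sum_mem (t := Finset.univ) (w := ![a, b, c])
    (z := ![p, q, r]) (by intro i _; fin_cases i <;> simpa) (by simp [Fin.sum_univ_three, h])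
    (by intro i _; fin_cases i <;> exact subset_convexHull ℝ _ (by simp))
  simpa [Fin.sum_univ_three] using this

/-! ### Jets -/

/-- Passing to a smaller domain does not change the derivatives. -/
theorem iteratedFDerivWithin_subset_of_timesDiff {k : ℕ} {f : Plane → ℝ} {K T : Set Plane}
    {x : Plane} (hKT : K ⊆ T) (hK : UniqueDiffOn ℝ K) (hT : UniqueDiffOn ℝ T) (hx : x ∈ K)
    (h : TimesDiffWithinAt k f T x) :
    iteratedFDerivWithin ℝ k f T x = iteratedFDerivWithin ℝ k f K x := by
  cases k with
  | zero => ext m; simp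
  | succ j =>
    have hev : iteratedFDerivWithin ℝ j f K =ᶠ[𝓝[K] x] iteratedFDerivWithin ℝ j f T := by
      obtain ⟨U, hU, hxU, hfU⟩ := h.1.contDiffOn' le_rfl (by simp)
      rw [insert_eq_of_mem (hKT hx)] at hfU
      filter_upwards [self_mem_nhdsWithin, nhdsWithin_le_nhds (hU.mem_nhds hxU)] with y hy hyU
      rw [← iteratedFDerivWithin_inter_open hU hyU (s := K),
        ← iteratedFDerivWithin_inter_open hU hyU (s := T)]
      exact iteratedFDerivWithin_subset (inter_subset_inter_left U hKT) (hK.inter hU)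
        (hT.inter hU) hfU ⟨hy, hyU⟩
    ext m
    rw [iteratedFDerivWithin_succ_apply_left, iteratedFDerivWithin_succ_apply_left,
      hev.fderivWithin_eq (hev.self_of_nhdsWithin hx), fderivWithin_subset hKT (hK x hx) h.2]

/-- The derivatives of `h` within `D` at `x` up to order three are those of `F`. -/
def JetEq (h : Plane → ℝ) (D : Set Plane) (F : Plane → ℝ) (x : Plane) : Prop :=
  ∀ j ≤ 3, iteratedFDerivWithin ℝ j h D x = iteratedFDeriv ℝ j F x

theorem jetEq_of_eqOn {f F : Plane → ℝ} {K T : Set Plane} (hKT : K ⊆ T) (hK : UniqueDiffOn ℝ K)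
    (hT : UniqueDiffOn ℝ T) (hf : ContDiffOn ℝ 3 f T) (hF : ContDiff ℝ ω F) (h : EqOn f F K)
    {x : Plane} (hx : x ∈ K) : JetEq f T F x := by
  intro j hj
  rw [← iteratedFDerivWithin_subset hKT hK hT (hf.of_le (by exact_mod_cast hj)) hx,
    iteratedFDerivWithin_congr h hx, iteratedFDerivWithin_eq_iteratedFDeriv hK
      (hF.of_le le_top).contDiffAt hx]

/-- Up to order three, every choice of coordinate directions is a permutation of a sorted one. -/
theorem exists_perm_sorted : ∀ (k : Fin 4) (r : Fin k → Fin 2), ∃ (j : Fin (k.1 + 1))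
    (σ : Equiv.Perm (Fin k)), ∀ l, r (σ l) = if l.1 < j.1 then 1 else 0 := by
  decide

/-- By symmetry, a derivative vanishes as soon as all partial derivatives vanish. -/
theorem iteratedFDeriv_eq_zero_of_coordDirections {F : Plane → ℝ} (hF : ContDiff ℝ ω F)
    {x : Plane} {k : ℕ} (hk : k ≤ 3)
    (h : ∀ j ≤ k, iteratedFDeriv ℝ k F x (coordDirections k j) = 0) :
    iteratedFDeriv ℝ k F x = 0 := by
  apply ContinuousMultilinearMap.toMultilinearMap_injective
  refine Module.Basis.ext_multilinear (fun _ => (EuclideanSpace.basisFun (Fin 2) ℝ).toBasis)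
    fun r => ?_
  obtain ⟨j, σ, hσ⟩ := exists_perm_sorted ⟨k, by omega⟩ r
  have h1 := h j (Nat.le_of_lt_succ j.2)
  have h2 := (hF.contDiffAt (x := x)).iteratedFDeriv_comp_perm
    (fun i : Fin k => EuclideanSpace.basisFun (Fin 2) ℝ (r i)) σ
  have h3 : (fun i : Fin k => EuclideanSpace.basisFun (Fin 2) ℝ (r i)) ∘ σ
      = coordDirections k j := by
    funext l
    have := hσ l
    simp only [Function.comp_apply, coordDirections, EuclideanSpace.basisFun_apply]
    rw [this]
    split_ifs <;> rfl
  rw [h3, h1] at h2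
  simpa using h2.symm

/-- All data of a function `h` on `D` attached to the edge with endpoints `a` and `b` vanish: the
derivatives up to order three at the endpoints, a first derivative across the edge at its midpoint,
and a second derivative across the edge at each quarterpoint. -/
structure EdgeDataZero (h : Plane → ℝ) (D : Set Plane) (a b : Plane) : Prop where
  left : ∀ j ≤ 3, iteratedFDerivWithin ℝ j h D a = 0
  right : ∀ j ≤ 3, iteratedFDerivWithin ℝ j h D b = 0
  mid : ∃ u, cross (b - a) u ≠ 0 ∧
    iteratedFDerivWithin ℝ 1 h D (a + (1 / 2 : ℝ) • (b - a)) (fun _ => u) = 0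
  quarterLeft : ∃ u, cross (b - a) u ≠ 0 ∧
    iteratedFDerivWithin ℝ 2 h D (a + (1 / 4 : ℝ) • (b - a)) (fun _ => u) = 0
  quarterRight : ∃ u, cross (b - a) u ≠ 0 ∧
    iteratedFDerivWithin ℝ 2 h D (a + (3 / 4 : ℝ) • (b - a)) (fun _ => u) = 0

/-- The edge lemma `exists_cubic_mul_of_edge_data` for the two polynomial pieces `F` and `G` of a
function `h` along the two halves of the edge. -/
theorem EdgeDataZero.exists_cubic_mul {h : Plane → ℝ} {D : Set Plane} {a b : Plane}
    (H : EdgeDataZero h D a b) {F G : Plane → ℝ} (hF : IsPoly 5 F) (hG : IsPoly 5 G) {w : Plane}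
    (hw : cross (b - a) w ≠ 0)
    (jF : ∀ τ ∈ Icc (0 : ℝ) (1 / 2), JetEq h D F (a + τ • (b - a)))
    (jG : ∀ τ ∈ Icc (1 / 2 : ℝ) 1, JetEq h D G (a + τ • (b - a))) :
    (∃ q : Fin 6 → ℝ, q 0 = 0 ∧ ∀ τ t : ℝ, F (a + τ • (b - a) + t • w)
      = t ^ 3 * (q 0 + q 1 * τ + q 2 * t + q 3 * τ ^ 2 + q 4 * τ * t + q 5 * t ^ 2)) ∧
    ∃ q : Fin 6 → ℝ, ∀ τ t : ℝ, G (a + τ • (b - a) + t • w)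
      = t ^ 3 * (q 0 + q 1 * τ + q 2 * t + q 3 * τ ^ 2 + q 4 * τ * t + q 5 * t ^ 2) := by
  obtain ⟨u₀, n₀, d₀⟩ := H.mid
  obtain ⟨u₁, n₁, d₁⟩ := H.quarterLeft
  obtain ⟨u₂, n₂, d₂⟩ := H.quarterRight
  refine exists_cubic_mul_of_edge_data hF hG (exists_eq_smul_add_smul hw u₀)
    (exists_eq_smul_add_smul hw u₁) (exists_eq_smul_add_smul hw u₂) (div_ne_zero n₀ hw)
    (div_ne_zero n₁ hw) (div_ne_zero n₂ hw) (fun j hj => ?_) (fun j hj => ?_) (fun j hj => ?_)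
    ?_ ?_ ?_
  · have := jF 0 (by norm_num) j hj
    rw [zero_smul, add_zero] at this
    rw [← this, H.left j hj]
  · have := jG 1 (by norm_num) j hj
    rw [one_smul, add_sub_cancel] at this
    rw [← this, H.right j hj]
  · rw [← jF _ (by norm_num) j hj, ← jG _ (by norm_num) j hj]
  · rw [← jF _ (by norm_num) 1 (by norm_num), d₀]
  · rw [← jF _ (by norm_num) 2 (by norm_num), d₁]
  · rw [← jG _ (by norm_num) 2 (by norm_num), d₂]

/-- Two quintic pieces of a `C³` function that meet along the segment from `p` to `q` differ by the
fourth power of an equation of its line, times an affine function. -/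
theorem exists_jump {h F G : Plane → ℝ} {D : Set Plane} (hF : IsPoly 5 F) (hG : IsPoly 5 G)
    {K K' : Set Plane} (hK : Convex ℝ K) (hK' : Convex ℝ K')
    (jF : ∀ x ∈ K, JetEq h D F x) (jG : ∀ x ∈ K', JetEq h D G x) {p q : Plane} (hp : p ∈ K)
    (hq : q ∈ K) (hp' : p ∈ K') (hq' : q ∈ K') (v : Plane) :
    ∃ l₀ l₁ l₂ : ℝ, ∀ τ t : ℝ, F (p + τ • (q - p) + t • v) - G (p + τ • (q - p) + t • v)
      = t ^ 4 * (l₀ + l₁ * τ + l₂ * t) := by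
  refine (hF.sub hG).exists_pow_four_mul p (q - p) v fun τ hτ j hj => ?_
  refine iteratedFDeriv_sub_eq_zero hF.contDiff hG.contDiff (fun i hi => ?_) j hj
  rw [← jF _ (hK.add_smul_sub_mem hp hq hτ) i hi, ← jG _ (hK'.add_smul_sub_mem hp' hq' hτ) i hi]

/-! ### Triangles -/

/-- `x, y, z` are the corners of the nondegenerate triangle `t`, in some order. -/
structure IsTri (t : Finset Plane) (x y z : Plane) : Prop where
  eq : (t : Set Plane) = {x, y, z}
  cross_ne : cross (y - x) (z - x) ≠ 0

namespace IsTri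

variable {t : Finset Plane} {x y z : Plane}

theorem swap (h : IsTri t x y z) : IsTri t y x z := by
  refine ⟨by rw [h.eq, insert_comm], fun hc => h.cross_ne ?_⟩
  simp only [cross, PiLp.sub_apply] at hc ⊢
  linarith

theorem swap' (h : IsTri t x y z) : IsTri t x z y := by
  refine ⟨by rw [h.eq, pair_comm], fun hc => h.cross_ne ?_⟩
  simp only [cross, PiLp.sub_apply] at hc ⊢
  linarith

theorem rot (h : IsTri t x y z) : IsTri t y z x := h.swap.swap'

theorem ne (h : IsTri t x y z) : x ≠ y := by
  rintro rfl
  exact h.cross_ne (by simp [cross])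

theorem mem (h : IsTri t x y z) : x ∈ t := by
  rw [← Finset.mem_coe, h.eq]; simp

theorem eq_insert (h : IsTri t x y z) : t = {x, y, z} := by
  apply Finset.coe_injective
  simp [h.eq]

theorem sum_eq (h : IsTri t x y z) : ∑ p ∈ t, p = x + y + z := by
  rw [h.eq_insert, Finset.sum_insert (by simp [h.ne, h.swap'.ne]),
    Finset.sum_pair h.rot.ne, add_assoc]

theorem innerPoint_eq (h : IsTri t x y z) :
    innerPoint t x = (1 / 2 : ℝ) • x + (1 / 4 : ℝ) • y + (1 / 4 : ℝ) • z := by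
  rw [innerPoint, h.sum_eq]; module

theorem barycenter_eq (h : IsTri t x y z) :
    barycenter t = (1 / 3 : ℝ) • x + (1 / 3 : ℝ) • y + (1 / 3 : ℝ) • z := by
  rw [barycenter, h.sum_eq]; module

theorem uniqueDiffOn (h : IsTri t x y z) : UniqueDiffOn ℝ (convexHull ℝ (t : Set Plane)) := by
  rw [h.eq]
  exact uniqueDiffOn_convexHull_triple h.cross_ne

theorem mem_convexHull (h : IsTri t x y z) {a b c : ℝ} (ha : 0 ≤ a) (hb : 0 ≤ b) (hc : 0 ≤ c)
    (hs : a + b + c = 1) : a • x + b • y + c • z ∈ convexHull ℝ (t : Set Plane) := by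
  rw [h.eq]
  exact mem_convexHull_triple ha hb hc hs

theorem exists_of_mem_convexHull (h : IsTri t x y z) {p : Plane}
    (hp : p ∈ convexHull ℝ (t : Set Plane)) : ∃ a b c : ℝ, 0 ≤ a ∧ 0 ≤ b ∧ 0 ≤ c ∧
      a + b + c = 1 ∧ p = a • x + b • y + c • z := by
  rw [h.eq_insert, Finset.mem_convexHull'] at hp
  obtain ⟨w, hw, h1, h2⟩ := hp
  have n1 : x ∉ ({y, z} : Finset Plane) := by simp [h.ne, h.swap'.ne]
  rw [Finset.sum_insert n1, Finset.sum_pair h.rot.ne] at h1 h2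
  exact ⟨w x, w y, w z, hw x (by simp), hw y (by simp), hw z (by simp), by linarith,
    by rw [← h2, add_assoc]⟩

end IsTri

/-- Any two distinct points of a nondegenerate set of three corners can be listed first. -/
theorem exists_isTri {t : Finset Plane} (h3 : t.card = 3)
    (hi : AffineIndependent ℝ ((↑) : t → Plane)) {x y : Plane} (hx : x ∈ t) (hy : y ∈ t)
    (hxy : x ≠ y) : ∃ z, IsTri t x y z := by
  classical
  obtain ⟨z, hz⟩ : ∃ z, z ∈ (t.erase x).erase y := by
    rw [← Finset.Nonempty, ← Finset.card_pos, Finset.card_erase_of_mem (by simp [hy, hxy.symm]),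
      Finset.card_erase_of_mem hx]
    omega
  simp only [Finset.mem_erase, ne_eq] at hz
  have ht : ({x, y, z} : Finset Plane) = t := by
    refine Finset.eq_of_subset_of_card_le (by intro; simp; rintro (rfl | rfl | rfl) <;> tauto) ?_
    rw [h3, Finset.card_insert_of_notMem (by simp [hxy, Ne.symm hz.2.1]), Finset.card_pair
      (Ne.symm hz.1)]
  refine ⟨z, by rw [← ht]; simp, cross_ne_zero_of_linearIndependent ?_⟩
  have h1 := hi.comp_embedding (⟨![⟨x, hx⟩, ⟨y, hy⟩, ⟨z, hz.2.2⟩], by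
    intro i j hij
    have n1 : x ≠ z := fun e => hz.2.1 e.symm
    have n2 : y ≠ z := fun e => hz.1 e.symm
    clear ht
    fin_cases i <;> fin_cases j <;> simp_all⟩ : Fin 3 ↪ t)
  rw [affineIndependent_iff_linearIndependent_vsub ℝ _ (0 : Fin 3),
    ← linearIndependent_equiv (finSuccAboveEquiv (0 : Fin 3))] at h1
  convert h1 using 1
  · ext i j
    fin_cases i <;> rfl
  · rfl

/-- The subtriangle at the corner `x` that contains the part of the edge from `x` to `y`. -/
def cornerCell (t : Finset Plane) (x y : Plane) : Set Plane :=
  convexHull ℝ {x, midpoint ℝ x y, innerPoint t x}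

/-- The subtriangle at the barycenter that lies next to `cornerCell t x y`. -/
def centerCell (t : Finset Plane) (x y : Plane) : Set Plane :=
  convexHull ℝ {barycenter t, midpoint ℝ x y, innerPoint t x}

theorem midpoint_eq_smul_add_smul (x y : Plane) :
    midpoint ℝ x y = (1 / 2 : ℝ) • x + (1 / 2 : ℝ) • y := by
  rw [midpoint_eq_smul_add, smul_add]; simp

namespace IsTri

variable {t : Finset Plane} {x y z : Plane}

theorem mem_cornerCell (h : IsTri t x y z) {a b c : ℝ} (hs : a + b + c = 1) (ha : 1 / 2 ≤ a)
    (hbc : c ≤ b) (hc : 0 ≤ c) : a • x + b • y + c • z ∈ cornerCell t x y := by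
  have := mem_convexHull_triple (p := x) (q := midpoint ℝ x y) (r := innerPoint t x)
    (a := 2 * a - 1) (b := 2 * (b - c)) (c := 4 * c) (by linarith) (by linarith) (by linarith)
    (by linarith)
  rw [cornerCell]
  convert this using 1
  rw [h.innerPoint_eq, midpoint_eq_smul_add_smul]
  obtain rfl : a = 1 - b - c := by linarith
  module

theorem mem_centerCell (h : IsTri t x y z) {a b c : ℝ} (hs : a + b + c = 1) (ha : a ≤ 1 / 2)
    (hab : b ≤ a) (hbc : c ≤ b) : a • x + b • y + c • z ∈ centerCell t x y := by
  have := mem_convexHull_triple (p := barycenter t) (q := midpoint ℝ x y) (r := innerPoint t x)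
    (a := 3 * (1 - 2 * a)) (b := 2 * (b - c)) (c := 4 * (a - b)) (by linarith) (by linarith)
    (by linarith) (by linarith)
  rw [centerCell]
  convert this using 1
  rw [h.innerPoint_eq, h.barycenter_eq, midpoint_eq_smul_add_smul]
  obtain rfl : a = 1 - b - c := by linarith
  module

theorem cornerCell_mem (h : IsTri t x y z) : cornerCell t x y ∈ splitCells t :=
  ⟨x, h.mem, y, h.swap.mem, h.ne, Or.inl rfl⟩

theorem centerCell_mem (h : IsTri t x y z) : centerCell t x y ∈ splitCells t :=
  ⟨x, h.mem, y, h.swap.mem, h.ne, Or.inr rfl⟩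

theorem midpoint_mem (h : IsTri t x y z) : midpoint ℝ x y ∈ convexHull ℝ (t : Set Plane) := by
  have := h.mem_convexHull (a := 1 / 2) (b := 1 / 2) (c := 0) (by norm_num) (by norm_num)
    (by norm_num) (by norm_num)
  rwa [zero_smul, add_zero, ← midpoint_eq_smul_add_smul] at this

theorem innerPoint_mem (h : IsTri t x y z) : innerPoint t x ∈ convexHull ℝ (t : Set Plane) := by
  rw [h.innerPoint_eq]
  exact h.mem_convexHull (by norm_num) (by norm_num) (by norm_num) (by norm_num)

theorem barycenter_mem (h : IsTri t x y z) : barycenter t ∈ convexHull ℝ (t : Set Plane) := by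
  rw [h.barycenter_eq]
  exact h.mem_convexHull (by norm_num) (by norm_num) (by norm_num) (by norm_num)

theorem cornerCell_subset (h : IsTri t x y z) :
    cornerCell t x y ⊆ convexHull ℝ (t : Set Plane) := by
  refine convexHull_min ?_ (convex_convexHull ℝ _)
  rintro p (rfl | rfl | rfl)
  · exact subset_convexHull ℝ _ h.mem
  · exact h.midpoint_mem
  · exact h.innerPoint_mem

theorem centerCell_subset (h : IsTri t x y z) :
    centerCell t x y ⊆ convexHull ℝ (t : Set Plane) := by
  refine convexHull_min ?_ (convex_convexHull ℝ _)
  rintro p (rfl | rfl | rfl)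
  · exact h.barycenter_mem
  · exact h.midpoint_mem
  · exact h.innerPoint_mem

theorem uniqueDiffOn_cornerCell (h : IsTri t x y z) : UniqueDiffOn ℝ (cornerCell t x y) := by
  refine uniqueDiffOn_convexHull_triple fun hc => h.cross_ne ?_
  rw [h.innerPoint_eq, midpoint_eq_smul_add_smul] at hc
  simp only [cross, PiLp.sub_apply, PiLp.add_apply, PiLp.smul_apply, smul_eq_mul] at hc ⊢
  linear_combination 8 * hc

theorem uniqueDiffOn_centerCell (h : IsTri t x y z) : UniqueDiffOn ℝ (centerCell t x y) := by
  refine uniqueDiffOn_convexHull_triple fun hc => h.cross_ne ?_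
  rw [h.innerPoint_eq, h.barycenter_eq, midpoint_eq_smul_add_smul] at hc
  simp only [cross, PiLp.sub_apply, PiLp.add_apply, PiLp.smul_apply, smul_eq_mul] at hc ⊢
  linear_combination (-24) * hc

/-- Every point of a triangle lies in one of its twelve subtriangles. -/
theorem exists_mem_cell (h : IsTri t x y z) {p : Plane}
    (hp : p ∈ convexHull ℝ (t : Set Plane)) :
    ∃ a b c, IsTri t a b c ∧ (p ∈ cornerCell t a b ∨ p ∈ centerCell t a b) := by
  have key : ∀ {x y z}, IsTri t x y z → ∀ {a b c : ℝ}, a + b + c = 1 → 0 ≤ c → b ≤ a → c ≤ b →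
      p = a • x + b • y + c • z → p ∈ cornerCell t x y ∨ p ∈ centerCell t x y := by
    rintro x y z h a b c hs hc hab hbc rfl
    rcases le_total (1 / 2) a with ha | ha
    · exact Or.inl (h.mem_cornerCell hs ha hbc hc)
    · exact Or.inr (h.mem_centerCell hs ha hab hbc)
  obtain ⟨a, b, c, ha, hb, hc, hs, e⟩ := h.exists_of_mem_convexHull hp
  rcases le_total a b with h1 | h1 <;> rcases le_total b c with h2 | h2 <;>
    rcases le_total a c with h3 | h3
  · exact ⟨_, _, _, h.rot.swap, key h.rot.swap (by linarith) ha h2 h1 (by rw [e]; module)⟩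
  · exact ⟨_, _, _, h.rot.swap, key h.rot.swap (by linarith) ha h2 h1 (by rw [e]; module)⟩
  · exact ⟨_, _, _, h.rot, key h.rot (by linarith) ha h2 h3 (by rw [e]; module)⟩
  · exact ⟨_, _, _, h.swap, key h.swap (by linarith) hc h1 h3 (by rw [e]; module)⟩
  · exact ⟨_, _, _, h.rot.rot, key h.rot.rot (by linarith) hb h3 h1 (by rw [e]; module)⟩
  · exact ⟨_, _, _, h.swap', key h.swap' (by linarith) hb h3 h2 (by rw [e]; module)⟩
  · exact ⟨_, _, _, h, key h (by linarith) hc h1 h2 (by rw [e])⟩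
  · exact ⟨_, _, _, h, key h (by linarith) hc h1 h2 (by rw [e])⟩

end IsTri

/-! ### Unisolvence on a single triangle -/

/-- The polynomial pieces of a `C³` quintic spline `f` on the 12-split of a single triangle `t`,
on the six subtriangles at the corners and on the six subtriangles at the barycenter. Pieces are
indexed by ordered pairs of corners of `t`; for other pairs they are arbitrary quintics. -/
structure Pieces (t : Finset Plane) (f : Plane → ℝ) (P G : Plane → Plane → Plane → ℝ) : Prop where
  polyP : ∀ x y, IsPoly 5 (P x y)
  polyG : ∀ x y, IsPoly 5 (G x y)
  eqP : ∀ x y z, IsTri t x y z → EqOn f (P x y) (cornerCell t x y)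
  eqG : ∀ x y z, IsTri t x y z → EqOn f (G x y) (centerCell t x y)
  jetP : ∀ x y z, IsTri t x y z → ∀ p ∈ cornerCell t x y,
    JetEq f (convexHull ℝ (t : Set Plane)) (P x y) p
  jetG : ∀ x y z, IsTri t x y z → ∀ p ∈ centerCell t x y,
    JetEq f (convexHull ℝ (t : Set Plane)) (G x y) p

theorem exists_pieces {t : Finset Plane} {f : Plane → ℝ}
    (hf : ContDiffOn ℝ 3 f (convexHull ℝ (t : Set Plane)))
    (hpoly : ∀ K ∈ splitCells t, ∃ F, IsPoly 5 F ∧ EqOn f F K) :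
    ∃ P G, Pieces t f P G := by
  have hP : ∀ x y, ∃ F, IsPoly 5 F ∧ ∀ z, IsTri t x y z → EqOn f F (cornerCell t x y) := by
    intro x y
    by_cases hz : ∃ z, IsTri t x y z
    · obtain ⟨z, hz⟩ := hz
      obtain ⟨F, hF, he⟩ := hpoly _ hz.cornerCell_mem
      exact ⟨F, hF, fun _ _ => he⟩
    · exact ⟨_, isPoly_const 5 0, fun z h => (hz ⟨z, h⟩).elim⟩
  have hG : ∀ x y, ∃ F, IsPoly 5 F ∧ ∀ z, IsTri t x y z → EqOn f F (centerCell t x y) := by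
    intro x y
    by_cases hz : ∃ z, IsTri t x y z
    · obtain ⟨z, hz⟩ := hz
      obtain ⟨F, hF, he⟩ := hpoly _ hz.centerCell_mem
      exact ⟨F, hF, fun _ _ => he⟩
    · exact ⟨_, isPoly_const 5 0, fun z h => (hz ⟨z, h⟩).elim⟩
  choose P hP eP using hP
  choose G hG eG using hG
  refine ⟨P, G, hP, hG, eP, eG, fun x y z h p hp => ?_, fun x y z h p hp => ?_⟩
  · exact jetEq_of_eqOn h.cornerCell_subset h.uniqueDiffOn_cornerCell h.uniqueDiffOn hf
      (hP x y).contDiff (eP x y z h) hp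
  · exact jetEq_of_eqOn h.centerCell_subset h.uniqueDiffOn_centerCell h.uniqueDiffOn hf
      (hG x y).contDiff (eG x y z h) hp

namespace IsTri

variable {t : Finset Plane} {x y z : Plane}

theorem corner_mem_cornerCell (h : IsTri t x y z) : x ∈ cornerCell t x y := by
  have := h.mem_cornerCell (a := 1) (b := 0) (c := 0) (by norm_num) (by norm_num) le_rfl le_rfl
  simpa using this

theorem innerPoint_mem_cornerCell (_ : IsTri t x y z) : innerPoint t x ∈ cornerCell t x y :=
  subset_convexHull ℝ _ (by simp)

theorem midpoint_mem_cornerCell (_ : IsTri t x y z) : midpoint ℝ x y ∈ cornerCell t x y :=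
  subset_convexHull ℝ _ (by simp)

theorem innerPoint_mem_centerCell (_ : IsTri t x y z) : innerPoint t x ∈ centerCell t x y :=
  subset_convexHull ℝ _ (by simp)

theorem midpoint_mem_centerCell (_ : IsTri t x y z) : midpoint ℝ x y ∈ centerCell t x y :=
  subset_convexHull ℝ _ (by simp)

theorem barycenter_mem_centerCell (_ : IsTri t x y z) : barycenter t ∈ centerCell t x y :=
  subset_convexHull ℝ _ (by simp)

end IsTri

/-- The part of the edge from `x` to `y` next to `x` is in `cornerCell t x y`. -/
theorem IsTri.edge_mem_cornerCell {t : Finset Plane} {x y z : Plane} (h : IsTri t x y z) {τ : ℝ}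
    (hτ : τ ∈ Icc (0 : ℝ) (1 / 2)) : x + τ • (y - x) ∈ cornerCell t x y := by
  have := h.mem_cornerCell (a := 1 - τ) (b := τ) (c := 0) (by ring) (by linarith [hτ.2]) hτ.1
    le_rfl
  convert this using 1
  module

/-- The part of the edge from `x` to `y` next to `y` is in `cornerCell t y x`. -/
theorem IsTri.edge_mem_cornerCell' {t : Finset Plane} {x y z : Plane} (h : IsTri t x y z) {τ : ℝ}
    (hτ : τ ∈ Icc (1 / 2 : ℝ) 1) : x + τ • (y - x) ∈ cornerCell t y x := by
  have := h.swap.edge_mem_cornerCell (τ := 1 - τ) ⟨by linarith [hτ.2], by linarith [hτ.1]⟩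
  convert this using 1
  module

namespace Pieces

variable {t : Finset Plane} {f : Plane → ℝ} {P G : Plane → Plane → Plane → ℝ}

/-- If the data on the edge vanish, the piece at the edge is divisible by the third power of the
equation of the edge. -/
theorem edge (hp : Pieces t f P G) {x y z : Plane} (h : IsTri t x y z)
    (he : EdgeDataZero f (convexHull ℝ (t : Set Plane)) x y) :
    ∃ q : Fin 6 → ℝ, q 0 = 0 ∧ ∀ a b c : ℝ, a + b + c = 1 → P x y (a • x + b • y + c • z)
      = c ^ 3 * (q 0 + q 1 * b + q 2 * c + q 3 * b ^ 2 + q 4 * b * c + q 5 * c ^ 2) := by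
  obtain ⟨⟨q, hq, hP⟩, -⟩ := he.exists_cubic_mul (hp.polyP x y) (hp.polyP y x) h.cross_ne
    (fun τ hτ => hp.jetP x y z h _ (h.edge_mem_cornerCell hτ))
    (fun τ hτ => hp.jetP y x z h.swap _ (h.edge_mem_cornerCell' hτ))
  refine ⟨q, hq, fun a b c hs => ?_⟩
  rw [← hP]
  obtain rfl : a = 1 - b - c := by linarith
  congr 1
  module

/-- The jump across the part of the median from the corner to the inner point. -/
theorem corner_jump (hp : Pieces t f P G) {x y z : Plane} (h : IsTri t x y z) :
    ∃ l₀ l₁ l₂ : ℝ, ∀ a b c : ℝ, a + b + c = 1 →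
      P x y (a • x + b • y + c • z) - P x z (a • x + b • y + c • z)
        = (b - c) ^ 4 * (l₀ + l₁ * b + l₂ * c) := by
  obtain ⟨l₀, l₁, l₂, hl⟩ := exists_jump (hp.polyP x y) (hp.polyP x z)
    (convex_convexHull ℝ _) (convex_convexHull ℝ _) (hp.jetP x y z h) (hp.jetP x z y h.swap')
    h.corner_mem_cornerCell h.innerPoint_mem_cornerCell h.swap'.corner_mem_cornerCell
    h.swap'.innerPoint_mem_cornerCell (y - z)
  refine ⟨l₀ / 16, (2 * l₁ + l₂ / 2) / 16, (2 * l₁ - l₂ / 2) / 16, fun a b c hs => ?_⟩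
  have := hl (2 * (b + c)) ((b - c) / 2)
  rw [h.innerPoint_eq] at this
  obtain rfl : a = 1 - b - c := by linarith
  have e : (1 - b - c) • x + b • y + c • z
      = x + (2 * (b + c)) • ((1 / 2 : ℝ) • x + (1 / 4 : ℝ) • y + (1 / 4 : ℝ) • z - x)
        + ((b - c) / 2) • (y - z) := by module
  rw [e, this]
  ring

/-- The jump across the segment between the edge midpoints. -/
theorem midline_jump (hp : Pieces t f P G) {x y z : Plane} (h : IsTri t x y z) :
    ∃ m₀ m₁ m₂ : ℝ, ∀ a b c : ℝ, a + b + c = 1 →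
      G x y (a • x + b • y + c • z) - P x y (a • x + b • y + c • z)
        = (a - 1 / 2) ^ 4 * (m₀ + m₁ * (a - 1 / 2) + m₂ * (b - c)) := by
  obtain ⟨l₀, l₁, l₂, hl⟩ := exists_jump (hp.polyG x y) (hp.polyP x y)
    (convex_convexHull ℝ _) (convex_convexHull ℝ _) (hp.jetG x y z h) (hp.jetP x y z h)
    h.midpoint_mem_centerCell h.innerPoint_mem_centerCell h.midpoint_mem_cornerCell
    h.innerPoint_mem_cornerCell (x - ((1 / 2 : ℝ) • y + (1 / 2 : ℝ) • z))
  refine ⟨l₀ + l₁, l₂, -2 * l₁, fun a b c hs => ?_⟩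
  have := hl (2 * (c - b) + 1) (a - 1 / 2)
  rw [h.innerPoint_eq, midpoint_eq_smul_add_smul] at this
  obtain rfl : a = 1 - b - c := by linarith
  have e : (1 - b - c) • x + b • y + c • z
      = (1 / 2 : ℝ) • x + (1 / 2 : ℝ) • y + (2 * (c - b) + 1) •
        ((1 / 2 : ℝ) • x + (1 / 4 : ℝ) • y + (1 / 4 : ℝ) • z
          - ((1 / 2 : ℝ) • x + (1 / 2 : ℝ) • y))
        + (1 - b - c - 1 / 2) • (x - ((1 / 2 : ℝ) • y + (1 / 2 : ℝ) • z)) := by module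
  rw [e, this]
  ring

/-- The jump across the part of the median from the inner point to the barycenter. -/
theorem center_jump (hp : Pieces t f P G) {x y z : Plane} (h : IsTri t x y z) :
    ∃ l₀ l₁ l₂ : ℝ, ∀ a b c : ℝ, a + b + c = 1 →
      G x y (a • x + b • y + c • z) - G x z (a • x + b • y + c • z)
        = (b - c) ^ 4 * (l₀ + l₁ * b + l₂ * c) := by
  obtain ⟨l₀, l₁, l₂, hl⟩ := exists_jump (hp.polyG x y) (hp.polyG x z)
    (convex_convexHull ℝ _) (convex_convexHull ℝ _) (hp.jetG x y z h) (hp.jetG x z y h.swap')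
    h.innerPoint_mem_centerCell h.barycenter_mem_centerCell h.swap'.innerPoint_mem_centerCell
    h.swap'.barycenter_mem_centerCell (y - z)
  refine ⟨(l₀ - 3 * l₁) / 16, (6 * l₁ + l₂ / 2) / 16, (6 * l₁ - l₂ / 2) / 16,
    fun a b c hs => ?_⟩
  have := hl (6 * (b + c) - 3) ((b - c) / 2)
  rw [h.innerPoint_eq, h.barycenter_eq] at this
  obtain rfl : a = 1 - b - c := by linarith
  have e : (1 - b - c) • x + b • y + c • z
      = (1 / 2 : ℝ) • x + (1 / 4 : ℝ) • y + (1 / 4 : ℝ) • z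
        + (6 * (b + c) - 3) • ((1 / 3 : ℝ) • x + (1 / 3 : ℝ) • y + (1 / 3 : ℝ) • z
          - ((1 / 2 : ℝ) • x + (1 / 4 : ℝ) • y + (1 / 4 : ℝ) • z))
        + ((b - c) / 2) • (y - z) := by module
  rw [e, this]
  ring

/-- The jump across the part of the median from the barycenter to the midpoint of an edge. -/
theorem half_median_jump (hp : Pieces t f P G) {x y z : Plane} (h : IsTri t x y z) :
    ∃ l₀ l₁ l₂ : ℝ, ∀ a b c : ℝ, a + b + c = 1 →
      G x y (a • x + b • y + c • z) - G y x (a • x + b • y + c • z)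
        = (a - b) ^ 4 * (l₀ + l₁ * (a - 1 / 2) + l₂ * (b - 1 / 2)) := by
  have hm : midpoint ℝ x y ∈ centerCell t y x := by
    rw [midpoint_comm]; exact h.swap.midpoint_mem_centerCell
  obtain ⟨l₀, l₁, l₂, hl⟩ := exists_jump (hp.polyG x y) (hp.polyG y x)
    (convex_convexHull ℝ _) (convex_convexHull ℝ _) (hp.jetG x y z h) (hp.jetG y x z h.swap)
    h.barycenter_mem_centerCell h.midpoint_mem_centerCell h.swap.barycenter_mem_centerCell
    hm (x - y)
  refine ⟨(l₀ + l₁) / 16, (3 * l₁ + l₂ / 2) / 16, (3 * l₁ - l₂ / 2) / 16, fun a b c hs => ?_⟩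
  have := hl (3 * (a + b) - 2) ((a - b) / 2)
  rw [h.barycenter_eq, midpoint_eq_smul_add_smul] at this
  obtain rfl : c = 1 - a - b := by linarith
  have e : a • x + b • y + (1 - a - b) • z
      = (1 / 3 : ℝ) • x + (1 / 3 : ℝ) • y + (1 / 3 : ℝ) • z
        + (3 * (a + b) - 2) • ((1 / 2 : ℝ) • x + (1 / 2 : ℝ) • y
          - ((1 / 3 : ℝ) • x + (1 / 3 : ℝ) • y + (1 / 3 : ℝ) • z))
        + ((a - b) / 2) • (x - y) := by module
  rw [e, this]
  ring

/-- The jump across a midline is the same on both sides of the median that crosses it. -/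
theorem exists_common_midline_jump (hp : Pieces t f P G) {x y z : Plane} (h : IsTri t x y z) :
    ∃ m₀ m₁ m₂ : ℝ, ∀ a b c : ℝ, a + b + c = 1 →
      (G x y (a • x + b • y + c • z) - P x y (a • x + b • y + c • z)
        = (a - 1 / 2) ^ 4 * (m₀ + m₁ * (a - 1 / 2) + m₂ * (b - c))) ∧
      (G x z (a • x + b • y + c • z) - P x z (a • x + b • y + c • z)
        = (a - 1 / 2) ^ 4 * (m₀ + m₁ * (a - 1 / 2) + m₂ * (b - c))) := by
  obtain ⟨m₀, m₁, m₂, hm⟩ := hp.midline_jump h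
  obtain ⟨n₀, n₁, n₂, hn⟩ := hp.midline_jump h.swap'
  obtain ⟨k₀, k₁, k₂, hk⟩ := hp.corner_jump h
  obtain ⟨l₀, l₁, l₂, hl⟩ := hp.center_jump h
  have hn' : ∀ a b c : ℝ, a + b + c = 1 →
      G x z (a • x + b • y + c • z) - P x z (a • x + b • y + c • z)
        = (a - 1 / 2) ^ 4 * (n₀ + n₁ * (a - 1 / 2) + n₂ * (c - b)) := by
    intro a b c hs
    have := hn a c b (by linarith)
    rwa [add_right_comm] at this
  -- In the coordinates `l = a - 1 / 2` and `k = b - c` the midline jumps on the two sides of the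
  -- median `k = 0` differ by the change of the jump across the median, a multiple of `k ^ 4`.
  have key := midline_eq (d₀ := m₀ - n₀) (d₁ := m₁ - n₁) (d₂ := m₂ + n₂)
    (e₀ := l₀ - k₀ + (l₁ - k₁ + l₂ - k₂) / 4) (e₁ := -(l₁ - k₁ + l₂ - k₂) / 2)
    (e₂ := (l₁ - k₁ - (l₂ - k₂)) / 2) (fun l k => by
      have e1 := hm (1 / 2 + l) ((1 / 2 - l + k) / 2) ((1 / 2 - l - k) / 2) (by ring)
      have e2 := hn' (1 / 2 + l) ((1 / 2 - l + k) / 2) ((1 / 2 - l - k) / 2) (by ring)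
      have e3 := hk (1 / 2 + l) ((1 / 2 - l + k) / 2) ((1 / 2 - l - k) / 2) (by ring)
      have e4 := hl (1 / 2 + l) ((1 / 2 - l + k) / 2) ((1 / 2 - l - k) / 2) (by ring)
      linear_combination e2 - e1 + e4 - e3)
  refine ⟨m₀, m₁, m₂, fun a b c hs => ⟨hm a b c hs, ?_⟩⟩
  rw [hn' a b c hs]
  obtain ⟨h0, h1, h2⟩ := key
  obtain rfl : m₀ = n₀ := by linarith
  obtain rfl : m₁ = n₁ := by linarith
  obtain rfl : m₂ = -n₂ := by linarith
  ring

/-- If the data on the two edges at a corner vanish, the piece at the edge is the third power of the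
equation of the edge times a quadratic form. -/
theorem corner (hp : Pieces t f P G) {x y z : Plane} (h : IsTri t x y z)
    (he : EdgeDataZero f (convexHull ℝ (t : Set Plane)) x y)
    (he' : EdgeDataZero f (convexHull ℝ (t : Set Plane)) x z) :
    ∃ q₀ q₁ q₂ : ℝ, ∀ a b c : ℝ, a + b + c = 1 → P x y (a • x + b • y + c • z)
      = c ^ 3 * (q₀ * b ^ 2 + q₁ * b * c + q₂ * c ^ 2) := by
  obtain ⟨q, hq, hP⟩ := hp.edge h he
  obtain ⟨q', hq', hP'⟩ := hp.edge h.swap' he'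
  obtain ⟨l₀, l₁, l₂, hl⟩ := hp.corner_jump h
  obtain ⟨h1, h2⟩ := corner_eq_zero (l₀ := l₀) (l₁ := l₁) (l₂ := l₂) hq hq' (fun b c => by
    rw [← hl (1 - b - c) b c (by ring), ← hP (1 - b - c) b c (by ring),
      ← hP' (1 - b - c) c b (by ring), add_right_comm])
  refine ⟨q 3, q 4, q 5, fun a b c hs => ?_⟩
  rw [hP a b c hs, hq, h1, h2]
  ring

end Pieces

/-- **Unisolvence on a single triangle.** A `C³` quintic spline on the 12-split vanishes if its
data on the three edges do. In barycentric coordinates every piece at an edge is the third power of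
the equation of the edge times a quadratic; the relations between the jumps around the edge
midpoints remove the jumps across midlines and half medians, and what is left is a multiple of the
fifth power of the equation of the edge, which the smoothness across the median at the corners
excludes. -/
theorem IsTri.eq_zero_of_edgeDataZero {t : Finset Plane} {x y z : Plane} (h : IsTri t x y z)
    {f : Plane → ℝ} (hf : ContDiffOn ℝ 3 f (convexHull ℝ (t : Set Plane)))
    (hpoly : ∀ K ∈ splitCells t, ∃ F, IsPoly 5 F ∧ EqOn f F K)
    (hedge : ∀ x y z, IsTri t x y z → EdgeDataZero f (convexHull ℝ (t : Set Plane)) x y) :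
    ∀ p ∈ convexHull ℝ (t : Set Plane), f p = 0 := by
  obtain ⟨P, G, hp⟩ := exists_pieces hf hpoly
  have corner : ∀ {x y z}, IsTri t x y z → ∃ q₀ q₁ q₂ : ℝ, ∀ a b c : ℝ, a + b + c = 1 →
      P x y (a • x + b • y + c • z) = c ^ 3 * (q₀ * b ^ 2 + q₁ * b * c + q₂ * c ^ 2) :=
    fun h => hp.corner h (hedge _ _ _ h) (hedge _ _ _ h.swap')
  -- The identity satisfied by the jumps around the midpoint of the edge from `x` to `y`,
  -- in the coordinates `u = a - 1 / 2` and `v = b - 1 / 2`, so that `c = -(u + v)`.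
  have around : ∀ {x y z}, IsTri t x y z → ∀ {m₀ m₁ m₂ n₀ n₁ n₂ : ℝ},
      (∀ a b c : ℝ, a + b + c = 1 →
        G x y (a • x + b • y + c • z) - P x y (a • x + b • y + c • z)
          = (a - 1 / 2) ^ 4 * (m₀ + m₁ * (a - 1 / 2) + m₂ * (b - c))) →
      (∀ a b c : ℝ, a + b + c = 1 →
        G y x (a • x + b • y + c • z) - P y x (a • x + b • y + c • z)
          = (b - 1 / 2) ^ 4 * (n₀ + n₁ * (b - 1 / 2) + n₂ * (c - a))) →
      ∃ r r₁ r₂ r₃ r₄ r₅ l l₁ l₂ : ℝ, (∀ u v : ℝ,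
        P x y ((1 / 2 + u) • x + (1 / 2 + v) • y + (-u - v) • z)
          - P y x ((1 / 2 + u) • x + (1 / 2 + v) • y + (-u - v) • z)
          = (u + v) ^ 3 * (r + r₁ * u + r₂ * v + r₃ * u ^ 2 + r₄ * u * v + r₅ * v ^ 2)) ∧
        ∀ u v : ℝ, (u + v) ^ 3 * (r + r₁ * u + r₂ * v + r₃ * u ^ 2 + r₄ * u * v + r₅ * v ^ 2)
          + u ^ 4 * ((m₀ + m₂ / 2) + (m₁ + m₂) * u + (2 * m₂) * v)
          - v ^ 4 * ((n₀ - n₂ / 2) + (-2 * n₂) * u + (n₁ - n₂) * v)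
          = (u - v) ^ 4 * (l + l₁ * u + l₂ * v) := by
    intro x y z h m₀ m₁ m₂ n₀ n₁ n₂ hm hn
    obtain ⟨q₀, q₁, q₂, hq⟩ := corner h
    obtain ⟨s₀, s₁, s₂, hs⟩ := corner h.swap
    obtain ⟨l, l₁, l₂, hl⟩ := hp.half_median_jump h
    have hR : ∀ u v : ℝ, P x y ((1 / 2 + u) • x + (1 / 2 + v) • y + (-u - v) • z)
          - P y x ((1 / 2 + u) • x + (1 / 2 + v) • y + (-u - v) • z)
          = (u + v) ^ 3 * ((s₀ - q₀) / 4 + (s₀ - s₁ / 2 + q₁ / 2) * u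
            + (-q₀ - s₁ / 2 + q₁ / 2) * v + (s₀ - s₁ + s₂ - q₂) * u ^ 2
            + (-s₁ + 2 * s₂ + q₁ - 2 * q₂) * u * v + (-q₀ + s₂ + q₁ - q₂) * v ^ 2) := by
      intro u v
      have e1 := hq (1 / 2 + u) (1 / 2 + v) (-u - v) (by ring)
      have e2 := hs (1 / 2 + v) (1 / 2 + u) (-u - v) (by ring)
      rw [add_comm ((1 / 2 + v) • y)] at e2
      rw [e1, e2]
      ring
    refine ⟨_, _, _, _, _, _, l, l₁, l₂, hR, fun u v => ?_⟩
    rw [← hR]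
    have e1 := hm (1 / 2 + u) (1 / 2 + v) (-u - v) (by ring)
    have e2 := hn (1 / 2 + u) (1 / 2 + v) (-u - v) (by ring)
    have e3 := hl (1 / 2 + u) (1 / 2 + v) (-u - v) (by ring)
    linear_combination e3 - e1 + e2
  obtain ⟨a₀, a₁, a₂, ha⟩ := hp.exists_common_midline_jump h
  obtain ⟨b₀, b₁, b₂, hb⟩ := hp.exists_common_midline_jump h.rot
  obtain ⟨c₀, c₁, c₂, hc⟩ := hp.exists_common_midline_jump h.rot.rot
  have rot₁ : ∀ (a b c : ℝ) (x y z : Plane),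
      b • y + c • z + a • x = a • x + b • y + c • z := fun a b c x y z => by abel
  obtain ⟨r, r₁, r₂, r₃, r₄, r₅, k, k₁, k₂, hx, hxy⟩ := around h (fun a b c hs => (ha a b c hs).1)
    (fun a b c hs => by
      have := (hb b c a (by linarith)).2
      rwa [rot₁] at this)
  obtain ⟨r', r₁', r₂', r₃', r₄', r₅', k', k₁', k₂', hy, hyz⟩ := around h.rot
    (fun a b c hs => (hb a b c hs).1)
    (fun a b c hs => by
      have := (hc b c a (by linarith)).2
      rwa [rot₁] at this)
  obtain ⟨s, s₁, s₂, s₃, s₄, s₅, j, j₁, j₂, hz, hzx⟩ := around h.rot.rot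
    (fun a b c hs => (hc a b c hs).1)
    (fun a b c hs => by
      have := (ha b c a (by linarith)).2
      rwa [rot₁] at this)
  -- The jumps across the midlines vanish at the edge midpoints.
  obtain ⟨e1, e2⟩ := edge_value_eq_zero hxy
  obtain ⟨e3, e4⟩ := edge_value_eq_zero hyz
  obtain ⟨e5, e6⟩ := edge_value_eq_zero hzx
  obtain rfl : a₀ = 0 := by linarith
  obtain rfl : a₂ = 0 := by linarith
  obtain rfl : b₀ = 0 := by linarith
  obtain rfl : b₂ = 0 := by linarith
  obtain rfl : c₀ = 0 := by linarith
  obtain rfl : c₂ = 0 := by linarith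
  -- Their slopes, one for each midline, add up to zero for any two midlines, hence they vanish.
  have f1 : a₁ + b₁ = 0 := edge_slope_add_eq_zero (r := r)
    (r₁ := r₁) (r₂ := r₂) (r₃ := r₃) (r₄ := r₄) (r₅ := r₅)
    (n := k) (n₁ := k₁) (n₂ := k₂) fun u v => by linear_combination hxy u v
  have f2 : b₁ + c₁ = 0 := edge_slope_add_eq_zero (r := r')
    (r₁ := r₁') (r₂ := r₂') (r₃ := r₃') (r₄ := r₄') (r₅ := r₅')
    (n := k') (n₁ := k₁') (n₂ := k₂') fun u v => by linear_combination hyz u v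
  have f3 : c₁ + a₁ = 0 := edge_slope_add_eq_zero (r := s)
    (r₁ := s₁) (r₂ := s₂) (r₃ := s₃) (r₄ := s₄) (r₅ := s₅)
    (n := j) (n₁ := j₁) (n₂ := j₂) fun u v => by linear_combination hzx u v
  obtain rfl : a₁ = 0 := by linarith
  obtain rfl : b₁ = 0 := by linarith
  obtain rfl : c₁ = 0 := by linarith
  -- Hence the two pieces at every edge coincide.
  have noJump : ∀ {r r₁ r₂ r₃ r₄ r₅ k k₁ k₂ : ℝ} {x y z : Plane}, (∀ u v : ℝ,
        P x y ((1 / 2 + u) • x + (1 / 2 + v) • y + (-u - v) • z)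
          - P y x ((1 / 2 + u) • x + (1 / 2 + v) • y + (-u - v) • z)
          = (u + v) ^ 3 * (r + r₁ * u + r₂ * v + r₃ * u ^ 2 + r₄ * u * v + r₅ * v ^ 2)) →
      (∀ u v : ℝ, (u + v) ^ 3 * (r + r₁ * u + r₂ * v + r₃ * u ^ 2 + r₄ * u * v + r₅ * v ^ 2)
          = (u - v) ^ 4 * (k + k₁ * u + k₂ * v)) →
      ∀ a b c : ℝ, a + b + c = 1 →
        P x y (a • x + b • y + c • z) = P y x (a • x + b • y + c • z) := by
    intro r r₁ r₂ r₃ r₄ r₅ k k₁ k₂ x y z h1 h2 a b c hs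
    obtain ⟨e0, e1, e2⟩ := edge_jump_eq_zero h2
    have e3 := h1 (a - 1 / 2) (b - 1 / 2)
    rw [h2, e0, e1, e2] at e3
    have e4 : (1 / 2 + (a - 1 / 2)) • x + (1 / 2 + (b - 1 / 2)) • y
        + (-(a - 1 / 2) - (b - 1 / 2)) • z = a • x + b • y + c • z := by
      obtain rfl : c = 1 - a - b := by linarith
      module
    rw [e4] at e3
    linarith
  have nxy := noJump (k := k) (k₁ := k₁) (k₂ := k₂) hx
    fun u v => by linear_combination hxy u v
  have nyz := noJump (k := k') (k₁ := k₁') (k₂ := k₂') hy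
    fun u v => by linear_combination hyz u v
  have nzx := noJump (k := j) (k₁ := j₁) (k₂ := j₂) hz
    fun u v => by linear_combination hzx u v
  have noJump' : ∀ {x y z : Plane}, IsTri t x y z → (∀ a b c : ℝ, a + b + c = 1 →
        P x y (a • x + b • y + c • z) = P y x (a • x + b • y + c • z)) →
      ∃ q : ℝ, ∀ a b c : ℝ, a + b + c = 1 →
        P x y (a • x + b • y + c • z) = q * c ^ 5 ∧
        P y x (a • x + b • y + c • z) = q * c ^ 5 := by
    intro x y z h hxy
    obtain ⟨q₀, q₁, q₂, hq⟩ := corner h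
    obtain ⟨s₀, s₁, s₂, hs⟩ := corner h.swap
    obtain ⟨e0, e1⟩ := coeff_eq_zero_of_quadratic_eq (a := q₀) (b := q₁) (c := q₂) (a' := s₀)
      (b' := s₁) (c' := s₂) fun a b c habc => by
        rw [← hq a b c habc, hxy a b c habc, ← hs b a c (by linarith), add_comm (a • x)]
    have : ∀ a b c : ℝ, a + b + c = 1 → P x y (a • x + b • y + c • z) = q₂ * c ^ 5 := by
      intro a b c habc
      rw [hq a b c habc, e0, e1]
      ring
    exact ⟨q₂, fun a b c habc => ⟨this a b c habc, by rw [← hxy a b c habc, this a b c habc]⟩⟩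
  obtain ⟨p₁, g₁⟩ := noJump' h nxy
  obtain ⟨p₂, g₂⟩ := noJump' h.rot nyz
  obtain ⟨p₃, g₃⟩ := noJump' h.rot.rot nzx
  have vanish : ∀ {x y z : Plane} {p q : ℝ}, IsTri t x y z →
      (∀ a b c : ℝ, a + b + c = 1 → P x y (a • x + b • y + c • z) = p * c ^ 5) →
      (∀ a b c : ℝ, a + b + c = 1 → P x z (a • x + b • y + c • z) = q * b ^ 5) → p = 0 := by
    intro x y z p q h h1 h2
    obtain ⟨l₀, l₁, l₂, hl⟩ := hp.corner_jump h
    refine corner_pow_five_eq_zero (c := p) (c' := q) (l₀ := l₀) (l₁ := l₁) (l₂ := l₂)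
      fun b c => ?_
    have e := hl (1 - b - c) b c (by ring)
    rwa [h1 _ _ _ (by ring), h2 _ _ _ (by ring)] at e
  obtain rfl : p₁ = 0 := vanish h (fun a b c hs => (g₁ a b c hs).1) (fun a b c hs => by
    have := (g₃ c a b (by linarith)).2
    rwa [← rot₁] at this)
  obtain rfl : p₂ = 0 := vanish h.rot (fun a b c hs => (g₂ a b c hs).1) (fun a b c hs => by
    have := (g₁ c a b (by linarith)).2
    rwa [← rot₁] at this)
  obtain rfl : p₃ = 0 := vanish h.rot.rot (fun a b c hs => (g₃ a b c hs).1) (fun a b c hs => by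
    have := (g₂ c a b (by linarith)).2
    rwa [← rot₁] at this)
  -- All pieces vanish.
  have all : ∀ {a b c : ℝ}, a + b + c = 1 →
      P x y (a • x + b • y + c • z) = 0 ∧ P y x (a • x + b • y + c • z) = 0 ∧
      P y z (a • x + b • y + c • z) = 0 ∧ P z y (a • x + b • y + c • z) = 0 ∧
      P z x (a • x + b • y + c • z) = 0 ∧ P x z (a • x + b • y + c • z) = 0 ∧
      G x y (a • x + b • y + c • z) = 0 ∧ G y x (a • x + b • y + c • z) = 0 ∧
      G y z (a • x + b • y + c • z) = 0 ∧ G z y (a • x + b • y + c • z) = 0 ∧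
      G z x (a • x + b • y + c • z) = 0 ∧ G x z (a • x + b • y + c • z) = 0 := by
    intro a b c hs
    obtain ⟨u1, u2⟩ := g₁ a b c hs
    obtain ⟨u3, u4⟩ := g₂ b c a (by linarith)
    obtain ⟨u5, u6⟩ := g₃ c a b (by linarith)
    obtain ⟨v1, v2⟩ := ha a b c hs
    obtain ⟨v3, v4⟩ := hb b c a (by linarith)
    obtain ⟨v5, v6⟩ := hc c a b (by linarith)
    rw [rot₁] at u3 u4 v3 v4
    rw [← rot₁] at u5 u6 v5 v6
    refine ⟨?_, ?_, ?_, ?_, ?_, ?_, ?_, ?_, ?_, ?_, ?_, ?_⟩ <;> linarith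
  intro p hpt
  obtain ⟨a', b', c', -, -, -, hs, rfl⟩ := h.exists_of_mem_convexHull hpt
  obtain ⟨w1, w2, w3, w4, w5, w6, w7, w8, w9, w10, w11, w12⟩ := all hs
  obtain ⟨u, v, w, huvw, hcell⟩ := h.exists_mem_cell hpt
  have hu := huvw.mem
  have hv := huvw.swap.mem
  have huv := huvw.ne
  rw [h.eq_insert] at hu hv
  simp only [Finset.mem_insert, Finset.mem_singleton] at hu hv
  rcases hcell with hcell | hcell
  · rw [hp.eqP u v w huvw hcell]
    rcases hu with rfl | rfl | rfl <;> rcases hv with rfl | rfl | rfl <;>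
      first | exact (huv rfl).elim | assumption
  · rw [hp.eqG u v w huvw hcell]
    rcases hu with rfl | rfl | rfl <;> rcases hv with rfl | rfl | rfl <;>
      first | exact (huv rfl).elim | assumption

/-! ### The degrees of freedom attached to a triangle -/

/-- The degrees of freedom as functionals on all functions on a domain `D`. The domains of interest
are the region, a single triangle, and the whole plane. -/
def dofEval {Δ : Triangulation} (d : CrossDirections Δ) (D : Set Plane) :
    Dof Δ → (Plane → ℝ) → ℝ
  | .vertex v k j, f => dirDeriv D v (coordDirections k j) f
  | .mid e, f => dirDeriv D (edgeMidpoint e) (fun _ : Fin 1 => d.mid e) f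
  | .quarter e a, f => dirDeriv D (edgeQuarterpoint e a) (fun _ : Fin 2 => d.quarter e a) f

/-- The point of evaluation of a degree of freedom. -/
def dofPoint {Δ : Triangulation} : Dof Δ → Plane
  | .vertex v _ _ => v
  | .mid e => edgeMidpoint e
  | .quarter e a => edgeQuarterpoint e a

/-- The order of differentiation of a degree of freedom. -/
def dofOrder {Δ : Triangulation} : Dof Δ → ℕ
  | .vertex _ k _ => k
  | .mid _ => 1
  | .quarter _ _ => 2

theorem dofFunctional_apply {Δ : Triangulation} (d : CrossDirections Δ) (i : Dof Δ)
    (s : splineSpace Δ) : (dofFunctional Δ d i).functional s = dofEval d Δ.region i s := by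
  cases i <;> rfl

theorem dofFunctional_carrier {Δ : Triangulation} (d : CrossDirections Δ) (i : Dof Δ) :
    (dofFunctional Δ d i).carrier = dofPoint i := by
  cases i <;> rfl

theorem dofOrder_le {Δ : Triangulation} (i : Dof Δ) : dofOrder i ≤ 3 := by
  cases i with
  | vertex v k j => exact Nat.le_of_lt_succ k.2
  | mid e => simp [dofOrder]
  | quarter e a => simp [dofOrder]

theorem dofEval_congr {Δ : Triangulation} (d : CrossDirections Δ) {D D' : Set Plane}
    {f g : Plane → ℝ} (i : Dof Δ)
    (h : iteratedFDerivWithin ℝ (dofOrder i) f D (dofPoint i)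
      = iteratedFDerivWithin ℝ (dofOrder i) g D' (dofPoint i)) :
    dofEval d D i f = dofEval d D' i g := by
  cases i with
  | vertex v k j => exact DFunLike.congr_fun h (coordDirections k j)
  | mid e => exact DFunLike.congr_fun h fun _ : Fin 1 => d.mid e
  | quarter e a => exact DFunLike.congr_fun h fun _ : Fin 2 => d.quarter e a

theorem dofEval_add {Δ : Triangulation} (d : CrossDirections Δ) {D : Set Plane}
    (hD : UniqueDiffOn ℝ D) {f g : Plane → ℝ} (i : Dof Δ) (hi : dofPoint i ∈ D)
    (hf : ContDiffOn ℝ 3 f D) (hg : ContDiffOn ℝ 3 g D) :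
    dofEval d D i (f + g) = dofEval d D i f + dofEval d D i g := by
  have h := dofOrder_le i
  have h' : ((dofOrder i : ℕ) : ℕ∞ω) ≤ 3 := by exact_mod_cast h
  cases i <;> exact dirDeriv_add _ hD hi (.of_contDiffOn hD hi (hf.of_le h'))
    (.of_contDiffOn hD hi (hg.of_le h'))

theorem dofEval_smul {Δ : Triangulation} (d : CrossDirections Δ) {D : Set Plane}
    (hD : UniqueDiffOn ℝ D) {f : Plane → ℝ} (c : ℝ) (i : Dof Δ) (hi : dofPoint i ∈ D)
    (hf : ContDiffOn ℝ 3 f D) :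
    dofEval d D i (c • f) = c * dofEval d D i f := by
  have h := dofOrder_le i
  have h' : ((dofOrder i : ℕ) : ℕ∞ω) ≤ 3 := by exact_mod_cast h
  cases i <;> exact dirDeriv_smul _ hD hi c (.of_contDiffOn hD hi (hf.of_le h'))

theorem edgeMidpoint_eq {e : Finset Plane} {x y : Plane} (hxy : x ≠ y)
    (he : (e : Set Plane) = {x, y}) : edgeMidpoint e = x + (1 / 2 : ℝ) • (y - x) := by
  have : e = {x, y} := by apply Finset.coe_injective; simp [he]
  rw [edgeMidpoint, this, Finset.sum_pair hxy]
  module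

/-- A direction not parallel to an edge is transverse to it in terms of the cross product. -/
theorem cross_ne_zero_of_notMem_vectorSpan {e : Finset Plane} {x y u : Plane} (hxy : x ≠ y)
    (he : (e : Set Plane) = {x, y}) (hu : u ∉ vectorSpan ℝ (e : Set Plane)) :
    cross (y - x) u ≠ 0 := by
  intro hc
  apply hu
  rw [he, pair_comm, mem_vectorSpan_pair]
  by_cases h0 : y 0 - x 0 = 0
  · have h1 : y 1 - x 1 ≠ 0 := fun h1 => hxy (plane_ext (by linarith) (by linarith))
    refine ⟨u 1 / (y 1 - x 1), plane_ext ?_ ?_⟩ <;>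
      simp only [vsub_eq_sub, PiLp.smul_apply, PiLp.sub_apply, smul_eq_mul, cross] at hc ⊢
    · rw [h0] at hc ⊢
      have : u 0 = 0 := by simpa [h1] using hc
      simp [this]
    · field_simp
  · refine ⟨u 0 / (y 0 - x 0), plane_ext ?_ ?_⟩ <;>
      simp only [vsub_eq_sub, PiLp.smul_apply, PiLp.sub_apply, smul_eq_mul, cross] at hc ⊢
    · field_simp
    · field_simp
      linarith

/-- If the degrees of freedom on an edge vanish, all data on the edge vanish. The polynomials `F`
and `G` provide the symmetry of the derivatives of `h` at the endpoints, by which the partial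
derivatives determine all derivatives. -/
theorem edgeDataZero_of_dofEval {Δ : Triangulation} (d : CrossDirections Δ) {e : Finset Plane}
    (heΔ : e ∈ Δ.edges) {x y : Plane} (hxy : x ≠ y) (he : (e : Set Plane) = {x, y})
    {h : Plane → ℝ} {D : Set Plane} {F G : Plane → ℝ} (hF : IsPoly 5 F) (hG : IsPoly 5 G)
    (jF : JetEq h D F x) (jG : JetEq h D G y)
    (h0 : ∀ i : Dof Δ, dofPoint i ∈ convexHull ℝ (e : Set Plane) → dofEval d D i h = 0) :
    EdgeDataZero h D x y := by
  have hx : x ∈ e := by rw [← Finset.mem_coe, he]; simp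
  have hy : y ∈ e := by rw [← Finset.mem_coe, he]; simp
  have hv : ∀ v ∈ e, v ∈ Δ.vertices := fun v hv => by
    obtain ⟨-, t, ht, het⟩ := heΔ
    exact ⟨t, ht, het hv⟩
  have hmt : d.mid ⟨e, heΔ⟩ ∉ vectorSpan ℝ (e : Set Plane) := d.mid_transverse ⟨e, heΔ⟩
  have hqt : ∀ (a : Plane) (ha : a ∈ e), d.quarter ⟨e, heΔ⟩ ⟨a, ha⟩ ∉
      vectorSpan ℝ (e : Set Plane) := fun a ha => d.quarter_transverse ⟨e, heΔ⟩ ⟨a, ha⟩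
  have hm := edgeMidpoint_eq hxy he
  have hmem : ∀ τ ∈ Icc (0 : ℝ) 1, x + τ • (y - x) ∈ convexHull ℝ (e : Set Plane) :=
    fun τ hτ => (convex_convexHull ℝ _).add_smul_sub_mem (subset_convexHull ℝ _ hx)
      (subset_convexHull ℝ _ hy) hτ
  have hq1 : edgeQuarterpoint e x = x + (1 / 4 : ℝ) • (y - x) := by
    rw [edgeQuarterpoint, hm]; module
  have hq2 : edgeQuarterpoint e y = x + (3 / 4 : ℝ) • (y - x) := by
    rw [edgeQuarterpoint, hm]; module
  have vert : ∀ v ∈ e, ∀ F, IsPoly 5 F → JetEq h D F v → ∀ j ≤ 3,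
      iteratedFDerivWithin ℝ j h D v = 0 := by
    intro v hve F hF jF j hj
    rw [jF j hj]
    refine iteratedFDeriv_eq_zero_of_coordDirections hF.contDiff hj fun i hi => ?_
    have := h0 (.vertex ⟨v, hv v hve⟩ ⟨j, by omega⟩ ⟨i, by simpa using Nat.lt_succ_of_le hi⟩)
      (subset_convexHull ℝ _ hve)
    rw [← jF j hj]
    exact this
  refine ⟨vert x hx F hF jF, vert y hy G hG jG, ?_, ?_, ?_⟩
  · refine ⟨d.mid ⟨e, heΔ⟩, cross_ne_zero_of_notMem_vectorSpan hxy he hmt, ?_⟩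
    have := h0 (.mid ⟨e, heΔ⟩) (by
      simp only [dofPoint]; rw [hm]; exact hmem _ (by norm_num))
    simp only [dofEval, dirDeriv] at this
    rwa [hm] at this
  · refine ⟨d.quarter ⟨e, heΔ⟩ ⟨x, hx⟩,
      cross_ne_zero_of_notMem_vectorSpan hxy he (hqt _ _), ?_⟩
    have := h0 (.quarter ⟨e, heΔ⟩ ⟨x, hx⟩) (by
      simp only [dofPoint]; rw [hq1]; exact hmem _ (by norm_num))
    simp only [dofEval, dirDeriv] at this
    rwa [hq1] at this
  · refine ⟨d.quarter ⟨e, heΔ⟩ ⟨y, hy⟩,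
      cross_ne_zero_of_notMem_vectorSpan hxy he (hqt _ _), ?_⟩
    have := h0 (.quarter ⟨e, heΔ⟩ ⟨y, hy⟩) (by
      simp only [dofPoint]; rw [hq2]; exact hmem _ (by norm_num))
    simp only [dofEval, dirDeriv] at this
    rwa [hq2] at this

theorem IsTri.edge_mem {Δ : Triangulation} {t : Finset Plane} (ht : t ∈ Δ.triangles)
    {x y z : Plane} (h : IsTri t x y z) : ({x, y} : Finset Plane) ∈ Δ.edges :=
  ⟨Finset.card_pair h.ne, t, ht, by rw [h.eq_insert]; intro p; simp; tauto⟩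

theorem Triangulation.exists_isTri (Δ : Triangulation) {t : Finset Plane}
    (ht : t ∈ Δ.triangles) : ∃ x y z, IsTri t x y z := by
  have h3 := Δ.card_eq t ht
  obtain ⟨x, y, z, hxy, -, -, rfl⟩ := Finset.card_eq_three.1 h3
  obtain ⟨w, hw⟩ := PowellSabin.exists_isTri h3 (Δ.indep _ ht) (x := x) (y := y) (by simp)
    (by simp) hxy
  exact ⟨x, y, w, hw⟩

/-- **Local unisolvence.** A `C³` quintic spline on the 12-split of a triangle vanishes if its
degrees of freedom carried by the triangle do. -/
theorem eq_zero_of_dofEval_eq_zero {Δ : Triangulation} (d : CrossDirections Δ) {t : Finset Plane}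
    (ht : t ∈ Δ.triangles) {f : Plane → ℝ}
    (hf : ContDiffOn ℝ 3 f (convexHull ℝ (t : Set Plane)))
    (hpoly : ∀ K ∈ splitCells t, ∃ F, IsPoly 5 F ∧ EqOn f F K)
    (h0 : ∀ i : Dof Δ, dofPoint i ∈ convexHull ℝ (t : Set Plane) →
      dofEval d (convexHull ℝ (t : Set Plane)) i f = 0) :
    ∀ p ∈ convexHull ℝ (t : Set Plane), f p = 0 := by
  obtain ⟨x, y, z, h⟩ := Δ.exists_isTri ht
  refine h.eq_zero_of_edgeDataZero hf hpoly fun x y z h => ?_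
  obtain ⟨P, G, hp⟩ := exists_pieces hf hpoly
  refine edgeDataZero_of_dofEval d (h.edge_mem ht) h.ne (by simp) (hp.polyP x y) (hp.polyP y x)
    (hp.jetP x y z h x h.corner_mem_cornerCell)
    (hp.jetP y x z h.swap y h.swap.corner_mem_cornerCell) fun i hi => h0 i ?_
  refine convexHull_mono ?_ hi
  rw [h.eq]
  intro p
  simp
  tauto

/-- A point of a triangle `t'` that lies in `t` is a combination of common corners only: two
representations by the affinely independent corners of `t'` agree. -/
theorem Triangulation.mem_of_mem_convexHull (Δ : Triangulation) {t t' : Finset Plane}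
    (ht : t ∈ Δ.triangles) (ht' : t' ∈ Δ.triangles) {w : Plane → ℝ} (hw : ∀ p ∈ t', 0 ≤ w p)
    (hw1 : ∑ p ∈ t', w p = 1) (hmem : ∑ p ∈ t', w p • p ∈ convexHull ℝ (t : Set Plane))
    {x : Plane} (hx : x ∈ t') (hwx : w x ≠ 0) : x ∈ t := by
  classical
  have h1 : ∑ p ∈ t', w p • p ∈ convexHull ℝ (t' : Set Plane) :=
    (convex_convexHull ℝ _).sum_mem hw hw1 fun p hp => subset_convexHull ℝ _ hp
  have h2 := Δ.inter t' ht' t ht ⟨h1, hmem⟩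
  rw [← Finset.coe_inter, Finset.mem_convexHull'] at h2
  obtain ⟨u, -, hu1, hu2⟩ := h2
  have hind := affineIndependent_iff.1 (Δ.indep t' ht') t'.attach
    (fun p => w p - if p.1 ∈ t then u p else 0)
  have e : ∀ {M : Type} [AddCommMonoid M] (g : Plane → M),
      ∑ p ∈ t' ∩ t, g p = ∑ p ∈ t', if p ∈ t then g p else 0 := fun g => by
    rw [← Finset.filter_mem_eq_inter, Finset.sum_filter]
  have h3 := hind (by
    rw [Finset.sum_attach t' (fun p => w p - if p ∈ t then u p else 0), Finset.sum_sub_distrib,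
      ← e, hu1, hw1, sub_self]) (by
    rw [Finset.sum_attach t' (fun p => (w p - if p ∈ t then u p else 0) • p)]
    simp only [sub_smul, ite_smul, zero_smul, Finset.sum_sub_distrib]
    rw [← e (fun p => u p • p), hu2, sub_self]) ⟨x, hx⟩ (Finset.mem_attach _ _)
  by_contra hxt
  simp only [hxt, if_false, sub_zero] at h3
  exact hwx h3

theorem Triangulation.mem_of_vertex_mem (Δ : Triangulation) {t : Finset Plane}
    (ht : t ∈ Δ.triangles) {v : Plane} (hv : v ∈ Δ.vertices)
    (h : v ∈ convexHull ℝ (t : Set Plane)) : v ∈ t := by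
  classical
  obtain ⟨t', ht', hvt⟩ := hv
  refine Δ.mem_of_mem_convexHull ht ht' (w := fun p => if p = v then 1 else 0)
    (fun p _ => by split_ifs <;> norm_num) (by simp [hvt]) ?_ hvt (by simp)
  simpa [ite_smul, hvt] using h

/-- A triangle that contains a point of the relative interior of an edge has this edge. -/
theorem Triangulation.subset_of_combination_mem (Δ : Triangulation) {t : Finset Plane}
    (ht : t ∈ Δ.triangles) {e : Finset Plane} (he : e ∈ Δ.edges) {w : Plane → ℝ}
    (hw : ∀ p ∈ e, 0 < w p) (hw1 : ∑ p ∈ e, w p = 1)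
    (h : ∑ p ∈ e, w p • p ∈ convexHull ℝ (t : Set Plane)) : e ⊆ t := by
  classical
  obtain ⟨-, t', ht', het⟩ := he
  intro x hx
  have hsum : ∀ {M : Type} [AddCommMonoid M] (g : Plane → M),
      (∑ p ∈ t', if p ∈ e then g p else 0) = ∑ p ∈ e, g p := fun g => by
    rw [← Finset.sum_filter, Finset.filter_mem_eq_inter, Finset.inter_eq_right.2 het]
  refine Δ.mem_of_mem_convexHull ht ht' (w := fun p => if p ∈ e then w p else 0)
    (fun p _ => by split_ifs with hp; exacts [(hw p hp).le, le_rfl]) (by rw [hsum, hw1]) ?_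
    (het hx) (by simpa [hx] using (hw x hx).ne')
  simp only [ite_smul, zero_smul]
  rwa [hsum]

/-- The midpoint of an edge is carried by the triangles that have the edge, and by no others. -/
theorem edgeMidpoint_mem_iff {Δ : Triangulation} {t : Finset Plane} (ht : t ∈ Δ.triangles)
    {e : Finset Plane} (he : e ∈ Δ.edges) :
    edgeMidpoint e ∈ convexHull ℝ (t : Set Plane) ↔ e ⊆ t := by
  have h2 := he.1
  constructor
  · intro h
    refine Δ.subset_of_combination_mem ht he (w := fun _ => 1 / 2) (fun _ _ => by norm_num)
      (by simp [h2]) ?_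
    rwa [← Finset.smul_sum]
  · intro h
    have := (convex_convexHull ℝ (t : Set Plane)).sum_mem (t := e) (w := fun _ => (1 / 2 : ℝ))
      (z := fun x => x) (fun _ _ => by norm_num) (by simp [h2])
      (fun x hx => subset_convexHull ℝ _ (h hx))
    rwa [← Finset.smul_sum] at this

theorem edgeQuarterpoint_mem_iff {Δ : Triangulation} {t : Finset Plane} (ht : t ∈ Δ.triangles)
    {e : Finset Plane} (he : e ∈ Δ.edges) {a : Plane} (ha : a ∈ e) :
    edgeQuarterpoint e a ∈ convexHull ℝ (t : Set Plane) ↔ e ⊆ t := by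
  classical
  have h2 := he.1
  constructor
  · intro h
    refine Δ.subset_of_combination_mem ht he
      (w := fun p => 1 / 4 + if p = a then 1 / 2 else 0)
      (fun p _ => by split_ifs <;> norm_num) (by
        rw [Finset.sum_add_distrib]; simp [h2, ha]; norm_num) ?_
    simp only [add_smul, ite_smul, zero_smul, Finset.sum_add_distrib, Finset.sum_ite_eq', ha,
      if_true]
    rw [← Finset.smul_sum]
    rw [edgeQuarterpoint, edgeMidpoint] at h
    convert h using 1
    module
  · intro h
    have := (convex_convexHull ℝ (t : Set Plane)).add_smul_sub_mem
      (subset_convexHull ℝ _ (h ha)) ((edgeMidpoint_mem_iff ht he).2 h)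
      (t := 1 / 2) (by norm_num)
    rw [edgeQuarterpoint]
    convert this using 1
    module

/-- The labels of the degrees of freedom of a single triangle `t`. -/
abbrev LocalDof (t : Finset Plane) : Type :=
  (t × Σ k : Fin 4, Fin (k.1 + 1)) ⊕ (t.powersetCard 2 ⊕ Σ e : t.powersetCard 2, e.1)

/-- The degree of freedom with a given local label. -/
def LocalDof.toDof {Δ : Triangulation} {t : Finset Plane} (ht : t ∈ Δ.triangles) :
    LocalDof t → Dof Δ
  | .inl p => .vertex ⟨p.1, t, ht, p.1.2⟩ p.2.1 p.2.2
  | .inr (.inl e) => .mid ⟨e, (Finset.mem_powersetCard.1 e.2).2, t, ht,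
      (Finset.mem_powersetCard.1 e.2).1⟩
  | .inr (.inr p) => .quarter ⟨p.1, (Finset.mem_powersetCard.1 p.1.2).2, t, ht,
      (Finset.mem_powersetCard.1 p.1.2).1⟩ p.2

theorem LocalDof.toDof_injective {Δ : Triangulation} {t : Finset Plane}
    (ht : t ∈ Δ.triangles) : Function.Injective (toDof ht) := by
  rintro (⟨⟨v, hv⟩, k, j⟩ | ⟨e, he⟩ | ⟨⟨e, he⟩, a⟩)
    (⟨⟨v', hv'⟩, k', j'⟩ | ⟨e', he'⟩ | ⟨⟨e', he'⟩, a'⟩) h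
  · simp only [toDof, Dof.vertex.injEq] at h
    obtain ⟨h1, rfl, h⟩ := h
    obtain rfl : v = v' := congrArg Subtype.val h1
    simp_all
  · cases h
  · cases h
  · cases h
  · simp only [toDof, Dof.mid.injEq] at h
    obtain rfl : e = e' := congrArg Subtype.val h
    rfl
  · cases h
  · cases h
  · cases h
  · simp only [toDof, Dof.quarter.injEq] at h
    obtain ⟨h1, h⟩ := h
    obtain rfl : e = e' := congrArg Subtype.val h1
    simp_all

theorem LocalDof.range_toDof {Δ : Triangulation} {t : Finset Plane} (ht : t ∈ Δ.triangles) :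
    range (toDof ht) = {i | dofPoint i ∈ convexHull ℝ (t : Set Plane)} := by
  ext i
  constructor
  · rintro ⟨⟨⟨v, hv⟩, k, j⟩ | ⟨e, he⟩ | ⟨⟨e, he⟩, a⟩, rfl⟩
    · exact subset_convexHull ℝ _ hv
    · exact (edgeMidpoint_mem_iff ht ⟨(Finset.mem_powersetCard.1 he).2, t, ht,
        (Finset.mem_powersetCard.1 he).1⟩).2 (Finset.mem_powersetCard.1 he).1
    · exact (edgeQuarterpoint_mem_iff ht ⟨(Finset.mem_powersetCard.1 he).2, t, ht,
        (Finset.mem_powersetCard.1 he).1⟩ a.2).2 (Finset.mem_powersetCard.1 he).1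
  · intro hi
    cases i with
    | vertex v k j =>
      exact ⟨.inl ⟨⟨v, Δ.mem_of_vertex_mem ht v.2 hi⟩, k, j⟩, rfl⟩
    | mid e =>
      exact ⟨.inr (.inl ⟨e, Finset.mem_powersetCard.2
        ⟨(edgeMidpoint_mem_iff ht e.2).1 hi, e.2.1⟩⟩), rfl⟩
    | quarter e a =>
      exact ⟨.inr (.inr ⟨⟨e, Finset.mem_powersetCard.2
        ⟨(edgeQuarterpoint_mem_iff ht e.2 a.2).1 hi, e.2.1⟩⟩, a⟩), rfl⟩

/-- The count is `3 * 10 + 3 + 3 * 2`. -/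
theorem LocalDof.card {t : Finset Plane} (ht : t.card = 3) : Nat.card (LocalDof t) = 39 := by
  have h : ∀ e : t.powersetCard 2, Nat.card e.1 = 2 := fun e => by
    simpa using (Finset.mem_powersetCard.1 e.2).2
  rw [Nat.card_sum, Nat.card_sum, Nat.card_prod, Nat.card_sigma, Nat.card_sigma]
  have h' : Nat.card (t.powersetCard 2) = 3 := by
    rw [Nat.card_eq_fintype_card, Fintype.card_coe, Finset.card_powersetCard, ht]
    rfl
  simp only [h, h']
  simp [ht, Finset.card_powersetCard, Fin.sum_univ_succ]

theorem ncard_dof {Δ : Triangulation} {t : Finset Plane} (ht : t ∈ Δ.triangles) :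
    {i : Dof Δ | dofPoint i ∈ convexHull ℝ (t : Set Plane)}.ncard = 39 := by
  rw [← LocalDof.range_toDof ht, ← Nat.card_coe_set_eq,
    Nat.card_range_of_injective (LocalDof.toDof_injective ht), LocalDof.card (Δ.card_eq t ht)]

theorem Triangulation.finite_vertices (Δ : Triangulation) : Δ.vertices.Finite := by
  classical
  refine (Δ.triangles.biUnion id).finite_toSet.subset ?_
  rintro v ⟨t, ht, hv⟩
  simp only [Finset.coe_biUnion, mem_iUnion]
  exact ⟨t, ht, hv⟩

theorem Triangulation.finite_edges (Δ : Triangulation) : Δ.edges.Finite := by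
  classical
  refine (Δ.triangles.biUnion fun t => t.powerset).finite_toSet.subset ?_
  rintro e ⟨-, t, ht, he⟩
  simp only [Finset.coe_biUnion, mem_iUnion]
  exact ⟨t, ht, by simpa using he⟩

instance (Δ : Triangulation) : Finite (Dof Δ) := by
  have := Δ.finite_vertices.to_subtype
  have := Δ.finite_edges.to_subtype
  let f : (Δ.vertices × Σ k : Fin 4, Fin (k.1 + 1)) ⊕ (Δ.edges ⊕ Σ e : Δ.edges, e.1) → Dof Δ :=
    Sum.elim (fun p => .vertex p.1 p.2.1 p.2.2) (Sum.elim .mid fun p => .quarter p.1 p.2)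
  refine Finite.of_surjective f fun i => ?_
  cases i with
  | vertex v k j => exact ⟨.inl ⟨v, k, j⟩, rfl⟩
  | mid e => exact ⟨.inr (.inl e), rfl⟩
  | quarter e a => exact ⟨.inr (.inr ⟨e, a⟩), rfl⟩

/-! ### Local interpolation -/

/-- Truncated powers are as smooth as their exponent allows. -/
theorem contDiff_max_zero_pow (n : ℕ) : ContDiff ℝ n (fun s : ℝ => max 0 s ^ (n + 1)) := by
  induction n with
  | zero => exact contDiff_zero.2 (by fun_prop)
  | succ n ih =>
    have hd : ∀ s : ℝ, HasDerivAt (fun s : ℝ => max 0 s ^ (n + 1 + 1))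
        (((n : ℝ) + 2) * max 0 s ^ (n + 1)) s := by
      intro s
      rcases lt_trichotomy s 0 with hs | rfl | hs
      · have h1 : (fun s : ℝ => max 0 s ^ (n + 1 + 1)) =ᶠ[𝓝 s] fun _ => 0 := by
          filter_upwards [Iio_mem_nhds hs] with y hy
          rw [max_eq_left (le_of_lt hy)]; simp
        rw [max_eq_left hs.le]
        simpa using (hasDerivAt_const s (0 : ℝ)).congr_of_eventuallyEq h1
      · rw [hasDerivAt_iff_isLittleO_nhds_zero]
        have h1 : (fun h : ℝ => h ^ (n + 1 + 1)) =o[𝓝 0] fun h : ℝ => h := by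
          simpa using Asymptotics.isLittleO_pow_pow (𝕜 := ℝ) (show 1 < n + 1 + 1 by omega)
        refine Asymptotics.IsBigO.trans_isLittleO ?_ h1
        refine Asymptotics.isBigO_of_le _ fun h => ?_
        simp only [zero_add, max_self, ne_eq, Nat.add_eq_zero_iff, one_ne_zero, and_false,
          not_false_eq_true, zero_pow, mul_zero, smul_zero, sub_zero, norm_pow]
        gcongr
        rw [Real.norm_eq_abs, Real.norm_eq_abs, abs_of_nonneg (le_max_left _ _)]
        exact max_le (abs_nonneg _) (le_abs_self _)
      · have h1 : (fun s : ℝ => max 0 s ^ (n + 1 + 1)) =ᶠ[𝓝 s] fun s => s ^ (n + 1 + 1) := by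
          filter_upwards [Ioi_mem_nhds hs] with y hy
          rw [max_eq_right (le_of_lt hy)]
        rw [max_eq_right hs.le]
        have := (hasDerivAt_pow (n + 1 + 1) s).congr_of_eventuallyEq h1
        refine this.congr_deriv ?_
        rw [Nat.add_sub_cancel]
        push_cast
        ring
    have hderiv : deriv (fun s : ℝ => max 0 s ^ (n + 1 + 1))
        = fun s : ℝ => ((n : ℝ) + 2) * max 0 s ^ (n + 1) := funext fun s => (hd s).deriv
    have : ContDiff ℝ ((n : ℕ∞ω) + 1) (fun s : ℝ => max 0 s ^ (n + 1 + 1)) := by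
      rw [contDiff_succ_iff_deriv]
      refine ⟨fun s => (hd s).differentiableAt, by simp, ?_⟩
      rw [hderiv]
      exact contDiff_const.mul ih
    exact_mod_cast this

theorem coeff_eq_zero_of_forall_Ioo {n : ℕ} {a : Fin n → ℝ} {l r : ℝ} (hlr : l < r)
    (h : ∀ t ∈ Ioo l r, ∑ j, a j * t ^ (j : ℕ) = 0) : ∀ j, a j = 0 := by
  have h0 : (∑ j : Fin n, Polynomial.C (a j) * Polynomial.X ^ (j : ℕ) : ℝ[X]) = 0 := by
    refine Polynomial.eq_zero_of_infinite_isRoot _ ((Ioo_infinite hlr).mono fun t ht => ?_)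
    simpa [Polynomial.IsRoot, Polynomial.eval_finsetSum] using h t ht
  intro j
  have := congrArg (fun p => Polynomial.coeff p j) h0
  simpa [Polynomial.finsetSum_coeff, Polynomial.coeff_X_pow, Fin.val_inj] using this

/-- The exponents `(i, j)` with `i + j ≤ 5` of a bivariate quintic. -/
abbrev QuinticIndex : Type := Σ i : Fin 6, Fin (6 - i.1)

/-- The quintic with given coefficients, in the variables `b` and `g`. -/
def quintic (c : QuinticIndex → ℝ) (b g : ℝ) : ℝ :=
  ∑ i : Fin 6, (∑ j : Fin (6 - i.1), c ⟨i, j⟩ * g ^ (j : ℕ)) * b ^ (i : ℕ)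

theorem quintic_coeff_eq_zero {c : QuinticIndex → ℝ} {l r l' r' : ℝ} (h : l < r) (h' : l' < r')
    (h0 : ∀ b ∈ Ioo l r, ∀ g ∈ Ioo l' r', quintic c b g = 0) : c = 0 := by
  funext ⟨i, j⟩
  refine coeff_eq_zero_of_forall_Ioo (a := fun j : Fin (6 - i.1) => c ⟨i, j⟩) h'
    (fun g hg => ?_) j
  exact coeff_eq_zero_of_forall_Ioo
    (a := fun i : Fin 6 => ∑ j : Fin (6 - i.1), c ⟨i, j⟩ * g ^ (j : ℕ)) h
    (fun b hb => h0 b hb g hg) i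

/-- Affine equations of the six lines of the 12-split of a triangle with corners `x, y, z`, in
terms of the barycentric coordinates `b` at `y` and `g` at `z`: the three lines through two edge
midpoints, and the three medians. All six are nonpositive on the subtriangle
`cornerCell t x y`. -/
def splitLine (l : Fin 6) (b g : ℝ) : ℝ :=
  ![b + g - 1 / 2, b - 1 / 2, g - 1 / 2, g - b, 2 * b + g - 1, b + 2 * g - 1] l

theorem splitLine_eq (l : Fin 6) :
    (splitLine l = fun b g => b + g - 1 / 2) ∨ (splitLine l = fun b _ => b - 1 / 2) ∨
    (splitLine l = fun _ g => g - 1 / 2) ∨ (splitLine l = fun b g => g - b) ∨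
    (splitLine l = fun b g => 2 * b + g - 1) ∨ (splitLine l = fun b g => b + 2 * g - 1) := by
  fin_cases l
  · exact Or.inl rfl
  · exact Or.inr (Or.inl rfl)
  · exact Or.inr (Or.inr (Or.inl rfl))
  · exact Or.inr (Or.inr (Or.inr (Or.inl rfl)))
  · exact Or.inr (Or.inr (Or.inr (Or.inr (Or.inl rfl))))
  · exact Or.inr (Or.inr (Or.inr (Or.inr (Or.inr rfl))))

/-- The spline `p + ∑ q_l (ℓ_l)₊ ^ 4`, with a quintic `p` and affine functions `q_l`, in
barycentric coordinates. -/
def ridgeSpline (c : (QuinticIndex → ℝ) × (Fin 6 → Fin 3 → ℝ)) (b g : ℝ) : ℝ :=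
  quintic c.1 b g + ∑ l, (c.2 l 0 + c.2 l 1 * b + c.2 l 2 * g) * max 0 (splitLine l b g) ^ 4

theorem ridgeSpline_add (c c' : (QuinticIndex → ℝ) × (Fin 6 → Fin 3 → ℝ)) (b g : ℝ) :
    ridgeSpline (c + c') b g = ridgeSpline c b g + ridgeSpline c' b g := by
  simp only [ridgeSpline, quintic, Prod.fst_add, Prod.snd_add, Pi.add_apply, add_mul,
    Finset.sum_add_distrib]
  ring

theorem ridgeSpline_smul (r : ℝ) (c : (QuinticIndex → ℝ) × (Fin 6 → Fin 3 → ℝ)) (b g : ℝ) :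
    ridgeSpline (r • c) b g = r * ridgeSpline c b g := by
  simp only [ridgeSpline, quintic, Prod.smul_fst, Prod.smul_snd, Pi.smul_apply, smul_eq_mul,
    mul_add, add_mul, Finset.mul_sum, Finset.sum_mul, mul_assoc]

theorem affine_coeff_eq_zero {q : Fin 3 → ℝ} {b g : ℝ} {ε : ℝ} (hε : ε ≠ 0)
    (h0 : q 0 + q 1 * b + q 2 * g = 0) (h1 : q 0 + q 1 * (b + ε) + q 2 * g = 0)
    (h2 : q 0 + q 1 * b + q 2 * (g + ε) = 0) : q = 0 := by
  have e1 : q 1 = 0 := by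
    have : q 1 * ε = 0 := by linarith
    exact (mul_eq_zero.1 this).resolve_right hε
  have e2 : q 2 = 0 := by
    have : q 2 * ε = 0 := by linarith
    exact (mul_eq_zero.1 this).resolve_right hε
  have e0 : q 0 = 0 := by rw [e1, e2] at h0; linarith
  funext i
  fin_cases i <;> assumption

/-- The ridge splines are linearly independent on the triangle: walking from one subtriangle to
the next, one crosses the six lines one after the other. -/
theorem ridgeSpline_injective {c : (QuinticIndex → ℝ) × (Fin 6 → Fin 3 → ℝ)}
    (h : ∀ b g : ℝ, 0 ≤ b → 0 ≤ g → b + g ≤ 1 → ridgeSpline c b g = 0) : c = 0 := by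
  obtain ⟨c, q⟩ := c
  -- On a rectangle inside `cornerCell t x y` all truncated powers vanish.
  have hc : c = 0 := by
    refine quintic_coeff_eq_zero (l := 1 / 5) (r := 1 / 4) (l' := 1 / 20) (r' := 1 / 10)
      (by norm_num) (by norm_num) fun b hb g hg => ?_
    have := h b g (by linarith [hb.1]) (by linarith [hg.1]) (by linarith [hb.2, hg.2])
    have hl : ∀ l, splitLine l b g ≤ 0 := by
      intro l
      fin_cases l <;> simp [splitLine] <;> linarith [hb.1, hb.2, hg.1, hg.2]
    simpa [ridgeSpline, max_eq_left (hl _)] using this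
  have key : ∀ b g : ℝ, 0 ≤ b → 0 ≤ g → b + g ≤ 1 →
      ∑ l, (q l 0 + q l 1 * b + q l 2 * g) * max 0 (splitLine l b g) ^ 4 = 0 := by
    intro b g hb hg hs
    have := h b g hb hg hs
    simpa [ridgeSpline, quintic, hc] using this
  clear h
  -- If `ℓ_l` is positive on a small square, and each of the other lines is nonpositive there or has
  -- zero coefficient, then `q_l` vanishes on the square.
  have step : ∀ (l : Fin 6) (b g : ℝ), 0 ≤ b → 0 ≤ g → b + g + 1 / 100 ≤ 1 →
      (∀ b' g', b' ∈ Icc b (b + 1 / 100) → g' ∈ Icc g (g + 1 / 100) →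
        0 < splitLine l b' g' ∧ ∀ k ≠ l, q k = 0 ∨ splitLine k b' g' ≤ 0) → q l = 0 := by
    intro l b g hb hg hs hk
    have e : ∀ b' g', b' ∈ Icc b (b + 1 / 100) → g' ∈ Icc g (g + 1 / 100) → b' + g' ≤ 1 →
        q l 0 + q l 1 * b' + q l 2 * g' = 0 := by
      intro b' g' hb' hg' hs'
      obtain ⟨h1, h2⟩ := hk b' g' hb' hg'
      have := key b' g' (hb.trans hb'.1) (hg.trans hg'.1) hs'
      rw [Finset.sum_eq_single l (fun k _ hkl => by
        rcases h2 k hkl with h3 | h3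
        · simp [h3]
        · simp [max_eq_left h3]) (by simp)] at this
      refine (mul_eq_zero.1 this).resolve_right ?_
      rw [max_eq_right h1.le]
      positivity
    refine affine_coeff_eq_zero (b := b) (g := g) (ε := 1 / 100) (by norm_num)
      (e _ _ ?_ ?_ ?_) (e _ _ ?_ ?_ ?_) (e _ _ ?_ ?_ ?_) <;>
      first | constructor <;> linarith | linarith
  have q0 : q 0 = 0 := by
    refine step 0 (35 / 100) (22 / 100) (by norm_num) (by norm_num) (by norm_num) ?_
    rintro b g ⟨h1, h2⟩ ⟨h3, h4⟩
    refine ⟨by simp [splitLine]; linarith, fun k hk => ?_⟩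
    fin_cases k <;> simp [splitLine] at hk ⊢ <;> right <;> linarith
  have q3 : q 3 = 0 := by
    refine step 3 (5 / 100) (20 / 100) (by norm_num) (by norm_num) (by norm_num) ?_
    rintro b g ⟨h1, h2⟩ ⟨h3, h4⟩
    refine ⟨by simp [splitLine]; linarith, fun k hk => ?_⟩
    fin_cases k <;> simp [splitLine, q0] at hk ⊢ <;> right <;> linarith
  have q4 : q 4 = 0 := by
    refine step 4 (45 / 100) (20 / 100) (by norm_num) (by norm_num) (by norm_num) ?_
    rintro b g ⟨h1, h2⟩ ⟨h3, h4⟩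
    refine ⟨by simp [splitLine]; linarith, fun k hk => ?_⟩
    fin_cases k <;> simp [splitLine, q0, q3] at hk ⊢ <;> right <;> linarith
  have q5 : q 5 = 0 := by
    refine step 5 (20 / 100) (45 / 100) (by norm_num) (by norm_num) (by norm_num) ?_
    rintro b g ⟨h1, h2⟩ ⟨h3, h4⟩
    refine ⟨by simp [splitLine]; linarith, fun k hk => ?_⟩
    fin_cases k <;> simp [splitLine, q0, q3, q4] at hk ⊢ <;> right <;> linarith
  have q1 : q 1 = 0 := by
    refine step 1 (60 / 100) (10 / 100) (by norm_num) (by norm_num) (by norm_num) ?_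
    rintro b g ⟨h1, h2⟩ ⟨h3, h4⟩
    refine ⟨by simp [splitLine]; linarith, fun k hk => ?_⟩
    fin_cases k <;> simp [splitLine, q0, q3, q4, q5] at hk ⊢
    right
    linarith
  have q2 : q 2 = 0 := by
    refine step 2 (10 / 100) (60 / 100) (by norm_num) (by norm_num) (by norm_num) ?_
    rintro b g ⟨h1, h2⟩ ⟨h3, h4⟩
    refine ⟨by simp [splitLine]; linarith, fun k hk => ?_⟩
    fin_cases k <;> simp [splitLine, q0, q1, q3, q4, q5] at hk ⊢
  refine Prod.ext hc (funext fun l => ?_)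
  fin_cases l <;> assumption

/-- The barycentric coordinate at `y` of the triangle with corners `x, y, z`. -/
def bary (x y z p : Plane) : ℝ := cross (p - x) (z - x) / cross (y - x) (z - x)

theorem isPoly_bary (x y z : Plane) : IsPoly 1 (bary x y z) := by
  have h : bary x y z = fun p : Plane =>
      (z 1 - x 1) / cross (y - x) (z - x) * p 0
        - (z 0 - x 0) / cross (y - x) (z - x) * p 1
        - ((z 1 - x 1) / cross (y - x) (z - x) * x 0
          - (z 0 - x 0) / cross (y - x) (z - x) * x 1) := by
    funext p
    rw [bary, cross]
    simp only [PiLp.sub_apply]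
    ring
  rw [h]
  exact (((isPoly_coord 0).const_mul _).sub ((isPoly_coord 1).const_mul _)).sub (isPoly_const 1 _)

namespace IsTri

variable {t : Finset Plane} {x y z : Plane}

theorem bary_apply (h : IsTri t x y z) {a b c : ℝ} (hs : a + b + c = 1) :
    bary x y z (a • x + b • y + c • z) = b := by
  rw [bary, div_eq_iff h.cross_ne]
  obtain rfl : a = 1 - b - c := by linarith
  simp only [cross, PiLp.sub_apply, PiLp.add_apply, PiLp.smul_apply, smul_eq_mul]
  ring

theorem bary_apply' (h : IsTri t x y z) {a b c : ℝ} (hs : a + b + c = 1) :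
    bary x z y (a • x + b • y + c • z) = c := by
  rw [add_right_comm, h.swap'.bary_apply (by linarith)]

theorem exists_of_mem_cornerCell (h : IsTri t x y z) {p : Plane} (hp : p ∈ cornerCell t x y) :
    ∃ a b c : ℝ, a + b + c = 1 ∧ 1 / 2 ≤ a ∧ c ≤ b ∧ 0 ≤ c ∧ p = a • x + b • y + c • z := by
  rw [cornerCell, convexHull_insert (by simp), convexHull_pair, convexJoin_singleton_left] at hp
  simp only [mem_iUnion] at hp
  obtain ⟨r, hr, hp⟩ := hp
  obtain ⟨u, v, hu, hv, huv, rfl⟩ := hr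
  obtain ⟨u', v', hu', hv', huv', rfl⟩ := hp
  have h1 : 0 ≤ v' * u := by positivity
  have h2 : 0 ≤ v' * v := by positivity
  have h3 : v' * u + v' * v = v' := by rw [← mul_add, huv, mul_one]
  refine ⟨u' + v' * u / 2 + v' * v / 2, v' * u / 2 + v' * v / 4, v' * v / 4, ?_, ?_, ?_, ?_, ?_⟩
  · linarith
  · linarith
  · linarith
  · linarith
  · rw [h.innerPoint_eq, midpoint_eq_smul_add_smul]
    module

theorem exists_of_mem_centerCell (h : IsTri t x y z) {p : Plane} (hp : p ∈ centerCell t x y) :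
    ∃ a b c : ℝ, a + b + c = 1 ∧ a ≤ 1 / 2 ∧ b ≤ a ∧ c ≤ b ∧ p = a • x + b • y + c • z := by
  rw [centerCell, convexHull_insert (by simp), convexHull_pair, convexJoin_singleton_left] at hp
  simp only [mem_iUnion] at hp
  obtain ⟨r, hr, hp⟩ := hp
  obtain ⟨u, v, hu, hv, huv, rfl⟩ := hr
  obtain ⟨u', v', hu', hv', huv', rfl⟩ := hp
  have h1 : 0 ≤ v' * u := by positivity
  have h2 : 0 ≤ v' * v := by positivity
  have h3 : v' * u + v' * v = v' := by rw [← mul_add, huv, mul_one]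
  refine ⟨u' / 3 + v' * u / 2 + v' * v / 2, u' / 3 + v' * u / 2 + v' * v / 4,
    u' / 3 + v' * v / 4, ?_, ?_, ?_, ?_, ?_⟩
  · linarith
  · linarith
  · linarith
  · linarith
  · rw [h.innerPoint_eq, h.barycenter_eq, midpoint_eq_smul_add_smul]
    module

/-- None of the six lines crosses a subtriangle. -/
theorem splitLine_sign (h : IsTri t x y z) {K : Set Plane} (hK : K ∈ splitCells t) (l : Fin 6) :
    (∀ p ∈ K, splitLine l (bary x y z p) (bary x z y p) ≤ 0) ∨
      ∀ p ∈ K, 0 ≤ splitLine l (bary x y z p) (bary x z y p) := by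
  have aux : ∀ {u v w : Plane}, IsTri t u v w → (K = cornerCell t u v ∨ K = centerCell t u v) →
      ∀ φ : ℝ → ℝ → ℝ → ℝ, (∀ a b c : ℝ, a + b + c = 1 →
        splitLine l (bary x y z (a • u + b • v + c • w)) (bary x z y (a • u + b • v + c • w))
          = φ a b c) →
      ((∀ a b c : ℝ, a + b + c = 1 → 1 / 2 ≤ a → c ≤ b → 0 ≤ c → φ a b c ≤ 0) ∨
        ∀ a b c : ℝ, a + b + c = 1 → 1 / 2 ≤ a → c ≤ b → 0 ≤ c → 0 ≤ φ a b c) →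
      ((∀ a b c : ℝ, a + b + c = 1 → a ≤ 1 / 2 → b ≤ a → c ≤ b → φ a b c ≤ 0) ∨
        ∀ a b c : ℝ, a + b + c = 1 → a ≤ 1 / 2 → b ≤ a → c ≤ b → 0 ≤ φ a b c) →
      (∀ p ∈ K, splitLine l (bary x y z p) (bary x z y p) ≤ 0) ∨
        ∀ p ∈ K, 0 ≤ splitLine l (bary x y z p) (bary x z y p) := by
    rintro u v w huvw (rfl | rfl) φ hφ h1 h2
    · refine h1.imp (fun h1 p hp => ?_) (fun h1 p hp => ?_) <;>
      · obtain ⟨a, b, c, hs, e1, e2, e3, rfl⟩ := huvw.exists_of_mem_cornerCell hp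
        rw [hφ a b c hs]
        exact h1 a b c hs e1 e2 e3
    · refine h2.imp (fun h2 p hp => ?_) (fun h2 p hp => ?_) <;>
      · obtain ⟨a, b, c, hs, e1, e2, e3, rfl⟩ := huvw.exists_of_mem_centerCell hp
        rw [hφ a b c hs]
        exact h2 a b c hs e1 e2 e3
  obtain ⟨u, hu, v, hv, huv, hK⟩ := hK
  have hK' : K = cornerCell t u v ∨ K = centerCell t u v := hK
  rw [h.eq_insert] at hu hv
  simp only [Finset.mem_insert, Finset.mem_singleton] at hu hv
  have b1 := fun a b c hs => h.bary_apply (a := a) (b := b) (c := c) hs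
  have b2 := fun a b c hs => h.bary_apply' (a := a) (b := b) (c := c) hs
  rcases hu with rfl | rfl | rfl <;> rcases hv with rfl | rfl | rfl
  · exact (huv rfl).elim
  · refine aux h hK' (fun a b c => splitLine l b c) (fun a b c hs => ?_) ?_ ?_
    · rw [b1 a b c hs, b2 a b c hs]
    all_goals rcases splitLine_eq l with e | e | e | e | e | e <;> simp only [e] <;>
      first | (left; intros; linarith) | (right; intros; linarith)
  · refine aux h.swap' hK' (fun a b c => splitLine l c b) (fun a b c hs => ?_) ?_ ?_
    · rw [add_right_comm, b1 a c b (by linarith), b2 a c b (by linarith)]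
    all_goals rcases splitLine_eq l with e | e | e | e | e | e <;> simp only [e] <;>
      first | (left; intros; linarith) | (right; intros; linarith)
  · refine aux h.swap hK' (fun a b c => splitLine l a c) (fun a b c hs => ?_) ?_ ?_
    · rw [add_comm (a • _), b1 b a c (by linarith), b2 b a c (by linarith)]
    all_goals rcases splitLine_eq l with e | e | e | e | e | e <;> simp only [e] <;>
      first | (left; intros; linarith) | (right; intros; linarith)
  · exact (huv rfl).elim
  · refine aux h.rot hK' (fun a b c => splitLine l a b) (fun a b c hs => ?_) ?_ ?_
    · rw [add_comm _ (c • _), ← add_assoc, b1 c a b (by linarith), b2 c a b (by linarith)]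
    all_goals rcases splitLine_eq l with e | e | e | e | e | e <;> simp only [e] <;>
      first | (left; intros; linarith) | (right; intros; linarith)
  · refine aux h.rot.rot hK' (fun a b c => splitLine l c a) (fun a b c hs => ?_) ?_ ?_
    · rw [add_assoc, add_comm (a • _), b1 b c a (by linarith), b2 b c a (by linarith)]
    all_goals rcases splitLine_eq l with e | e | e | e | e | e <;> simp only [e] <;>
      first | (left; intros; linarith) | (right; intros; linarith)
  · refine aux h.rot.swap hK' (fun a b c => splitLine l b a) (fun a b c hs => ?_) ?_ ?_
    · rw [add_comm _ (c • _), add_comm (a • _), ← add_assoc, b1 c b a (by linarith),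
        b2 c b a (by linarith)]
    all_goals rcases splitLine_eq l with e | e | e | e | e | e <;> simp only [e] <;>
      first | (left; intros; linarith) | (right; intros; linarith)
  · exact (huv rfl).elim

end IsTri

/-- The ridge spline with given coefficients on the triangle with corners `x, y, z`, extended to the
whole plane. -/
def planeSpline (x y z : Plane)
    (c : (QuinticIndex → ℝ) × (Fin 6 → Fin 3 → ℝ)) : Plane → ℝ :=
  fun p => ridgeSpline c (bary x y z p) (bary x z y p)

theorem contDiff_planeSpline (x y z : Plane) (c : (QuinticIndex → ℝ) × (Fin 6 → Fin 3 → ℝ)) :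
    ContDiff ℝ 3 (planeSpline x y z c) := by
  have hb : ContDiff ℝ 3 (bary x y z) := (isPoly_bary x y z).contDiff
  have hg : ContDiff ℝ 3 (bary x z y) := (isPoly_bary x z y).contDiff
  have hl : ∀ l, ContDiff ℝ 3 fun p => splitLine l (bary x y z p) (bary x z y p) := by
    intro l
    fin_cases l <;> simp [splitLine] <;> fun_prop
  have hm : ContDiff ℝ 3 (fun s : ℝ => max 0 s ^ 4) := contDiff_max_zero_pow 3
  have hml : ∀ l, ContDiff ℝ 3 fun p => max 0 (splitLine l (bary x y z p) (bary x z y p)) ^ 4 :=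
    fun l => hm.comp (hl l)
  unfold planeSpline ridgeSpline quintic
  fun_prop

theorem isPoly_splitLine (x y z : Plane) (l : Fin 6) :
    IsPoly 1 fun p => splitLine l (bary x y z p) (bary x z y p) := by
  have hb := isPoly_bary x y z
  have hg := isPoly_bary x z y
  fin_cases l
  · exact (hb.add hg).sub (isPoly_const 1 _)
  · exact hb.sub (isPoly_const 1 _)
  · exact hg.sub (isPoly_const 1 _)
  · exact hg.sub hb
  · exact ((hb.const_mul 2).add hg).sub (isPoly_const 1 _)
  · exact (hb.add (hg.const_mul 2)).sub (isPoly_const 1 _)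

theorem isPoly_quintic (x y z : Plane) (c : QuinticIndex → ℝ) :
    IsPoly 5 fun p => quintic c (bary x y z p) (bary x z y p) := by
  refine IsPoly.sum Finset.univ fun i _ => ?_
  have h1 : IsPoly (5 - i) fun p => ∑ j : Fin (6 - i.1), c ⟨i, j⟩ * bary x z y p ^ (j : ℕ) :=
    IsPoly.sum Finset.univ fun j _ => (((isPoly_bary x z y).pow j).const_mul _).mono (by omega)
  exact (h1.mul ((isPoly_bary x y z).pow i)).mono (by omega)

/-- On every subtriangle the ridge spline is a quintic. -/
theorem IsTri.planeSpline_poly {t : Finset Plane} {x y z : Plane} (h : IsTri t x y z)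
    (c : (QuinticIndex → ℝ) × (Fin 6 → Fin 3 → ℝ)) {K : Set Plane} (hK : K ∈ splitCells t) :
    ∃ F, IsPoly 5 F ∧ EqOn (planeSpline x y z c) F K := by
  have hl : ∀ l, ∃ F, IsPoly 5 F ∧ ∀ p ∈ K,
      (c.2 l 0 + c.2 l 1 * bary x y z p + c.2 l 2 * bary x z y p)
        * max 0 (splitLine l (bary x y z p) (bary x z y p)) ^ 4 = F p := by
    intro l
    rcases h.splitLine_sign hK l with hs | hs
    · exact ⟨_, isPoly_const 5 0, fun p hp => by rw [max_eq_left (hs p hp)]; ring⟩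
    · refine ⟨fun p => (c.2 l 0 + c.2 l 1 * bary x y z p + c.2 l 2 * bary x z y p)
        * splitLine l (bary x y z p) (bary x z y p) ^ 4, ?_,
        fun p hp => by rw [max_eq_right (hs p hp)]⟩
      exact (((isPoly_const 1 _).add ((isPoly_bary x y z).const_mul _)).add
        ((isPoly_bary x z y).const_mul _)).mul ((isPoly_splitLine x y z l).pow 4)
  choose F hF hFe using hl
  refine ⟨fun p => quintic c.1 (bary x y z p) (bary x z y p) + ∑ l, F l p,
    (isPoly_quintic x y z c.1).add (IsPoly.sum Finset.univ fun l _ => hF l), fun p hp => ?_⟩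
  simp only [planeSpline, ridgeSpline]
  congr 1
  exact Finset.sum_congr rfl fun l _ => hFe l p hp

theorem finrank_coefficients :
    Module.finrank ℝ ((QuinticIndex → ℝ) × (Fin 6 → Fin 3 → ℝ)) = 39 := by
  rw [Module.finrank_prod, Module.finrank_pi]
  simp [Fintype.card_sigma, Fin.sum_univ_succ, Module.finrank_pi_fintype]

/-- **Local interpolation.** On every triangle there is a `C³` quintic spline on the 12-split with
prescribed degrees of freedom, the restriction of a `C³` function on the plane. The ridge splines
form a space of dimension `39`, the number of degrees of freedom, and evaluation of the latter is
injective by `eq_zero_of_dofEval_eq_zero`. -/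
theorem exists_local_interpolant {Δ : Triangulation} (d : CrossDirections Δ) {t : Finset Plane}
    (ht : t ∈ Δ.triangles) (y : Dof Δ → ℝ) :
    ∃ g : Plane → ℝ, ContDiff ℝ 3 g ∧ (∀ K ∈ splitCells t, ∃ F, IsPoly 5 F ∧ EqOn g F K) ∧
      ∀ i : Dof Δ, dofPoint i ∈ convexHull ℝ (t : Set Plane) → dofEval d univ i g = y i := by
  obtain ⟨a, b, c, h⟩ := Δ.exists_isTri ht
  have cd := fun v => (contDiff_planeSpline a b c v).contDiffOn (s := univ)
  let I : Set (Dof Δ) := {i | dofPoint i ∈ convexHull ℝ (t : Set Plane)}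
  let Φ : ((QuinticIndex → ℝ) × (Fin 6 → Fin 3 → ℝ)) →ₗ[ℝ] (I → ℝ) :=
    { toFun := fun v i => dofEval d univ i (planeSpline a b c v)
      map_add' := fun v w => by
        funext i
        have e : planeSpline a b c (v + w) = planeSpline a b c v + planeSpline a b c w :=
          funext fun p => ridgeSpline_add v w _ _
        rw [e]
        exact dofEval_add d uniqueDiffOn_univ i (mem_univ _) (cd v) (cd w)
      map_smul' := fun r v => by
        funext i
        have e : planeSpline a b c (r • v) = r • planeSpline a b c v :=
          funext fun p => ridgeSpline_smul r v _ _
        rw [e]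
        exact dofEval_smul d uniqueDiffOn_univ r i (mem_univ _) (cd v) }
  have hinj : Function.Injective Φ := by
    rw [injective_iff_map_eq_zero]
    intro v hv
    refine ridgeSpline_injective fun β γ hβ hγ hs => ?_
    have hT := h.uniqueDiffOn
    have := eq_zero_of_dofEval_eq_zero d ht (f := planeSpline a b c v)
      (contDiff_planeSpline a b c v).contDiffOn (fun K hK => h.planeSpline_poly v hK)
      (fun i hi => by
        rw [← show Φ v ⟨i, hi⟩ = 0 by rw [hv]; rfl]
        refine dofEval_congr d i ?_
        rw [iteratedFDerivWithin_univ, iteratedFDerivWithin_eq_iteratedFDeriv hT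
          ((contDiff_planeSpline a b c v).of_le (by exact_mod_cast dofOrder_le i)).contDiffAt hi])
      _ (h.mem_convexHull (a := 1 - β - γ) (b := β) (c := γ) (by linarith) hβ hγ (by ring))
    simp only [planeSpline] at this
    rwa [h.bary_apply (by ring), h.bary_apply' (by ring)] at this
  have hcard : Nat.card I = 39 := by
    rw [Nat.card_coe_set_eq]; exact ncard_dof ht
  have := Fintype.ofFinite I
  have hfin : Module.finrank ℝ ((QuinticIndex → ℝ) × (Fin 6 → Fin 3 → ℝ))
      = Module.finrank ℝ (I → ℝ) := by
    rw [finrank_coefficients, Module.finrank_pi, ← Nat.card_eq_fintype_card, hcard]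
  obtain ⟨v, hv⟩ := (LinearMap.injective_iff_surjective_of_finrank_eq_finrank hfin).1 hinj
    fun i => y i
  exact ⟨planeSpline a b c v, contDiff_planeSpline a b c v, fun K hK => h.planeSpline_poly v hK,
    fun i hi => congrFun hv ⟨i, hi⟩⟩

/-! ### Gluing -/

theorem JetEq.sub {h h' F F' : Plane → ℝ} {x : Plane} (hh : ContDiff ℝ 3 h)
    (hh' : ContDiff ℝ 3 h') (hF : ContDiff ℝ 3 F) (hF' : ContDiff ℝ 3 F')
    (j : JetEq h univ F x) (j' : JetEq h' univ F' x) :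
    JetEq (fun p => h p - h' p) univ (fun p => F p - F' p) x := by
  intro k hk
  have hk' : ((k : ℕ) : ℕ∞ω) ≤ 3 := by exact_mod_cast hk
  have e1 := iteratedFDeriv_sub_apply (𝕜 := ℝ) (i := k) (f := h) (g := h') (x := x)
    (hh.of_le hk').contDiffAt (hh'.of_le hk').contDiffAt
  have e2 := iteratedFDeriv_sub_apply (𝕜 := ℝ) (i := k) (f := F) (g := F') (x := x)
    (hF.of_le hk').contDiffAt (hF'.of_le hk').contDiffAt
  have j1 := j k hk
  have j2 := j' k hk
  rw [iteratedFDerivWithin_univ] at j1 j2 ⊢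
  rw [j1, j2, ← e2] at e1
  exact e1

theorem dofEval_sub {Δ : Triangulation} (d : CrossDirections Δ) {f g : Plane → ℝ} (i : Dof Δ)
    (hf : ContDiff ℝ 3 f) (hg : ContDiff ℝ 3 g) :
    dofEval d univ i (fun p => f p - g p) = dofEval d univ i f - dofEval d univ i g := by
  have h1 := dofEval_add d uniqueDiffOn_univ i (mem_univ _) (hf.sub hg).contDiffOn hg.contDiffOn
  rw [show (fun p => f p - g p) + g = f from funext fun p => by simp] at h1
  linarith

theorem IsTri.exists_corner_piece {t : Finset Plane} {x y z : Plane} (h : IsTri t x y z)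
    {g : Plane → ℝ} (hg : ContDiff ℝ 3 g)
    (hpoly : ∀ K ∈ splitCells t, ∃ F, IsPoly 5 F ∧ EqOn g F K) :
    ∃ F, IsPoly 5 F ∧ ∀ p ∈ cornerCell t x y, JetEq g univ F p := by
  obtain ⟨F, hF, he⟩ := hpoly _ h.cornerCell_mem
  exact ⟨F, hF, fun p hp => jetEq_of_eqOn (subset_univ _) h.uniqueDiffOn_cornerCell
    uniqueDiffOn_univ hg.contDiffOn hF.contDiff he hp⟩

theorem IsTri.eq_add_bary {t : Finset Plane} {x y z : Plane} (h : IsTri t x y z) (p : Plane) :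
    p = x + bary x y z p • (y - x) + bary x z y p • (z - x) := by
  have h1 := exists_eq_smul_add_smul h.cross_ne (p - x)
  have h2 : bary x z y p = cross (y - x) (p - x) / cross (y - x) (z - x) := by
    rw [bary, div_eq_div_iff h.swap'.cross_ne h.cross_ne]
    simp only [cross, PiLp.sub_apply]
    ring
  rw [h2, bary, add_assoc, ← h1]
  abel

/-- A function divisible by the third power of the equation of a line has vanishing derivatives
up to order two along that line. -/
theorem IsTri.iteratedFDeriv_eq_zero_of_cubic {t : Finset Plane} {x y z : Plane}
    (h : IsTri t x y z) {F : Plane → ℝ} {q : Fin 6 → ℝ}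
    (hF : ∀ τ s : ℝ, F (x + τ • (y - x) + s • (z - x))
      = s ^ 3 * (q 0 + q 1 * τ + q 2 * s + q 3 * τ ^ 2 + q 4 * τ * s + q 5 * s ^ 2)) (τ : ℝ) :
    ∀ j ≤ 2, iteratedFDeriv ℝ j F (x + τ • (y - x)) = 0 := by
  have hb : ContDiff ℝ ω (bary x y z) := (isPoly_bary x y z).contDiff
  have hg : ContDiff ℝ ω (bary x z y) := (isPoly_bary x z y).contDiff
  let Q : Plane → ℝ := fun p => q 0 + q 1 * bary x y z p + q 2 * bary x z y p
    + q 3 * bary x y z p ^ 2 + q 4 * bary x y z p * bary x z y p + q 5 * bary x z y p ^ 2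
  have hQ : ContDiff ℝ ω Q := by fun_prop
  have e : F = fun p => bary x z y p * (bary x z y p * (bary x z y p * Q p)) := by
    funext p
    conv_lhs => rw [h.eq_add_bary p]
    rw [hF]
    ring
  have h0 : bary x z y (x + τ • (y - x)) = 0 := by
    have := h.bary_apply' (a := 1 - τ) (b := τ) (c := 0) (by ring)
    rw [← this]
    congr 1
    module
  rw [e]
  have h1 := iteratedFDeriv_mul_eq_zero (k := 0) hg hQ h0 (fun j hj => by omega)
  have h2 := iteratedFDeriv_mul_eq_zero (k := 1) hg (hg.mul hQ) h0 (fun j hj => h1 j (by omega))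
  exact iteratedFDeriv_mul_eq_zero (k := 2) hg (hg.mul (hg.mul hQ)) h0
    (fun j hj => h2 j (by omega))

/-- A local interpolant of the data `y` on the triangle `t`. -/
structure IsInterpolant {Δ : Triangulation} (d : CrossDirections Δ) (y : Dof Δ → ℝ)
    (t : Finset Plane) (g : Plane → ℝ) : Prop where
  contDiff : ContDiff ℝ 3 g
  poly : ∀ K ∈ splitCells t, ∃ F, IsPoly 5 F ∧ EqOn g F K
  data : ∀ i : Dof Δ, dofPoint i ∈ convexHull ℝ (t : Set Plane) → dofEval d univ i g = y i

section

variable {Δ : Triangulation} {d : CrossDirections Δ} {y : Dof Δ → ℝ} {t t' : Finset Plane}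
  {g g' : Plane → ℝ}

theorem Triangulation.exists_isTri_vertex (ht : t ∈ Δ.triangles) {v : Plane} (hv : v ∈ t) :
    ∃ a b, IsTri t v a b := by
  obtain ⟨a, ha, hav⟩ := Finset.exists_mem_ne (by rw [Δ.card_eq t ht]; norm_num) v
  obtain ⟨b, hb⟩ := PowellSabin.exists_isTri (Δ.card_eq t ht) (Δ.indep t ht) hv ha hav.symm
  exact ⟨a, b, hb⟩

theorem iteratedFDeriv_eq_of_sub_eq_zero {k : ℕ} (hk : k ≤ 3) (hg : ContDiff ℝ 3 g)
    (hg' : ContDiff ℝ 3 g') {p : Plane} (h : iteratedFDeriv ℝ k (fun p => g p - g' p) p = 0) :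
    iteratedFDeriv ℝ k g p = iteratedFDeriv ℝ k g' p := by
  have hk' : ((k : ℕ) : ℕ∞ω) ≤ 3 := by exact_mod_cast hk
  have e := iteratedFDeriv_sub_apply (𝕜 := ℝ) (i := k) (f := g) (g := g') (x := p)
    (hg.of_le hk').contDiffAt (hg'.of_le hk').contDiffAt
  rw [← sub_eq_zero, ← e]
  exact h

/-- Two local interpolants agree to third order at a common vertex. -/
theorem IsInterpolant.eq_at_vertex (ht : t ∈ Δ.triangles) (ht' : t' ∈ Δ.triangles)
    (h : IsInterpolant d y t g) (h' : IsInterpolant d y t' g') {v : Plane} (hv : v ∈ t)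
    (hv' : v ∈ t') : ∀ k ≤ 3, iteratedFDeriv ℝ k g v = iteratedFDeriv ℝ k g' v := by
  intro k hk
  obtain ⟨a, b, hab⟩ := Triangulation.exists_isTri_vertex ht hv
  obtain ⟨a', b', hab'⟩ := Triangulation.exists_isTri_vertex ht' hv'
  obtain ⟨F, hF, jF⟩ := hab.exists_corner_piece h.contDiff h.poly
  obtain ⟨F', hF', jF'⟩ := hab'.exists_corner_piece h'.contDiff h'.poly
  have j := JetEq.sub h.contDiff h'.contDiff hF.contDiff hF'.contDiff
    (jF v hab.corner_mem_cornerCell) (jF' v hab'.corner_mem_cornerCell)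
  refine iteratedFDeriv_eq_of_sub_eq_zero hk h.contDiff h'.contDiff ?_
  rw [← iteratedFDerivWithin_univ, j k hk]
  refine iteratedFDeriv_eq_zero_of_coordDirections (hF.sub hF').contDiff hk fun i hi => ?_
  rw [← j k hk]
  let D : Dof Δ := .vertex ⟨v, t, ht, hv⟩ ⟨k, by omega⟩ ⟨i, by simpa using Nat.lt_succ_of_le hi⟩
  have e := dofEval_sub d D h.contDiff h'.contDiff
  rw [h.data D (subset_convexHull ℝ _ hv), h'.data D (subset_convexHull ℝ _ hv'), sub_self] at e
  exact e

/-- Two local interpolants agree to second order along a common edge. -/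
theorem IsInterpolant.eq_on_edge (ht : t ∈ Δ.triangles) (ht' : t' ∈ Δ.triangles)
    (h : IsInterpolant d y t g) (h' : IsInterpolant d y t' g') {a b : Plane} (hab : a ≠ b)
    (ha : a ∈ t) (hb : b ∈ t) (ha' : a ∈ t') (hb' : b ∈ t') {τ : ℝ} (hτ : τ ∈ Icc (0 : ℝ) 1) :
    ∀ k ≤ 2, iteratedFDeriv ℝ k g (a + τ • (b - a)) = iteratedFDeriv ℝ k g' (a + τ • (b - a)) := by
  obtain ⟨c, hT⟩ := PowellSabin.exists_isTri (Δ.card_eq t ht) (Δ.indep t ht) ha hb hab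
  obtain ⟨c', hT'⟩ := PowellSabin.exists_isTri (Δ.card_eq t' ht') (Δ.indep t' ht') ha' hb' hab
  obtain ⟨F, hF, jF⟩ := hT.exists_corner_piece h.contDiff h.poly
  obtain ⟨F', hF', jF'⟩ := hT'.exists_corner_piece h'.contDiff h'.poly
  obtain ⟨G, hG, jG⟩ := hT.swap.exists_corner_piece h.contDiff h.poly
  obtain ⟨G', hG', jG'⟩ := hT'.swap.exists_corner_piece h'.contDiff h'.poly
  have jl : ∀ τ ∈ Icc (0 : ℝ) (1 / 2), JetEq (fun p => g p - g' p) univ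
      (fun p => F p - F' p) (a + τ • (b - a)) := fun τ hτ =>
    JetEq.sub h.contDiff h'.contDiff hF.contDiff hF'.contDiff
      (jF _ (hT.edge_mem_cornerCell hτ)) (jF' _ (hT'.edge_mem_cornerCell hτ))
  have jr : ∀ τ ∈ Icc (1 / 2 : ℝ) 1, JetEq (fun p => g p - g' p) univ
      (fun p => G p - G' p) (a + τ • (b - a)) := fun τ hτ =>
    JetEq.sub h.contDiff h'.contDiff hG.contDiff hG'.contDiff
      (jG _ (hT.edge_mem_cornerCell' hτ)) (jG' _ (hT'.edge_mem_cornerCell' hτ))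
  have hsub : ∀ {s : Finset Plane}, a ∈ s → b ∈ s →
      convexHull ℝ (({a, b} : Finset Plane) : Set Plane) ⊆ convexHull ℝ (s : Set Plane) := by
    intro s has hbs
    refine convexHull_mono fun p hp => ?_
    simp only [Finset.coe_insert, Finset.coe_singleton, mem_insert_iff, mem_singleton_iff] at hp
    rcases hp with rfl | rfl <;> assumption
  have hz : EdgeDataZero (fun p => g p - g' p) univ a b := by
    refine edgeDataZero_of_dofEval d (hT.edge_mem ht) hab (by simp) (hF.sub hF') (hG.sub hG')
      ?_ ?_ fun i hi => ?_
    · simpa using jl 0 (by norm_num)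
    · simpa using jr 1 (by norm_num)
    · rw [dofEval_sub d i h.contDiff h'.contDiff, h.data i (hsub ha hb hi),
        h'.data i (hsub ha' hb' hi), sub_self]
  obtain ⟨⟨q, -, hq⟩, q', hq'⟩ :=
    hz.exists_cubic_mul (hF.sub hF') (hG.sub hG') hT.cross_ne jl jr
  intro k hk
  refine iteratedFDeriv_eq_of_sub_eq_zero (by omega) h.contDiff h'.contDiff ?_
  rw [← iteratedFDerivWithin_univ]
  rcases le_total τ (1 / 2) with h1 | h1
  · rw [jl τ ⟨hτ.1, h1⟩ k (by omega)]
    exact hT.iteratedFDeriv_eq_zero_of_cubic hq τ k hk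
  · rw [jr τ ⟨h1, hτ.2⟩ k (by omega)]
    exact hT.iteratedFDeriv_eq_zero_of_cubic hq' τ k hk

/-- Two local interpolants agree to second order on the intersection of their triangles. -/
theorem IsInterpolant.eq_on_inter (ht : t ∈ Δ.triangles) (ht' : t' ∈ Δ.triangles)
    (h : IsInterpolant d y t g) (h' : IsInterpolant d y t' g') (hne : t ≠ t') {p : Plane}
    (hp : p ∈ convexHull ℝ (t : Set Plane)) (hp' : p ∈ convexHull ℝ (t' : Set Plane)) :
    ∀ k ≤ 2, iteratedFDeriv ℝ k g p = iteratedFDeriv ℝ k g' p := by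
  classical
  have h1 := Δ.inter t ht t' ht' ⟨hp, hp'⟩
  rw [← Finset.coe_inter] at h1
  have hcard : (t ∩ t').card < 3 := by
    rw [← Δ.card_eq t ht]
    refine Finset.card_lt_card (Finset.ssubset_iff_subset_ne.2 ⟨Finset.inter_subset_left, ?_⟩)
    intro he
    exact hne (Finset.eq_of_subset_of_card_le (Finset.inter_eq_left.1 he)
      (by rw [Δ.card_eq t ht, Δ.card_eq t' ht']))
  have hc : (t ∩ t').card = 0 ∨ (t ∩ t').card = 1 ∨ (t ∩ t').card = 2 := by omega
  rcases hc with hc | hc | hc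
  · rw [Finset.card_eq_zero] at hc
    simp [hc] at h1
  · obtain ⟨v, hv⟩ := Finset.card_eq_one.1 hc
    have hvm : v ∈ t ∩ t' := by simp [hv]
    rw [hv, Finset.coe_singleton, convexHull_singleton, mem_singleton_iff] at h1
    subst h1
    intro k hk
    exact h.eq_at_vertex ht ht' h' (Finset.mem_inter.1 hvm).1 (Finset.mem_inter.1 hvm).2 k
      (by omega)
  · obtain ⟨a, b, hab, hv⟩ := Finset.card_eq_two.1 hc
    have ha : a ∈ t ∩ t' := by simp [hv]
    have hb : b ∈ t ∩ t' := by simp [hv]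
    rw [hv, Finset.coe_pair, convexHull_pair, segment_eq_image'] at h1
    obtain ⟨τ, hτ, rfl⟩ := h1
    exact h.eq_on_edge ht ht' h' hab (Finset.mem_inter.1 ha).1 (Finset.mem_inter.1 hb).1
      (Finset.mem_inter.1 ha).2 (Finset.mem_inter.1 hb).2 hτ

end

theorem Triangulation.region_eq (Δ : Triangulation) :
    Δ.region = ⋃ t ∈ Δ.triangles, convexHull ℝ (t : Set Plane) := by
  ext p
  simp [Triangulation.region]

theorem isClosed_triangle (t : Finset Plane) : IsClosed (convexHull ℝ (t : Set Plane)) :=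
  (t.finite_toSet.isCompact_convexHull ℝ).isClosed

/-- Derivatives within the region can be checked on each of its triangles, because these are closed
and finite in number. -/
theorem Triangulation.hasFDerivWithinAt_region (Δ : Triangulation) {E : Type*}
    [NormedAddCommGroup E] [NormedSpace ℝ E] {f : Plane → E} {f' : Plane →L[ℝ] E} {x : Plane}
    (h : ∀ t ∈ Δ.triangles, x ∈ convexHull ℝ (t : Set Plane) →
      HasFDerivWithinAt f f' (convexHull ℝ (t : Set Plane)) x) :
    HasFDerivWithinAt f f' Δ.region x := by
  classical
  rw [Δ.region_eq]
  have key : ∀ T : Finset (Finset Plane), T ⊆ Δ.triangles →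
      HasFDerivWithinAt f f' (⋃ t ∈ T, convexHull ℝ (t : Set Plane)) x := by
    intro T
    induction T using Finset.induction_on with
    | empty => intro _; simp
    | insert a T ha ih =>
      intro hT
      rw [Finset.set_biUnion_insert]
      refine HasFDerivWithinAt.union ?_ (ih fun s hs => hT (by simp [hs]))
      by_cases hx : x ∈ convexHull ℝ (a : Set Plane)
      · exact h a (hT (by simp)) hx
      · exact .of_notMem_closure (by rwa [(isClosed_triangle a).closure_eq])
  exact key _ subset_rfl

theorem Triangulation.continuousWithinAt_region (Δ : Triangulation) {E : Type*}
    [TopologicalSpace E] {f : Plane → E} {x : Plane}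
    (h : ∀ t ∈ Δ.triangles, x ∈ convexHull ℝ (t : Set Plane) →
      ContinuousWithinAt f (convexHull ℝ (t : Set Plane)) x) :
    ContinuousWithinAt f Δ.region x := by
  classical
  rw [Δ.region_eq]
  have key : ∀ T : Finset (Finset Plane), T ⊆ Δ.triangles →
      ContinuousWithinAt f (⋃ t ∈ T, convexHull ℝ (t : Set Plane)) x := by
    intro T
    induction T using Finset.induction_on with
    | empty => intro _; simp [ContinuousWithinAt]
    | insert a T ha ih =>
      intro hT
      rw [Finset.set_biUnion_insert]
      refine ContinuousWithinAt.union ?_ (ih fun s hs => hT (by simp [hs]))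
      by_cases hx : x ∈ convexHull ℝ (a : Set Plane)
      · exact h a (hT (by simp)) hx
      · exact continuousWithinAt_of_notMem_closure
          (by rwa [(isClosed_triangle a).closure_eq])
  exact key _ subset_rfl

theorem Triangulation.subset_of_mem_splitCells (Δ : Triangulation) {t : Finset Plane}
    (ht : t ∈ Δ.triangles) {K : Set Plane} (hK : K ∈ splitCells t) :
    K ⊆ convexHull ℝ (t : Set Plane) := by
  obtain ⟨a, ha, b, hb, hab, hK⟩ := hK
  obtain ⟨c, hc⟩ := PowellSabin.exists_isTri (Δ.card_eq t ht) (Δ.indep t ht) ha hb hab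
  rcases hK with rfl | rfl
  · exact hc.cornerCell_subset
  · exact hc.centerCell_subset

theorem dofOrder_le_two_or_mem_vertices {Δ : Triangulation} (i : Dof Δ) :
    dofOrder i ≤ 2 ∨ dofPoint i ∈ Δ.vertices := by
  cases i with
  | vertex v k j => exact Or.inr v.2
  | mid e => exact Or.inl (by simp [dofOrder])
  | quarter e a => exact Or.inl (by simp [dofOrder])

theorem dofPoint_mem {Δ : Triangulation} (i : Dof Δ) : dofPoint i ∈ Δ.region := by
  cases i with
  | vertex v k j => exact Δ.vertex_mem_region v.2
  | mid e => exact edgeMidpoint_mem e.2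
  | quarter e a => exact edgeQuarterpoint_mem e.2 a.2

/-- **Interpolation.** There is a spline with prescribed degrees of freedom. It equals a local
interpolant on every triangle; as the jets of the local interpolants up to order two agree wherever
the triangles meet, they form a Taylor series of the glued function. -/
theorem exists_interpolant {Δ : Triangulation} (d : CrossDirections Δ) (y : Dof Δ → ℝ) :
    ∃ s ∈ splineSpace Δ, ∀ i, dofEval d Δ.region i s = y i := by
  classical
  have hloc : ∀ t : Finset Plane, ∃ g : Plane → ℝ, t ∈ Δ.triangles → IsInterpolant d y t g := by
    intro t
    by_cases ht : t ∈ Δ.triangles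
    · obtain ⟨g, h1, h2, h3⟩ := exists_local_interpolant d ht y
      exact ⟨g, fun _ => ⟨h1, h2, h3⟩⟩
    · exact ⟨0, fun h => (ht h).elim⟩
  choose g hg using hloc
  -- A triangle that contains a given point.
  have htri : ∀ p : Plane, ∃ t : Finset Plane, p ∈ Δ.region →
      t ∈ Δ.triangles ∧ p ∈ convexHull ℝ (t : Set Plane) := by
    intro p
    by_cases hp : p ∈ Δ.region
    · obtain ⟨t, ht, hpt⟩ := hp
      exact ⟨t, fun _ => ⟨ht, hpt⟩⟩
    · exact ⟨∅, fun h => (hp h).elim⟩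
  choose T hT using htri
  have hΩ := Δ.uniqueDiffOn_region
  have hreg : ∀ {t}, t ∈ Δ.triangles → ∀ {p}, p ∈ convexHull ℝ (t : Set Plane) → p ∈ Δ.region :=
    fun ht _ hp => ⟨_, ht, hp⟩
  -- The jets of the local interpolants fit together.
  have jet2 : ∀ {t}, t ∈ Δ.triangles → ∀ {p}, p ∈ convexHull ℝ (t : Set Plane) → ∀ k ≤ 2,
      iteratedFDeriv ℝ k (g (T p)) p = iteratedFDeriv ℝ k (g t) p := by
    intro t ht p hp k hk
    obtain ⟨h1, h2⟩ := hT p (hreg ht hp)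
    by_cases he : T p = t
    · rw [he]
    · exact (hg _ h1).eq_on_inter h1 ht (hg _ ht) he h2 hp k hk
  let s : Plane → ℝ := fun p => if p ∈ Δ.region then g (T p) p else 0
  let J : Plane → FormalMultilinearSeries ℝ Plane ℝ := fun p => ftaylorSeries ℝ (g (T p)) p
  have hs : ∀ {t}, t ∈ Δ.triangles → EqOn s (g t) (convexHull ℝ (t : Set Plane)) := by
    intro t ht p hp
    have := congrArg (fun L => L 0) (jet2 ht hp 0 (by norm_num))
    simp only [iteratedFDeriv_zero_apply] at this
    simp only [s, if_pos (hreg ht hp), this]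
  have hJ : ∀ {t}, t ∈ Δ.triangles → ∀ {m : ℕ}, m ≤ 2 →
      EqOn (fun p => J p m) (iteratedFDeriv ℝ m (g t)) (convexHull ℝ (t : Set Plane)) :=
    fun ht m hm p hp => jet2 ht hp m hm
  have hgd : ∀ {t}, t ∈ Δ.triangles → ∀ {m : ℕ}, m < 3 → ∀ p, HasFDerivAt
      (iteratedFDeriv ℝ m (g t)) (iteratedFDeriv ℝ (m + 1) (g t) p).curryLeft p := by
    intro t ht m hm p
    have := (contDiff_iff_ftaylorSeries.1 (hg t ht).contDiff).fderiv m (by exact_mod_cast hm) p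
    exact this
  -- Derivatives of the glued jets; for `m = 2` the triangles need not agree on the third derivative
  -- except at the vertices, so that the common value `L` is a hypothesis.
  have hJd : ∀ {m : ℕ}, m ≤ 2 → ∀ p ∈ Δ.region, ∀ L : Plane [×(m + 1)]→L[ℝ] ℝ,
      (∀ t ∈ Δ.triangles, p ∈ convexHull ℝ (t : Set Plane) →
        iteratedFDeriv ℝ (m + 1) (g t) p = L) →
      HasFDerivWithinAt (fun p => J p m) L.curryLeft Δ.region p := by
    intro m hm p hp L hL
    refine Δ.hasFDerivWithinAt_region fun t ht hpt => ?_
    rw [← hL t ht hpt]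
    exact ((hgd ht (by omega) p).hasFDerivWithinAt).congr (fun q hq => hJ ht hm hq)
      (hJ ht hm hpt)
  have htaylor : HasFTaylorSeriesUpToOn 2 s J Δ.region := by
    refine ⟨fun p hp => ?_, fun m hm p hp => ?_, fun m hm p hp => ?_⟩
    · simp only [J, s, if_pos hp]
      rfl
    · have hm' : m < 2 := by exact_mod_cast hm
      exact hJd hm'.le p hp (J p (m + 1)) fun t ht hpt => (hJ ht (m := m + 1) hm' hpt).symm
    · have hm' : m ≤ 2 := by exact_mod_cast hm
      refine Δ.continuousWithinAt_region fun t ht hpt => ?_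
      exact ((hgd ht (m := m) (by omega) p).continuousAt.continuousWithinAt).congr
        (fun q hq => hJ ht hm' hq) (hJ ht hm' hpt)
  have hder : ∀ {m : ℕ}, m ≤ 2 → EqOn (iteratedFDerivWithin ℝ m s Δ.region)
      (fun p => J p m) Δ.region := fun hm p hp =>
    (htaylor.eq_iteratedFDerivWithin_of_uniqueDiffOn (by exact_mod_cast hm) hΩ hp).symm
  have hvertex : ∀ v ∈ Δ.vertices, ∀ t ∈ Δ.triangles, v ∈ convexHull ℝ (t : Set Plane) →
      HasFDerivWithinAt (iteratedFDerivWithin ℝ 2 s Δ.region)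
        (iteratedFDeriv ℝ 3 (g t) v).curryLeft Δ.region v := by
    intro v hv t ht hvt
    have hvΩ := Δ.vertex_mem_region hv
    refine (hJd le_rfl v hvΩ (iteratedFDeriv ℝ 3 (g t) v) fun t' ht' hvt' => ?_).congr
      (hder le_rfl) (hder le_rfl hvΩ)
    exact (hg t' ht').eq_at_vertex ht' ht (hg t ht) (Δ.mem_of_vertex_mem ht' hv hvt')
      (Δ.mem_of_vertex_mem ht hv hvt) 3 le_rfl
  have hC2 : ContDiffOn ℝ 2 s Δ.region := by
    have := htaylor.contDiffOn
    exact_mod_cast this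
  refine ⟨s, ⟨fun p hp => if_neg hp, fun t ht K hK => ?_, hC2, fun t ht => ?_, fun v hv => ?_⟩,
    fun i => ?_⟩
  · obtain ⟨F, ⟨p, hp, hpF⟩, hF⟩ := (hg t ht).poly K hK
    exact ⟨p, hp, fun q hq => by
      rw [hs ht (Δ.subset_of_mem_splitCells ht hK hq), hF hq, hpF]⟩
  · exact (hg t ht).contDiff.contDiffOn.congr (hs ht)
  · obtain ⟨t, ht, hvt⟩ := Δ.vertex_mem_region hv
    exact ⟨hC2 v (Δ.vertex_mem_region hv), (hvertex v hv t ht hvt).differentiableWithinAt⟩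
  · obtain ⟨t, ht, hit⟩ := dofPoint_mem i
    rw [← (hg t ht).data i hit]
    refine dofEval_congr d i ?_
    rw [iteratedFDerivWithin_univ]
    have h2 : dofOrder i ≤ 2 → iteratedFDerivWithin ℝ (dofOrder i) s Δ.region (dofPoint i)
        = iteratedFDeriv ℝ (dofOrder i) (g t) (dofPoint i) := fun h2 => by
      rw [hder h2 (dofPoint_mem i)]
      exact hJ ht h2 hit
    rcases Nat.lt_or_ge 2 (dofOrder i) with h3 | h3
    · have hv := (dofOrder_le_two_or_mem_vertices i).resolve_left (by omega)
      have h3' : dofOrder i = 3 := le_antisymm (dofOrder_le i) h3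
      rw [h3']
      ext m
      rw [iteratedFDerivWithin_succ_apply_left,
        (hvertex _ hv t ht hit).fderivWithin (hΩ _ (dofPoint_mem i))]
      rfl
    · exact h2 h3

/-! ### The spline space and its dual -/

theorem timesDiff_dofOrder {Δ : Triangulation} (i : Dof Δ) :
    ∀ s ∈ splineSpace Δ, TimesDiffWithinAt (dofOrder i) s Δ.region (dofPoint i) := by
  cases i with
  | vertex v k j => exact timesDiff_vertex Δ v.2 (Nat.le_of_lt_succ k.2)
  | mid e => exact timesDiff_of_mem_splineSpace Δ (edgeMidpoint_mem e.2) (by simp [dofOrder])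
  | quarter e a => exact timesDiff_of_mem_splineSpace Δ (edgeQuarterpoint_mem e.2 a.2) le_rfl

/-- A spline vanishes on a triangle as soon as the degrees of freedom carried by the triangle
vanish. -/
theorem eqOn_zero_of_dofFunctional_eq_zero {Δ : Triangulation} (d : CrossDirections Δ)
    {t : Finset Plane} (ht : t ∈ Δ.triangles) (s : splineSpace Δ)
    (h : ∀ i : Dof Δ, dofPoint i ∈ convexHull ℝ (t : Set Plane) →
      (dofFunctional Δ d i).functional s = 0) :
    EqOn (s : Plane → ℝ) 0 (convexHull ℝ (t : Set Plane)) := by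
  obtain ⟨-, hpoly, -, h3, -⟩ := s.2
  refine eq_zero_of_dofEval_eq_zero d ht (h3 t ht) (fun K hK => ?_) fun i hi => ?_
  · obtain ⟨p, hp, hpK⟩ := hpoly t ht K hK
    exact ⟨_, ⟨p, hp, fun _ => rfl⟩, hpK⟩
  · rw [← h i hi, dofFunctional_apply]
    refine (dofEval_congr d i ?_).symm
    exact iteratedFDerivWithin_subset_of_timesDiff (Δ.convexHull_subset_region ht)
      (Δ.uniqueDiffOn_convexHull ht) Δ.uniqueDiffOn_region hi (timesDiff_dofOrder i s s.2)

theorem eq_zero_of_dofFunctional_eq_zero {Δ : Triangulation} (d : CrossDirections Δ)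
    (s : splineSpace Δ) (h : ∀ i, (dofFunctional Δ d i).functional s = 0) : s = 0 := by
  ext x
  by_cases hx : x ∈ Δ.region
  · obtain ⟨t, ht, hxt⟩ := hx
    exact eqOn_zero_of_dofFunctional_eq_zero d ht s (fun i _ => h i) hxt
  · exact s.2.1 x hx

/-- The splines are parametrized by the values of their degrees of freedom. -/
def dofEquiv {Δ : Triangulation} (d : CrossDirections Δ) : splineSpace Δ ≃ₗ[ℝ] (Dof Δ → ℝ) :=
  LinearEquiv.ofBijective (LinearMap.pi fun i => (dofFunctional Δ d i).functional) <| by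
    refine ⟨(injective_iff_map_eq_zero _).2 fun s hs =>
      eq_zero_of_dofFunctional_eq_zero d s (congrFun hs), fun y => ?_⟩
    obtain ⟨s, hs, hsy⟩ := exists_interpolant d y
    exact ⟨⟨s, hs⟩, funext fun i => (dofFunctional_apply d i _).trans (hsy i)⟩

/-- The basis of the spline space dual to the degrees of freedom. -/
def nodalBasis {Δ : Triangulation} (d : CrossDirections Δ) :
    Module.Basis (Dof Δ) ℝ (splineSpace Δ) :=
  .ofEquivFun (dofEquiv d)

theorem nodalBasis_coord {Δ : Triangulation} (d : CrossDirections Δ) (i : Dof Δ) :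
    (nodalBasis d).coord i = (dofFunctional Δ d i).functional := rfl

theorem dofFunctional_injective {Δ : Triangulation} (d : CrossDirections Δ) :
    Function.Injective (dofFunctional Δ d) := by
  intro i j hij
  have h := congrArg (fun ℓ => ℓ.functional (nodalBasis d i)) hij
  simp only [← nodalBasis_coord] at h
  by_contra hne
  simp [hne] at h

theorem isNodalMinimalDeterminingSet_dofSet {Δ : Triangulation} (d : CrossDirections Δ) :
    IsNodalMinimalDeterminingSet (dofSet Δ d) := by
  refine ⟨fun s hs => eq_zero_of_dofFunctional_eq_zero d s fun i => hs _ ⟨i, rfl⟩,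
    fun Λ' hΛ' => ?_⟩
  rcases Λ'.finite_or_infinite with hfin | hinf
  · have := hfin.fintype
    have := Fintype.ofFinite (Dof Δ)
    -- A finite determining set embeds the spline space into a space of dimension `#Λ'`.
    let Ψ : splineSpace Δ →ₗ[ℝ] (Λ' → ℝ) := LinearMap.pi fun ℓ => ℓ.1.functional
    have hΨ : Function.Injective Ψ := (injective_iff_map_eq_zero _).2 fun s hs =>
      hΛ' s fun ℓ hℓ => congrFun hs ⟨ℓ, hℓ⟩
    have h := LinearMap.finrank_le_finrank_of_injective hΨ
    rw [Module.finrank_eq_card_basis (nodalBasis d), Module.finrank_pi] at h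
    rw [dofSet, ← image_univ, (dofFunctional_injective d).encard_image, encard_univ,
      ENat.card_eq_coe_fintype_card, ← coe_fintypeCard]
    exact_mod_cast h
  · simp [hinf.encard_eq]

theorem carriedBy_dofSet {Δ : Triangulation} (d : CrossDirections Δ) (t : Finset Plane) :
    carriedBy (dofSet Δ d) t
      = dofFunctional Δ d '' {i | dofPoint i ∈ convexHull ℝ (t : Set Plane)} := by
  ext ℓ
  constructor
  · rintro ⟨⟨i, rfl⟩, hi⟩
    rw [dofFunctional_carrier] at hi
    exact ⟨i, hi, rfl⟩
  · rintro ⟨i, hi, rfl⟩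
    exact ⟨⟨i, rfl⟩, (dofFunctional_carrier d i).symm ▸ hi⟩

theorem isMacroElement_splineSpace {Δ : Triangulation} (d : CrossDirections Δ) :
    IsMacroElement Δ (splineSpace Δ) (dofSet Δ d) := by
  refine ⟨isNodalMinimalDeterminingSet_dofSet d, fun t ht s s' h x hx => ?_⟩
  rw [carriedBy_dofSet] at h
  have := eqOn_zero_of_dofFunctional_eq_zero d ht (s - s')
    (fun i hi => by rw [map_sub, h _ ⟨i, hi, rfl⟩, sub_self]) hx
  simpa [sub_eq_zero] using this

end PowellSabin

end

theorem theorem3p2 (Δ : Triangulation) (d : CrossDirections Δ) :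
    IsNodalMinimalDeterminingSet (dofSet Δ d) ∧
    (∀ t ∈ Δ.triangles, (carriedBy (dofSet Δ d) t).ncard = 39) ∧
    IsMacroElement Δ (splineSpace Δ) (dofSet Δ d) ∧
    (∃ b : Module.Basis (Dof Δ) ℝ (Module.Dual ℝ (splineSpace Δ)),
      ∀ i, b i = (dofFunctional Δ d i).functional) ∧
    (∃ b : Module.Basis (Dof Δ) ℝ (splineSpace Δ),
      ∀ i, (dofFunctional Δ d i).functional (b i) = 1 ∧
        ∀ j, j ≠ i → (dofFunctional Δ d j).functional (b i) = 0) := by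
  classical
  refine ⟨isNodalMinimalDeterminingSet_dofSet d, fun t ht => ?_, isMacroElement_splineSpace d,
    ⟨(nodalBasis d).dualBasis, fun i => ?_⟩, nodalBasis d, fun i => ⟨?_, fun j hji => ?_⟩⟩
  · rw [carriedBy_dofSet, ncard_image_of_injective _ (dofFunctional_injective d), ncard_dof ht]
  · rw [Module.Basis.coe_dualBasis, nodalBasis_coord]
  · simp [← nodalBasis_coord]
  · simp [← nodalBasis_coord, hji.symm]
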